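/- **Setting.** Let $\mathbb F$ be a field. The 0-Hecke algebra $H_W(0)$ of a finite Coxeter system $(W,S)$ is the $\mathbb F$-algebra generated by $\pi_s$ ($s\in S$) subject to $\pi_s^2=\pi_s$ and the braid relations of $W$; put $\overline\pi_s=\pi_s-1$, and for a reduced word $w=s_1\cdots s_k$ put $\pi_w=\pi_{s_1}\cdots\pi_{s_k}$, $\overline\pi_w=\overline\pi_{s_1}\cdots\overline\pi_{s_k}$. For $I\subseteq S$ let $w_0(I)$ be the longest element of the parabolic subgroup generated by $I$, and for $I,J\subseteq S$ define the left ideals $\mathcal P_I^S=H_W(0)\,\overline\pi_{w_0(I)}\pi_{w_0(S\setminus I)}$ and $\mathcal P_{I,J}^S=H_W(0)\,\overline\pi_{w_0(I)}\pi_{w_0(J\setminus I)}$. For $n\ge 2$ let $\mathfrak S^D_n$ be the group of signed permutations $w$ of $[n]$ with an even number of negative values among $w(1),\dots,w(n)$, with Coxeter generators $s_0=\bar2\,\bar1\,3\cdots n$ and $s_i=(i,i+1)(-i,-(i+1))$, $1\le i\le n-1$. Its descent sets are $D(w)=\{0\le i\le n-1: w(i)>w(i+1)\}$ with $w(0):=-w(2)$.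 Let $H^D_n(0)$ be its 0-Hecke algebra, and let $H_m(0)$ be the 0-Hecke algebra of the symmetric group $\mathfrak S_m$. A *pseudo-composition* is a sequence $\alpha=(\alpha_1,\dots,\alpha_\ell)$, $\ell\ge1$, of integers with $\alpha_1\ge 0$ and $\alpha_2,\dots,\alpha_\ell>0$; it is a *composition* if also $\alpha_1>0$. Its size is $|\alpha|=\sum\alpha_i$ and $D(\alpha)=\{\alpha_1,\alpha_1+\alpha_2,\dots,\alpha_1+\cdots+\alpha_{\ell-1}\}$. For a pseudo-composition $\alpha$ and a composition $\beta=(\beta_1,\dots,\beta_k)$ put $\alpha\cdot\beta=(\alpha_1,\dots,\alpha_\ell,\beta_1,\dots,\beta_k)$ and $\alpha\rhd\beta=(\alpha_1,\dots,\alpha_{\ell-1},\alpha_\ell+\beta_1,\beta_2,\dots,\beta_k)$. A composition is identified with its ribbon (rows of lengths $\alpha_1,\alpha_2,\dots$ from bottom to top, the first box of each row directly above the last box of the row below it). A pseudo-composition is identified with its pseudo-ribbon, in which there is in addition an extra $0$-box, placed to the left of the bottom row if $\alpha_1>0$, and below the first box of the ribbon of $(\alpha_2,\dots,\alpha_\ell)$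 if $\alpha_1=0$. A *generalized pseudo-ribbon* $\alpha=\alpha^1\oplus\cdots\oplus\alpha^k$ ($k\ge1$) is a skew diagram whose components are a pseudo-ribbon $\alpha^1$ of size $n_1\ge0$ and ribbons $\alpha^2,\dots,\alpha^k$ of sizes $n_2,\dots,n_k\ge1$, each component lying strictly northeast of the previous one; its size is $n=n_1+\cdots+n_k$. Let $[\alpha]$ be the set of all pseudo-compositions $\alpha^1*\alpha^2*\cdots*\alpha^k$ (evaluated from left to right) in which each $*$ is $\cdot$ or $\rhd$. Let $\alpha$ be a generalized pseudo-ribbon of size $n\ge2$. A *type D standard tableau* $\tau$ of shape $\alpha$ is a filling of the boxes of $\alpha$ other than the $0$-box whose reading word $w(\tau)$ (rows from bottom to top, each from left to right) lies in $\mathfrak S^D_n$, and whose rows increase from left to right and columns increase from top to bottom when the $0$-box is included with entry $-w(2)$, where $w=w(\tau)$. Let $s_i(\tau)$ be the filling with reading word $s_i\,w(\tau)$. Let $\mathbf P^D_\alpha$ be the $\mathbb F$-vector space with basis all type D standard tableaux of shape $\alpha$, and for $0\le i\le n-1$ set $$\overline\pi_i(\tau)=\begin{cases}-\tau,& i\in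 D(w(\tau)^{-1}),\\ 0,& i\notin D(w(\tau)^{-1})\text{ and } s_i(\tau)\text{ is not type D standard},\\ s_i(\tau),& i\notin D(w(\tau)^{-1})\text{ and } s_i(\tau)\text{ is type D standard}.\end{cases}\qquad(\ast)$$ For a composition $\beta$ of $m$, let $\mathbf P_\beta$ be the $\mathbb F$-vector space with basis the standard tableaux $\tau$ of ribbon shape $\beta$ (fillings with $1,\dots,m$, rows increasing from left to right, columns increasing from top to bottom), and for $1\le i\le m-1$ let $\overline\pi_i(\tau)$ be $-\tau$, $0$ or $s_i(\tau)$ (the tableau with $i$ and $i+1$ interchanged) according as $i$ is in a higher row than, in the same row as, or in a lower row than $i+1$. $\qquad(\ast\ast)$ **Theorem.** (i) Let $\alpha$ be a pseudo-composition of $n\ge2$. Then $(\ast)$ defines an $H^D_n(0)$-module structure on $\mathbf P^D_\alpha$, and $\mathbf P^D_\alpha\cong\mathcal P_I^S$, where $I=\{s_i:i\in D(\alpha)\}$. (ii) Let $\alpha=\alpha^1\oplus\cdots\oplus\alpha^k$ be a generalized pseudo-ribbon of size $n\ge2$, with $n_i=|\alpha^i|$. Let $$I=\{s_i:i\in D(\alpha^1\rhd\cdots\rhd\alpha^k)\},\qquad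 J=\{s_j:j\in D(0\cdot1^{n_1}\rhd1^{n_2}\rhd\cdots\rhd1^{n_k})\}.$$ Then $(\ast)$ defines an $H^D_n(0)$-module structure on $\mathbf P^D_\alpha$, and as $H^D_n(0)$-modules $$\mathbf P^D_\alpha\;\cong\;\mathcal P_{I,J}^S\;\cong\;\bigoplus_{\beta\in[\alpha]}\mathbf P^D_\beta .$$ If in addition $n_1\ge2$, then $(\ast\ast)$ defines an $H_{n_b}(0)$-module structure on $\mathbf P_{\alpha^b}$ for $b=2,\dots,k$; the algebra map $H^D_{n_1}(0)\otimes H_{n_2}(0)\otimes\cdots\otimes H_{n_k}(0)\to H^D_n(0)$ that sends the generator $\pi_i$ of the first factor to $\pi_i$ and the generator $\pi_i$ of the $b$-th factor ($b\ge2$) to $\pi_{n_1+\cdots+n_{b-1}+i}$ is injective, with image the parabolic subalgebra $H^D_{n_1,\dots,n_k}(0)$ generated by $\{\pi_j: s_j\in J\}$; and, with respect to this embedding, $$\mathbf P^D_\alpha\;\cong\;\bigl(\mathbf P^D_{\alpha^1}\otimes\mathbf P_{\alpha^2}\otimes\cdots\otimes\mathbf P_{\alpha^k}\bigr)\big\uparrow_{H^D_{n_1,\dots,n_k}(0)}^{H^D_n(0)}:=H^D_n(0)\otimes_{H^D_{n_1,\dots,n_k}(0)}\bigl(\mathbf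 P^D_{\alpha^1}\otimes\mathbf P_{\alpha^2}\otimes\cdots\otimes\mathbf P_{\alpha^k}\bigr).$$ -/

import Mathlib

open scoped TensorProduct DirectSum

noncomputable section

/-! ### 0-Hecke algebras -/

/-- The alternating product `a * b * a * ⋯` with `m` factors. -/
def altProd {A : Type*} [Monoid A] : ℕ → A → A → A
  | 0, _, _ => 1
  | m + 1, a, b => a * altProd m b a

theorem map_altProd {A A' G : Type*} [Monoid A] [Monoid A'] [FunLike G A A']
    [MonoidHomClass G A A'] (f : G) (m : ℕ) (a b : A) :
    f (altProd m a b) = altProd m (f a) (f b) := by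
  induction m generalizing a b with
  | zero => simp [altProd]
  | succ m ih => simp [altProd, ih]

section Hecke

variable (F : Type*) [Field F] {B : Type*} (M : CoxeterMatrix B)

/-- Defining relations of the 0-Hecke algebra: `π_s² = π_s` and the braid relations. -/
inductive HeckeRel : FreeAlgebra F B → FreeAlgebra F B → Prop
  | quad (s : B) : HeckeRel (FreeAlgebra.ι F s * FreeAlgebra.ι F s) (FreeAlgebra.ι F s)
  | braid (s t : B) :
      HeckeRel (altProd (M s t) (FreeAlgebra.ι F s) (FreeAlgebra.ι F t))
        (altProd (M s t) (FreeAlgebra.ι F t) (FreeAlgebra.ι F s))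

/-- The 0-Hecke algebra over `F` of the Coxeter matrix `M`. -/
def HeckeZero : Type _ := RingQuot (HeckeRel F M)

instance : Ring (HeckeZero F M) := inferInstanceAs (Ring (RingQuot (HeckeRel F M)))

instance : Algebra F (HeckeZero F M) := inferInstanceAs (Algebra F (RingQuot (HeckeRel F M)))

namespace HeckeZero

variable {M}

/-- The generator `π_s`. -/
def gen (s : B) : HeckeZero F M :=
  (RingQuot.mkAlgHom F (HeckeRel F M) (FreeAlgebra.ι F s) : RingQuot (HeckeRel F M))

/-- The generator `π̄_s = π_s - 1`. -/
def genBar (s : B) : HeckeZero F M := gen F s - 1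

theorem gen_mul_self (s : B) : gen F s * gen F s = (gen F s : HeckeZero F M) := by
  have h := RingQuot.mkAlgHom_rel F (HeckeRel.quad (F := F) (M := M) s)
  rw [map_mul] at h
  exact h

theorem gen_braid (s t : B) :
    altProd (M s t) (gen F s) (gen F t) =
      (altProd (M s t) (gen F t) (gen F s) : HeckeZero F M) := by
  have h := RingQuot.mkAlgHom_rel F (HeckeRel.braid (F := F) (M := M) s t)
  rw [map_altProd, map_altProd] at h
  exact h

variable {F}

/-- The universal property of the 0-Hecke algebra. -/
def lift {A : Type*} [Ring A] [Algebra F A] (f : B → A) (hq : ∀ s, f s * f s = f s)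
    (hb : ∀ s t, altProd (M s t) (f s) (f t) = altProd (M s t) (f t) (f s)) :
    HeckeZero F M →ₐ[F] A :=
  RingQuot.liftAlgHom F ⟨FreeAlgebra.lift F f, by
    rintro x y (s | ⟨s, t⟩)
    · simpa using hq s
    · simpa [map_altProd] using hb s t⟩

theorem lift_gen {A : Type*} [Ring A] [Algebra F A] (f : B → A) (hq : ∀ s, f s * f s = f s)
    (hb : ∀ s t, altProd (M s t) (f s) (f t) = altProd (M s t) (f t) (f s)) (s : B) :
    lift f hq hb (gen F s : HeckeZero F M) = f s := by
  unfold lift gen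
  refine (RingQuot.liftAlgHom_mkAlgHom_apply F _ _ _).trans ?_
  simp

theorem adjoin_gen : Algebra.adjoin F (Set.range (gen F : B → HeckeZero F M)) = ⊤ := by
  have h1 : (RingQuot.mkAlgHom F (HeckeRel F M)).range = ⊤ :=
    (AlgHom.range_eq_top _).2 (RingQuot.mkAlgHom_surjective F _)
  have h2 := FreeAlgebra.adjoin_range_ι (R := F) (X := B)
  have h3 := congrArg (Subalgebra.map (RingQuot.mkAlgHom F (HeckeRel F M))) h2
  rw [AlgHom.map_adjoin, Algebra.map_top, h1, ← Set.range_comp] at h3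
  exact h3

/-- The algebra map `π_s ↦ π_{f s}` induced by a map of Coxeter diagrams. -/
def map {B' : Type*} {M' : CoxeterMatrix B'} (f : B → B')
    (hf : ∀ s t, M' (f s) (f t) = M s t) : HeckeZero F M →ₐ[F] HeckeZero F M' :=
  lift (fun s => gen F (f s)) (fun s => gen_mul_self F (f s))
    (fun s t => by rw [← hf s t]; exact gen_braid F (f s) (f t))

theorem commute_map {B' B₁ : Type*} {M' : CoxeterMatrix B'} {M₁ : CoxeterMatrix B₁}
    (f : B → B') (hf : ∀ s t, M' (f s) (f t) = M s t)
    (g : B₁ → B') (hg : ∀ s t, M' (g s) (g t) = M₁ s t)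
    (hc : ∀ s t, M' (f s) (g t) = 2) (x : HeckeZero F M) (y : HeckeZero F M₁) :
    Commute (map f hf x) (map g hg y) := by
  have hx : x ∈ Algebra.adjoin F (Set.range (gen F : B → HeckeZero F M)) := by
    rw [adjoin_gen]; trivial
  have hy : y ∈ Algebra.adjoin F (Set.range (gen F : B₁ → HeckeZero F M₁)) := by
    rw [adjoin_gen]; trivial
  induction hx using Algebra.adjoin_induction with
  | algebraMap r => rw [AlgHom.commutes]; exact Algebra.commute_algebraMap_left r _
  | add a b _ _ ha hb => rw [map_add]; exact ha.add_left hb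
  | mul a b _ _ ha hb => rw [map_mul]; exact ha.mul_left hb
  | mem a ha =>
    obtain ⟨s, rfl⟩ := ha
    induction hy using Algebra.adjoin_induction with
    | algebraMap r => rw [AlgHom.commutes]; exact Algebra.commute_algebraMap_right r _
    | add a b _ _ ha hb => rw [map_add]; exact ha.add_right hb
    | mul a b _ _ ha hb => rw [map_mul]; exact ha.mul_right hb
    | mem b hb =>
      obtain ⟨t, rfl⟩ := hb
      have h := gen_braid (M := M') F (f s) (g t)
      rw [hc s t] at h
      simp only [map, lift_gen]
      simpa [altProd, Commute, SemiconjBy] using h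

open Classical in
/-- The representation of the 0-Hecke algebra on `V` in which each `π̄_s` acts by the prescribed
operator `T s`. (It is unique if it exists; otherwise every `π̄_s` acts by `0`.) -/
def rep (M : CoxeterMatrix B) {V : Type*} [AddCommGroup V] [Module F V]
    (T : B → Module.End F V) : HeckeZero F M →ₐ[F] Module.End F V :=
  if h : ∃ ρ : HeckeZero F M →ₐ[F] Module.End F V, ∀ s, ρ (genBar F s) = T s then h.choose
  else lift (fun _ => 1) (fun _ => mul_one 1) (fun _ _ => rfl)

end HeckeZero

/-! ### The modules `P_{I,J}^S`

Below `W` is a group with generators `gs s`, `s ∈ S`, and `M` is the Coxeter matrix. -/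

variable {W : Type*} [Group W] (gs : B → W)

/-- The length of `w` with respect to the generators. -/
def wordLength (w : W) : ℕ := sInf {k | ∃ l : List B, l.length = k ∧ (l.map gs).prod = w}

/-- `w` is a longest element of the parabolic subgroup `W_I`. -/
def IsLongest (I : Set B) (w : W) : Prop :=
  w ∈ Subgroup.closure (gs '' I) ∧
    ∀ u ∈ Subgroup.closure (gs '' I), wordLength gs u ≤ wordLength gs w

/-- The longest element `w₀(I)` of the parabolic subgroup `W_I`. -/
def longest (I : Set B) : W := Classical.epsilon (IsLongest gs I)

/-- A reduced word of `w`. -/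
def reducedWord (w : W) : List B :=
  Classical.epsilon fun l : List B => (l.map gs).prod = w ∧ l.length = wordLength gs w

/-- `π_w`. -/
def piW (w : W) : HeckeZero F M := ((reducedWord gs w).map (HeckeZero.gen F)).prod

/-- `π̄_w`. -/
def piBarW (w : W) : HeckeZero F M := ((reducedWord gs w).map (HeckeZero.genBar F)).prod

/-- `P_{I,J}^S`, the left ideal generated by `π̄_{w₀(I)} π_{w₀(J ∖ I)}`. -/
def moduleIJ (I J : Set B) : Submodule (HeckeZero F M) (HeckeZero F M) :=
  Submodule.span (HeckeZero F M)
    {piBarW F M gs (longest gs I) * piW F M gs (longest gs (J \ I))}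

/-- `P_I^S`, the left ideal generated by `π̄_{w₀(I)} π_{w₀(Iᶜ)}`. -/
def moduleI (I : Set B) : Submodule (HeckeZero F M) (HeckeZero F M) :=
  Submodule.span (HeckeZero F M)
    {piBarW F M gs (longest gs I) * piW F M gs (longest gs Iᶜ)}

end Hecke

/-! ### Induction along an algebra map -/

section Induction

variable {F A H : Type*} [Field F] [Ring A] [Algebra F A] [Ring H] [Algebra F H]
  (φ : A →ₐ[F] H) (N : Type*) [AddCommGroup N] [Module F N] [Module A N]

/-- `H ⊗_A N`, where `A` acts on `H` from the right through `φ`: the quotient of `H ⊗_F N` by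
the relations `h φ(a) ⊗ v = h ⊗ a v`, with `H` acting by left multiplication. -/
abbrev Induced : Type _ :=
  (H ⊗[F] N) ⧸ Submodule.span H
    {x : H ⊗[F] N | ∃ (h : H) (a : A) (v : N), x = (h * φ a) ⊗ₜ[F] v - h ⊗ₜ[F] (a • v)}

end Induction

/-! ### Compositions and (generalized) pseudo-ribbons -/

/-- The descent set `{α₁, α₁ + α₂, …, α₁ + ⋯ + α_{ℓ-1}}` of a sequence `(α₁, …, α_ℓ)`. -/
def descents (l : List ℕ) : Finset ℕ :=
  (Finset.Ico 1 l.length).image fun k => (l.take k).sum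

/-- A nonempty composition, i.e. a ribbon. -/
@[ext]
structure Ribbon where
  first : ℕ
  rest : List ℕ
  first_pos : 0 < first
  rest_pos : ∀ a ∈ rest, 0 < a

/-- A pseudo-composition, i.e. a pseudo-ribbon. -/
@[ext]
structure PseudoRibbon where
  first : ℕ
  rest : List ℕ
  rest_pos : ∀ a ∈ rest, 0 < a

namespace Ribbon

def parts (β : Ribbon) : List ℕ := β.first :: β.rest

def size (β : Ribbon) : ℕ := β.parts.sum

theorem size_pos (β : Ribbon) : 0 < β.size := by
  have := β.first_pos
  simp only [size, parts, List.sum_cons]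
  omega

/-- The composition `1^m`, where `m` is the size of `β`. -/
def ones (β : Ribbon) : Ribbon where
  first := 1
  rest := List.replicate (β.size - 1) 1
  first_pos := one_pos
  rest_pos a ha := by rw [List.eq_of_mem_replicate ha]; exact one_pos

end Ribbon

namespace PseudoRibbon

def parts (α : PseudoRibbon) : List ℕ := α.first :: α.rest

def size (α : PseudoRibbon) : ℕ := α.parts.sum

/-- The pseudo-composition `0 · 1^m`, where `m` is the size of `α`. -/
def zeroOnes (α : PseudoRibbon) : PseudoRibbon where
  first := 0
  rest := List.replicate α.size 1
  rest_pos a ha := by rw [List.eq_of_mem_replicate ha]; exact one_pos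

/-- `α · β`. -/
def concat (α : PseudoRibbon) (β : Ribbon) : PseudoRibbon where
  first := α.first
  rest := α.rest ++ β.parts
  rest_pos a ha := by
    rw [Ribbon.parts, List.mem_append, List.mem_cons] at ha
    rcases ha with ha | rfl | ha
    · exact α.rest_pos a ha
    · exact β.first_pos
    · exact β.rest_pos a ha

/-- `α ▷ β`. -/
def nearConcat (α : PseudoRibbon) (β : Ribbon) : PseudoRibbon where
  first := if α.rest = [] then α.first + β.first else α.first
  rest := if h : α.rest = [] then β.rest
    else α.rest.dropLast ++ (α.rest.getLast h + β.first) :: β.rest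
  rest_pos a ha := by
    split_ifs at ha with h
    · exact β.rest_pos a ha
    · rw [List.mem_append, List.mem_cons] at ha
      rcases ha with ha | rfl | ha
      · exact α.rest_pos a (List.mem_of_mem_dropLast ha)
      · exact Nat.add_pos_right _ β.first_pos
      · exact β.rest_pos a ha

end PseudoRibbon

/-- A generalized pseudo-ribbon `α¹ ⊕ ⋯ ⊕ αᵏ`, with `head = α¹` and `tail = (α², …, αᵏ)`. -/
@[ext]
structure GenPseudoRibbon where
  head : PseudoRibbon
  tail : List Ribbon

namespace GenPseudoRibbon

def size (α : GenPseudoRibbon) : ℕ := α.head.size + (α.tail.map Ribbon.size).sum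

/-- `α¹ ▷ ⋯ ▷ αᵏ`. -/
def near (α : GenPseudoRibbon) : PseudoRibbon := α.tail.foldl PseudoRibbon.nearConcat α.head

/-- `0 · 1^{n₁} ▷ 1^{n₂} ▷ ⋯ ▷ 1^{nₖ}`, where `n_i = |αⁱ|`. -/
def nearOnes (α : GenPseudoRibbon) : PseudoRibbon :=
  (α.tail.map Ribbon.ones).foldl PseudoRibbon.nearConcat α.head.zeroOnes

/-- The set `[α]` of all pseudo-ribbons `α¹ * α² * ⋯ * αᵏ` with each `*` equal to `·` or `▷`. -/
def glue (α : GenPseudoRibbon) : Set PseudoRibbon :=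
  α.tail.foldl (fun S β => {γ | ∃ δ ∈ S, γ = δ.concat β ∨ γ = δ.nearConcat β}) {α.head}

/-- The total size of the components preceding the component `tail[b]`. -/
def offset (α : GenPseudoRibbon) (b : ℕ) : ℕ :=
  α.head.size + ((α.tail.map Ribbon.size).take b).sum

/-- With all boxes numbered in reading order, the indices `j` such that the boxes `j` and `j + 1`
lie in the same component and `j` is the last box of its row, i.e. such that box `j + 1` is
directly above box `j`. -/
def ups (α : GenPseudoRibbon) : Finset ℕ :=
  descents α.head.parts ∪ Finset.univ.biUnion fun b : Fin α.tail.length =>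
    (descents (α.tail.get b).parts).image (α.offset b + ·)

/-- The indices `j` such that box `j` is the last box of its component and is not the last box of
the diagram, i.e. the set `{n₁, n₁ + n₂, …, n₁ + ⋯ + n_{k-1}}`. -/
def breaks (α : GenPseudoRibbon) : Finset ℕ :=
  Finset.univ.image fun b : Fin α.tail.length => α.offset b

end GenPseudoRibbon

/-- A pseudo-ribbon is a generalized pseudo-ribbon with one component. -/
def PseudoRibbon.toGen (α : PseudoRibbon) : GenPseudoRibbon := ⟨α, []⟩

/-- The position `(row, column)` of the `j`-th box in reading order (rows from bottom to top, each
row from left to right; rows are numbered upwards and columns rightwards). Box `0` is the extra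
`0`-box. Box `j + 1` is directly above box `j` if `j ∈ V`, it is strictly northeast of box `j`
(a new component starts) if `j ∈ K`, and otherwise it is the right neighbour of box `j`. -/
def box (V K : Finset ℕ) : ℕ → ℕ × ℕ
  | 0 => (0, 0)
  | j + 1 =>
    let p := box V K j
    if j ∈ V then (p.1 + 1, p.2) else if j ∈ K then (p.1 + 1, p.2 + 1) else (p.1, p.2 + 1)

/-- The filling of the boxes `0, 1, …` by `entry` is such that on the boxes with index in `X`
rows increase from left to right and columns increase from top to bottom. -/
def IsIncreasing (b : ℕ → ℕ × ℕ) (entry : ℕ → ℤ) (X : Set ℕ) : Prop :=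
  ∀ i ∈ X, ∀ j ∈ X,
    ((b i).1 = (b j).1 → (b i).2 < (b j).2 → entry i < entry j) ∧
    ((b i).2 = (b j).2 → (b i).1 < (b j).1 → entry j < entry i)

/-! ### Type D: signed permutations, tableaux, action

A signed permutation of `[n]` is encoded as a permutation of `ℤ` fixing every `x` with `|x| > n`;
its value at `0` is then `0`. -/

/-- The group of type `D_n`: signed permutations with an even number of negative values. -/
def typeDGroup (n : ℕ) : Set (Equiv.Perm ℤ) :=
  {w | (∀ x, w (-x) = -w x) ∧ (∀ x, (n : ℤ) < |x| → w x = x) ∧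
    Even ((Finset.Icc 1 n).filter fun j : ℕ => w j < 0).card}

/-- The generators `s₀ = 2̄ 1̄ 3 ⋯ n` and `s_i = (i, i+1)(-i, -(i+1))`. -/
def sD (i : ℕ) : Equiv.Perm ℤ :=
  if i = 0 then Equiv.swap 1 (-2) * Equiv.swap 2 (-1)
  else Equiv.swap (i : ℤ) (i + 1) * Equiv.swap (-i : ℤ) (-(i + 1))

/-- The word `w(1) w(2) ⋯` of `w` extended by `w(0) := -w(2)`. -/
def wordD (w : Equiv.Perm ℤ) (j : ℕ) : ℤ := if j = 0 then -w 2 else w j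

/-- The descent set of `w` in type `D_n`. -/
def descentsD (n : ℕ) (w : Equiv.Perm ℤ) : Set ℕ := {i | i < n ∧ wordD w (i + 1) < wordD w i}

/-- The Coxeter matrix of type `D_n`, with the labelling in which both `0` and `1` are joined
to `2`, and `i` is joined to `i + 1` for `i ≥ 2`. -/
def coxD (n : ℕ) : CoxeterMatrix (Fin n) where
  M := Matrix.of fun i j : Fin n =>
    if i = j then 1
    else if ((i : ℕ) = 0 ∧ (j : ℕ) = 2) ∨ ((j : ℕ) = 0 ∧ (i : ℕ) = 2) ∨
      ((i : ℕ) ≠ 0 ∧ (i : ℕ) + 1 = j) ∨ ((j : ℕ) ≠ 0 ∧ (j : ℕ) + 1 = i) then 3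
    else 2
  isSymm := by
    ext i j
    simp only [Matrix.transpose_apply, Matrix.of_apply]
    by_cases h : i = j
    · simp [h]
    · rw [if_neg h, if_neg (Ne.symm h)]
      congr 1
      simp only [eq_iff_iff]
      omega
  diagonal := by simp
  off_diagonal i j h := by
    simp only [Matrix.of_apply, if_neg h]
    split_ifs <;> omega

/-- The 0-Hecke algebra of type `D_n`. -/
abbrev HeckeD (F : Type*) [Field F] (n : ℕ) : Type _ := HeckeZero F (coxD n)

/-- The filling with reading word `w(1) ⋯ w(n)` is a type D standard tableau of shape `α`. -/
def IsTableauD (n : ℕ) (α : GenPseudoRibbon) (w : Equiv.Perm ℤ) : Prop :=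
  w ∈ typeDGroup n ∧
    IsIncreasing (box α.ups α.breaks) (wordD w) (Set.Icc 0 n)

/-- Type D standard tableaux of shape `α` (`n = |α|`), recorded by their reading words:
box `j` contains `w(j)`. -/
def TableauD (n : ℕ) (α : GenPseudoRibbon) : Type := {w : Equiv.Perm ℤ // IsTableauD n α w}

/-- The vector space `P^D_α` with basis the type D standard tableaux of shape `α`. -/
def PD (F : Type*) [Field F] (n : ℕ) (α : GenPseudoRibbon) : Type _ := TableauD n α →₀ F

section PD

variable (F : Type*) [Field F] (n : ℕ) (α : GenPseudoRibbon)

instance : AddCommGroup (PD F n α) := inferInstanceAs (AddCommGroup (TableauD n α →₀ F))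

instance : Module F (PD F n α) := inferInstanceAs (Module F (TableauD n α →₀ F))

variable {n α} in
/-- The basis vector of `P^D_α` given by a tableau. -/
def vecD (τ : TableauD n α) : PD F n α := (Finsupp.single τ 1 : TableauD n α →₀ F)

open Classical in
/-- The prescribed value of `π̄_i(τ)`; note that `s_i(τ)` has reading word `s_i w(τ)`. -/
def actD (i : ℕ) (τ : TableauD n α) : PD F n α :=
  if i ∈ descentsD n τ.1⁻¹ then -vecD F τ
  else if h : IsTableauD n α (sD i * τ.1) then vecD F ⟨sD i * τ.1, h⟩
  else 0

/-- The linear operator on `P^D_α` extending `actD`. -/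
def opD (i : Fin n) : Module.End F (PD F n α) :=
  (Finsupp.linearCombination F (actD F n α i) : (TableauD n α →₀ F) →ₗ[F] PD F n α)

/-- `P^D_α` as a module over the 0-Hecke algebra. -/
instance : Module (HeckeD F n) (PD F n α) :=
  Module.compHom (PD F n α) (HeckeZero.rep (coxD n) (opD F n α)).toRingHom

instance : IsScalarTower F (HeckeD F n) (PD F n α) where
  smul_assoc c h v := by
    change (HeckeZero.rep (coxD n) (opD F n α)) (c • h) v =
      c • (HeckeZero.rep (coxD n) (opD F n α)) h v
    rw [map_smul, LinearMap.smul_apply]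

end PD

/-! ### Type A: tableaux of ribbon shape and action -/

/-- Permutations of `[m]`, encoded as permutations of `ℤ` fixing everything outside `[m]`. -/
def typeAGroup (m : ℕ) : Set (Equiv.Perm ℤ) := {w | ∀ x, x ∉ Set.Icc 1 (m : ℤ) → w x = x}

/-- The adjacent transposition `s_i = (i, i+1)`. -/
def sA (i : ℕ) : Equiv.Perm ℤ := Equiv.swap (i : ℤ) (i + 1)

/-- The 0-Hecke algebra `H_m(0)` of type `A_{m-1}`; the generator with index `i : Fin (m - 1)`
is `π_{i+1}`. -/
abbrev HeckeA (F : Type*) [Field F] (m : ℕ) : Type _ := HeckeZero F (CoxeterMatrix.A (m - 1))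

/-- The position of the `j`-th box of a ribbon, `j = 1, …, |β|`. -/
def boxA (β : Ribbon) : ℕ → ℕ × ℕ := box (descents β.parts) ∅

/-- The filling with reading word `w(1) ⋯ w(m)` is a standard tableau of shape `β`. -/
def IsTableauA (m : ℕ) (β : Ribbon) (w : Equiv.Perm ℤ) : Prop :=
  w ∈ typeAGroup m ∧ IsIncreasing (boxA β) (fun j => w j) (Set.Icc 1 m)

/-- Standard tableaux of ribbon shape `β` (`m = |β|`), recorded by their reading words. -/
def TableauA (m : ℕ) (β : Ribbon) : Type := {w : Equiv.Perm ℤ // IsTableauA m β w}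

/-- The row of the tableau with reading word `w` in which the entry `x` appears. -/
def rowA (β : Ribbon) (w : Equiv.Perm ℤ) (x : ℕ) : ℕ := (boxA β (w⁻¹ x).toNat).1

/-- The vector space `P_β` with basis the standard tableaux of shape `β`. -/
def PA (F : Type*) [Field F] (m : ℕ) (β : Ribbon) : Type _ := TableauA m β →₀ F

section PA

variable (F : Type*) [Field F] (m : ℕ) (β : Ribbon)

instance : AddCommGroup (PA F m β) := inferInstanceAs (AddCommGroup (TableauA m β →₀ F))

instance : Module F (PA F m β) := inferInstanceAs (Module F (TableauA m β →₀ F))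

variable {m β} in
/-- The basis vector of `P_β` given by a tableau. -/
def vecA (τ : TableauA m β) : PA F m β := (Finsupp.single τ 1 : TableauA m β →₀ F)

open Classical in
/-- The prescribed value of `π̄_i(τ)`: it is `-τ` if `i` is in a higher row than `i + 1`, it is `0`
if they are in the same row, and it is `s_i(τ)` (which is then standard) if `i` is in a lower row
than `i + 1`. -/
def actA (i : ℕ) (τ : TableauA m β) : PA F m β :=
  if rowA β τ.1 (i + 1) < rowA β τ.1 i then -vecA F τ
  else if rowA β τ.1 i = rowA β τ.1 (i + 1) then 0
  else if h : IsTableauA m β (sA i * τ.1) then vecA F ⟨sA i * τ.1, h⟩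
  else 0

/-- The operator on `P_β` for the generator with index `i`, i.e. for `π̄_{i+1}`. -/
def opA (i : Fin (m - 1)) : Module.End F (PA F m β) :=
  (Finsupp.linearCombination F (actA F m β (i + 1)) : (TableauA m β →₀ F) →ₗ[F] PA F m β)

/-- `P_β` as a module over the 0-Hecke algebra of type A. -/
instance : Module (HeckeA F m) (PA F m β) :=
  Module.compHom (PA F m β) (HeckeZero.rep (CoxeterMatrix.A (m - 1)) (opA F m β)).toRingHom

instance : IsScalarTower F (HeckeA F m) (PA F m β) where
  smul_assoc c h v := by
    change (HeckeZero.rep (CoxeterMatrix.A (m - 1)) (opA F m β)) (c • h) v =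
      c • (HeckeZero.rep (CoxeterMatrix.A (m - 1)) (opA F m β)) h v
    rw [map_smul, LinearMap.smul_apply]

end PA

/-! ### The parabolic tensor product -/

theorem prod_ofFn_mul_of_commute {A : Type*} [Monoid A] {r : ℕ} (f g : Fin r → A)
    (h : ∀ i j, i ≠ j → Commute (f i) (g j)) :
    (List.ofFn fun i => f i * g i).prod = (List.ofFn f).prod * (List.ofFn g).prod := by
  induction r with
  | zero => simp
  | succ r ih =>
    have hc : Commute (g 0) (List.ofFn fun i => f (Fin.succ i)).prod :=
      Commute.list_prod_right _ _ fun z hz => by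
        obtain ⟨i, rfl⟩ := List.mem_ofFn.1 hz
        exact (h i.succ 0 (Fin.succ_ne_zero i)).symm
    have ih' := ih (fun i => f i.succ) (fun i => g i.succ)
      fun i j hij => h _ _ fun e => hij (Fin.succ_injective _ e)
    simp only [List.ofFn_succ, List.prod_cons, ih']
    rw [mul_assoc, ← mul_assoc (g 0), hc.eq]
    simp only [mul_assoc]

namespace GenPseudoRibbon

variable (F : Type*) [Field F] (α : GenPseudoRibbon)

theorem offset_succ (b : Fin α.tail.length) :
    α.offset (b + 1) = α.offset b + (α.tail.get b).size := by
  have h : (b : ℕ) < (α.tail.map Ribbon.size).length := by simp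
  simp [offset, List.take_add_one, add_assoc]

theorem offset_mono {b c : ℕ} (h : b ≤ c) : α.offset b ≤ α.offset c := by
  unfold offset
  gcongr
  exact (List.take_sublist_take_left h).sum_le_sum (by simp)

theorem offset_le_size (b : ℕ) : α.offset b ≤ α.size := by
  unfold offset size
  gcongr
  exact (List.take_sublist _ _).sum_le_sum (by simp)

/-- `H^D_{n₁}(0) ⊗ H_{n₂}(0) ⊗ ⋯ ⊗ H_{nₖ}(0)`. -/
abbrev ParAlg : Type _ :=
  HeckeD F α.head.size ⊗[F] (⨂[F] b : Fin α.tail.length, HeckeA F (α.tail.get b).size)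

theorem head_lt (i : Fin α.head.size) : (i : ℕ) < α.size :=
  i.2.trans_le (Nat.le_add_right _ _)

theorem tail_lt (b : Fin α.tail.length) (i : Fin ((α.tail.get b).size - 1)) :
    α.offset b + i + 1 < α.size := by
  have h1 := α.offset_succ b
  have h2 := α.offset_le_size (b + 1)
  have h3 := i.2
  omega

/-- `H^D_{n₁}(0) → H^D_n(0)`, `π_i ↦ π_i`. -/
def headHom : HeckeD F α.head.size →ₐ[F] HeckeD F α.size :=
  HeckeZero.map (fun i => ⟨i, α.head_lt i⟩) (by
    intro s t
    simp [coxD, Fin.ext_iff])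

/-- `H_{n_b}(0) → H^D_n(0)`, `π_i ↦ π_{n₁ + ⋯ + n_{b-1} + i}`. -/
def tailHom (b : Fin α.tail.length) :
    HeckeA F (α.tail.get b).size →ₐ[F] HeckeD F α.size :=
  HeckeZero.map (fun i => ⟨α.offset b + i + 1, α.tail_lt b i⟩) (by
    intro s t
    simp only [coxD, CoxeterMatrix.A, Matrix.of_apply, Fin.ext_iff]
    grind)

theorem commute_tail {b c : Fin α.tail.length} (h : b ≠ c)
    (x : HeckeA F (α.tail.get b).size) (y : HeckeA F (α.tail.get c).size) :
    Commute (α.tailHom F b x) (α.tailHom F c y) := by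
  refine HeckeZero.commute_map _ _ _ _ (fun s t => ?_) x y
  have hb := α.offset_succ b
  have hc := α.offset_succ c
  have hs := s.2
  have ht := t.2
  have h' : (b : ℕ) + 1 ≤ c ∨ (c : ℕ) + 1 ≤ b := by
    have := Fin.val_ne_of_ne h
    omega
  simp only [coxD, Matrix.of_apply, Fin.ext_iff]
  rcases h' with h' | h' <;> have := α.offset_mono h' <;> grind

theorem commute_head (h : 2 ≤ α.head.size) (b : Fin α.tail.length)
    (x : HeckeD F α.head.size) (y : HeckeA F (α.tail.get b).size) :
    Commute (α.headHom F x) (α.tailHom F b y) := by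
  refine HeckeZero.commute_map _ _ _ _ (fun s t => ?_) x y
  have hs := s.2
  have hb : α.head.size ≤ α.offset b := Nat.le_add_right _ _
  simp only [coxD, Matrix.of_apply, Fin.ext_iff]
  grind

/-- `H_{n₂}(0) ⊗ ⋯ ⊗ H_{nₖ}(0) → H^D_n(0)`, `a₂ ⊗ ⋯ ⊗ aₖ ↦ a₂ ⋯ aₖ`. -/
def tailsHom :
    (⨂[F] b : Fin α.tail.length, HeckeA F (α.tail.get b).size) →ₐ[F] HeckeD F α.size :=
  PiTensorProduct.liftAlgHom
    ((MultilinearMap.mkPiAlgebraFin F α.tail.length (HeckeD F α.size)).compLinearMap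
      fun b => (α.tailHom F b).toLinearMap)
    (by simp)
    (by
      intro x y
      simp only [MultilinearMap.compLinearMap_apply, MultilinearMap.mkPiAlgebraFin_apply,
        AlgHom.toLinearMap_apply, Pi.mul_apply, map_mul]
      exact prod_ofFn_mul_of_commute _ _ fun i j h => α.commute_tail F h _ _)

theorem tailsHom_tprod (a : ∀ b : Fin α.tail.length, HeckeA F (α.tail.get b).size) :
    α.tailsHom F (PiTensorProduct.tprod F a) = (List.ofFn fun b => α.tailHom F b (a b)).prod := by
  simp [tailsHom, PiTensorProduct.liftAlgHom]

theorem commute_tails (h : 2 ≤ α.head.size) (x : HeckeD F α.head.size)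
    (y : ⨂[F] b : Fin α.tail.length, HeckeA F (α.tail.get b).size) :
    Commute (α.headHom F x) (α.tailsHom F y) := by
  induction y using PiTensorProduct.induction_on with
  | smul_tprod r a =>
    rw [map_smul, tailsHom_tprod]
    refine Commute.smul_right (Commute.list_prod_right _ _ fun z hz => ?_) r
    obtain ⟨b, rfl⟩ := List.mem_ofFn.1 hz
    exact α.commute_head F h b _ _
  | add y z hy hz => rw [map_add]; exact hy.add_right hz

/-- The embedding `H^D_{n₁}(0) ⊗ H_{n₂}(0) ⊗ ⋯ ⊗ H_{nₖ}(0) → H^D_n(0)` onto the parabolic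
subalgebra, for `n₁ ≥ 2`: `a₁ ⊗ a₂ ⊗ ⋯ ⊗ aₖ ↦ a₁ a₂ ⋯ aₖ`. -/
def parHom (h : 2 ≤ α.head.size) : α.ParAlg F →ₐ[F] HeckeD F α.size :=
  Algebra.TensorProduct.lift (α.headHom F) (α.tailsHom F) (α.commute_tails F h)

/-- `P^D_{α¹} ⊗ P_{α²} ⊗ ⋯ ⊗ P_{αᵏ}`. -/
def ParMod : Type _ :=
  PD F α.head.size α.head.toGen ⊗[F]
    (⨂[F] b : Fin α.tail.length, PA F (α.tail.get b).size (α.tail.get b))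

instance : AddCommGroup (α.ParMod F) :=
  inferInstanceAs (AddCommGroup (PD F α.head.size α.head.toGen ⊗[F]
    (⨂[F] b : Fin α.tail.length, PA F (α.tail.get b).size (α.tail.get b))))

instance : Module F (α.ParMod F) :=
  inferInstanceAs (Module F (PD F α.head.size α.head.toGen ⊗[F]
    (⨂[F] b : Fin α.tail.length, PA F (α.tail.get b).size (α.tail.get b))))

/-- `a₂ ⊗ ⋯ ⊗ aₖ` acts on `P_{α²} ⊗ ⋯ ⊗ P_{αᵏ}` factor by factor. -/
def tailsRep : (⨂[F] b : Fin α.tail.length, HeckeA F (α.tail.get b).size) →ₐ[F]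
    Module.End F (⨂[F] b : Fin α.tail.length, PA F (α.tail.get b).size (α.tail.get b)) :=
  PiTensorProduct.liftAlgHom
    ((PiTensorProduct.mapMultilinear F _ _).compLinearMap
      fun b => (Algebra.lsmul F F (PA F (α.tail.get b).size (α.tail.get b))).toLinearMap)
    (by
      ext x
      simp)
    (by
      intro x y
      ext v
      simp)

/-- `a₁ ⊗ a₂ ⊗ ⋯ ⊗ aₖ` acts on `P^D_{α¹} ⊗ P_{α²} ⊗ ⋯ ⊗ P_{αᵏ}` factor by factor. -/
def parRep : α.ParAlg F →ₐ[F] Module.End F (α.ParMod F) :=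
  (Module.endTensorEndAlgHom (R := F) (S := F) (A := F)).comp
    (Algebra.TensorProduct.map (Algebra.lsmul F F (PD F α.head.size α.head.toGen))
      (α.tailsRep F))

instance : Module (α.ParAlg F) (α.ParMod F) :=
  Module.compHom (α.ParMod F) (α.parRep F).toRingHom

/-- The induced module `(P^D_{α¹} ⊗ P_{α²} ⊗ ⋯ ⊗ P_{αᵏ}) ↑` of `H^D_n(0)`. -/
abbrev IndMod (h : 2 ≤ α.head.size) : Type _ := Induced (α.parHom F h) (α.ParMod F)

end GenPseudoRibbon

end

/-! Reading words identify the tableaux of a shape with a class of group elements defined by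
descents. Vertical adjacencies of the shape force descents (a set `I`), horizontal adjacencies force
ascents (a set `L`), and the breaks between components force nothing. The action (∗) is left
multiplication by `π̄_i` on the elements `π̄_w`, except that a term leaving the class is replaced by
`0`. Exactly this happens after multiplying everything on the right by `g = π_{w₀(L)}`. A
length-increasing left multiplication never destroys a descent in `I`, so an element leaving the
class has gained a descent in `L`; and `π̄_w g = 0` as soon as `w` has a descent in `L`. Hence
`emb`, which sends `τ` to `π̄_{w(τ)} g`, intertwines (∗) with left multiplication (`emb_op`).

Injectivity of `emb` comes from triangularity: `π̄_w h` is `χ_w(h) π̄_w` plus longer terms, where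
`χ_w` is the character with `π̄_s ↦ -1` at the descents `s` of `w` and `π̄_s ↦ 0` elsewhere, and
`χ_w(g) = 1` when `w` has no descent in `L` (`exists_repr_mul`). So the relations of the 0-Hecke
algebra pull back to (∗), with no braid computation on tableaux. Right multiplication by `e =
π̄_{w₀(I)}` is `±1` on each `π̄_w` of the class, so the image of `emb` is the left ideal generated
by `e g` (`mem_range_emb`). This gives `P_I^S` and `P_{I,J}^S`.

For the direct sum, the class of `α` is partitioned by the set of breaks that are descents, and the
blocks are the classes of the `β ∈ [α]`. Right multiplication by the element `e g` of each block
maps `P^D_α` to the product of the `P^D_β`; this map is injective by triangularity and bijective by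
dimension (`nonempty_equiv_directSum`).

For induction, `π̄_u π̄_y = π̄_{uy}` when `u` is a minimal coset representative and `y` lies in the
parabolic subgroup. The algebra is therefore free as a right module over the parabolic subalgebra,
and inducing a left ideal gives the left ideal with the same generator (`nonempty_equiv_induced`).
The product of the top elements of the factors is a top element for the whole diagram, so this is
again the left ideal of `P^D_α`.

The Coxeter theory required (`exchange`, `matsumoto`, `linearIndependent_piBar`, minimal
representatives) is derived once from `DescentSystem` and applied to types D and A. There the
essential condition to verify is `fold`. -/

/-! ### Groups with a descent structure -/

/-- A group `W` generated by involutions `gs s`, with right descents `desc s w` subject to the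
folding condition. By a theorem of Tits this amounts to a simply laced Coxeter system of
type `M`. -/
structure DescentSystem {B : Type*} (M : CoxeterMatrix B) (W : Type*) [Group W] where
  gs : B → W
  desc : B → W → Prop
  gs_mul_self : ∀ s, gs s * gs s = 1
  gs_injective : Function.Injective gs
  closure_eq_top : Subgroup.closure (Set.range gs) = ⊤
  not_desc_one : ∀ s, ¬ desc s 1
  desc_mul_gs : ∀ s w, desc s (w * gs s) ↔ ¬ desc s w
  fold : ∀ s t w, ¬ desc s w → desc s (gs t * w) → gs t * w = w * gs s
  laced : ∀ s t, s ≠ t → M s t = 2 ∨ M s t = 3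
  gs_comm : ∀ s t, M s t = 2 → gs s * gs t = gs t * gs s
  gs_braid : ∀ s t, M s t = 3 → gs s * gs t * gs s = gs t * gs s * gs t
  gs_not_comm : ∀ s t, M s t = 3 → gs s * gs t ≠ gs t * gs s

namespace DescentSystem

variable {B : Type*} {M : CoxeterMatrix B} {W : Type*} [Group W] (C : DescentSystem M W)

/-- The product of a word in the generators. -/
def wordProd (r : List B) : W := (r.map C.gs).prod

@[simp] theorem wordProd_nil : C.wordProd [] = 1 := rfl

@[simp] theorem wordProd_cons (s : B) (r : List B) :
    C.wordProd (s :: r) = C.gs s * C.wordProd r := by simp [wordProd]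

@[simp] theorem wordProd_append (r r' : List B) :
    C.wordProd (r ++ r') = C.wordProd r * C.wordProd r' := by simp [wordProd]

@[simp] theorem gs_inv (s : B) : (C.gs s)⁻¹ = C.gs s :=
  inv_eq_of_mul_eq_one_left (C.gs_mul_self s)

@[simp] theorem gs_mul_gs_mul (s : B) (w : W) : C.gs s * (C.gs s * w) = w := by
  rw [← mul_assoc, C.gs_mul_self, one_mul]

@[simp] theorem mul_gs_mul_gs (s : B) (w : W) : w * C.gs s * C.gs s = w := by
  rw [mul_assoc, C.gs_mul_self, mul_one]

theorem wordProd_reverse (r : List B) : C.wordProd r.reverse = (C.wordProd r)⁻¹ := by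
  induction r with
  | nil => simp
  | cons a r ih => simp [ih]

theorem exists_word_of_mem_closure {I : Set B} {w : W}
    (hw : w ∈ Subgroup.closure (C.gs '' I)) :
    ∃ r : List B, (∀ s ∈ r, s ∈ I) ∧ C.wordProd r = w := by
  induction hw using Subgroup.closure_induction with
  | mem x hx =>
    obtain ⟨s, hs, rfl⟩ := hx
    exact ⟨[s], by simpa using hs, by simp⟩
  | one => exact ⟨[], by simp, rfl⟩
  | mul x y _ _ hx hy =>
    obtain ⟨r, hr, rfl⟩ := hx
    obtain ⟨r', hr', rfl⟩ := hy
    exact ⟨r ++ r', by simpa [or_imp, forall_and] using ⟨hr, hr'⟩, by simp⟩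
  | inv x _ hx =>
    obtain ⟨r, hr, rfl⟩ := hx
    exact ⟨r.reverse, by simpa using hr, C.wordProd_reverse r⟩

theorem exists_word (w : W) : ∃ r : List B, C.wordProd r = w := by
  obtain ⟨r, -, hr⟩ := C.exists_word_of_mem_closure (I := Set.univ) (w := w)
    (by rw [Set.image_univ, C.closure_eq_top]; trivial)
  exact ⟨r, hr⟩

/-- The length function. -/
noncomputable def len (w : W) : ℕ := wordLength C.gs w

theorem len_wordProd_le (r : List B) : C.len (C.wordProd r) ≤ r.length :=
  Nat.sInf_le ⟨r, rfl, rfl⟩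

theorem exists_reduced (w : W) : ∃ r : List B, C.wordProd r = w ∧ r.length = C.len w := by
  obtain ⟨r, hr⟩ := C.exists_word w
  obtain ⟨l, hl, hw⟩ := Nat.sInf_mem (s := {k | ∃ l : List B, l.length = k ∧
    (l.map C.gs).prod = w}) ⟨_, r, rfl, hr⟩
  exact ⟨l, hw, hl⟩

/-- The word `r` is reduced. -/
def IsReduced (r : List B) : Prop := r.length = C.len (C.wordProd r)

@[simp] theorem len_one : C.len 1 = 0 := Nat.le_zero.1 (C.len_wordProd_le [])

theorem len_inv_le (w : W) : C.len w⁻¹ ≤ C.len w := by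
  obtain ⟨r, rfl, hr⟩ := C.exists_reduced w
  rw [← C.wordProd_reverse, ← hr, ← List.length_reverse]
  exact C.len_wordProd_le _

@[simp] theorem len_inv (w : W) : C.len w⁻¹ = C.len w :=
  le_antisymm (C.len_inv_le w) (by simpa using C.len_inv_le w⁻¹)

theorem len_mul_le (v w : W) : C.len (v * w) ≤ C.len v + C.len w := by
  obtain ⟨r, rfl, hr⟩ := C.exists_reduced v
  obtain ⟨r', rfl, hr'⟩ := C.exists_reduced w
  rw [← hr, ← hr', ← C.wordProd_append, ← List.length_append]
  exact C.len_wordProd_le _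

theorem len_gs_le (s : B) : C.len (C.gs s) ≤ 1 := by
  simpa using C.len_wordProd_le [s]

/-- The exchange condition. -/
theorem exchange {r : List B} {s : B} (h : C.desc s (C.wordProd r)) :
    ∃ l a l', r = l ++ a :: l' ∧ C.wordProd r * C.gs s = C.wordProd (l ++ l') := by
  induction r with
  | nil => exact absurd h (C.not_desc_one s)
  | cons a r ih =>
    -- As the suffix grows from the empty word, `s` changes from a non-descent to a descent at some
    -- letter. There `fold` trades that letter on the left for `s` on the right, where it cancels.
    by_cases h' : C.desc s (C.wordProd r)
    · obtain ⟨l, b, l', rfl, h2⟩ := ih h'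
      exact ⟨a :: l, b, l', rfl, by
        rw [wordProd_cons, mul_assoc, h2, List.cons_append, wordProd_cons]⟩
    · refine ⟨[], a, r, rfl, ?_⟩
      rw [wordProd_cons] at h ⊢
      rw [C.fold _ _ _ h' h, mul_gs_mul_gs, List.nil_append]

theorem len_mul_gs_lt {s : B} {w : W} (h : C.desc s w) : C.len (w * C.gs s) < C.len w := by
  obtain ⟨r, rfl, hr⟩ := C.exists_reduced w
  obtain ⟨l, a, l', rfl, h2⟩ := C.exchange h
  rw [h2, ← hr]
  refine (C.len_wordProd_le _).trans_lt ?_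
  simp

theorem desc_iff {s : B} {w : W} : C.desc s w ↔ C.len (w * C.gs s) < C.len w := by
  refine ⟨C.len_mul_gs_lt, fun h => ?_⟩
  by_contra h'
  have := C.len_mul_gs_lt ((C.desc_mul_gs s w).2 h')
  rw [mul_gs_mul_gs] at this
  omega

theorem len_mul_gs_of_desc {s : B} {w : W} (h : C.desc s w) :
    C.len (w * C.gs s) + 1 = C.len w := by
  have h1 := C.len_mul_gs_lt h
  have h2 := C.len_mul_le (w * C.gs s) (C.gs s)
  rw [mul_gs_mul_gs] at h2
  have := C.len_gs_le s
  omega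

theorem len_mul_gs_of_not_desc {s : B} {w : W} (h : ¬ C.desc s w) :
    C.len (w * C.gs s) = C.len w + 1 := by
  have := C.len_mul_gs_of_desc ((C.desc_mul_gs s w).2 h)
  rw [mul_gs_mul_gs] at this
  exact this.symm

/-- Left descents. -/
def ldesc (s : B) (w : W) : Prop := C.desc s w⁻¹

theorem ldesc_iff {s : B} {w : W} : C.ldesc s w ↔ C.len (C.gs s * w) < C.len w := by
  rw [ldesc, desc_iff, ← C.len_inv w, ← C.len_inv (C.gs s * w)]
  simp

theorem ldesc_gs_mul (s : B) (w : W) : C.ldesc s (C.gs s * w) ↔ ¬ C.ldesc s w := by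
  rw [ldesc, ldesc, ← C.desc_mul_gs]
  simp

theorem len_gs_mul_of_ldesc {s : B} {w : W} (h : C.ldesc s w) :
    C.len (C.gs s * w) + 1 = C.len w := by
  rw [← C.len_inv w, ← C.len_mul_gs_of_desc h, ← C.len_inv (C.gs s * w)]
  simp

theorem len_gs_mul_of_not_ldesc {s : B} {w : W} (h : ¬ C.ldesc s w) :
    C.len (C.gs s * w) = C.len w + 1 := by
  rw [← C.len_inv w, ← C.len_mul_gs_of_not_desc h, ← C.len_inv (C.gs s * w)]
  simp

/-- The exchange condition for left descents. -/
theorem left_exchange {r : List B} {s : B} (h : C.ldesc s (C.wordProd r)) :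
    ∃ l a l', r = l ++ a :: l' ∧ C.gs s * C.wordProd r = C.wordProd (l ++ l') := by
  rw [ldesc, ← wordProd_reverse] at h
  obtain ⟨l, a, l', h1, h2⟩ := C.exchange h
  refine ⟨l'.reverse, a, l.reverse, ?_, ?_⟩
  · rw [← r.reverse_reverse, h1]
    simp
  · rw [← inv_inj, ← wordProd_reverse, ← List.reverse_append, List.reverse_reverse, ← h2,
      wordProd_reverse]
    simp

/-- Separates the two places of the deleted letter, the first letter or a later one. This is the
form needed for the dihedral arguments in `matsumoto` and `isReduced_triple`. -/
theorem left_exchange_cons {r : List B} {s a : B} (h : C.ldesc s (C.gs a * C.wordProd r)) :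
    C.gs s * (C.gs a * C.wordProd r) = C.wordProd r ∨
      ∃ r', r'.length + 1 = r.length ∧
        C.gs s * (C.gs a * C.wordProd r) = C.gs a * C.wordProd r' := by
  rw [← wordProd_cons] at h ⊢
  obtain ⟨l, b, l', h1, h2⟩ := C.left_exchange h
  rcases l with _ | ⟨c, l⟩
  · left
    simp only [List.nil_append, List.cons.injEq] at h1
    rw [h2, h1.2, List.nil_append]
  · right
    simp only [List.cons_append, List.cons.injEq] at h1
    refine ⟨l ++ l', ?_, ?_⟩
    · rw [h1.2]
      simp
      omega
    · rw [h2, List.cons_append, wordProd_cons, h1.1]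

theorem IsReduced.of_cons {s : B} {r : List B} (h : C.IsReduced (s :: r)) : C.IsReduced r := by
  have h1 := C.len_wordProd_le r
  have h2 := C.len_mul_le (C.gs s) (C.wordProd r)
  have h3 := C.len_gs_le s
  simp only [IsReduced, List.length_cons, wordProd_cons] at h ⊢
  omega

theorem isReduced_cons {s : B} {r : List B} :
    C.IsReduced (s :: r) ↔ C.IsReduced r ∧ ¬ C.ldesc s (C.wordProd r) := by
  refine ⟨fun h => ⟨IsReduced.of_cons C h, fun h' => ?_⟩, fun h => ?_⟩
  · have h1 := IsReduced.of_cons C h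
    have := C.len_gs_mul_of_ldesc h'
    simp only [IsReduced, List.length_cons, wordProd_cons] at h h1
    omega
  · have := C.len_gs_mul_of_not_ldesc h.2
    have := h.1
    simp only [IsReduced, List.length_cons, wordProd_cons] at this ⊢
    omega

theorem IsReduced.ldesc_cons {s : B} {r : List B} (h : C.IsReduced (s :: r)) :
    C.ldesc s (C.wordProd (s :: r)) := by
  rw [wordProd_cons, ldesc_gs_mul]
  exact (C.isReduced_cons.1 h).2

theorem isReduced_of_length_le {r r' : List B} (h : C.IsReduced r)
    (h1 : C.wordProd r' = C.wordProd r) (h2 : r'.length ≤ r.length) : C.IsReduced r' := by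
  have := C.len_wordProd_le r'
  simp only [IsReduced] at h ⊢
  rw [h1] at this ⊢
  omega

/-- Matsumoto's theorem. -/
theorem matsumoto {A : Type*} [Monoid A] (f : B → A)
    (hf : ∀ s t, altProd (M s t) (f s) (f t) = altProd (M s t) (f t) (f s)) {r r' : List B}
    (hr : C.IsReduced r) (hr' : C.IsReduced r') (h : C.wordProd r = C.wordProd r') :
    (r.map f).prod = (r'.map f).prod := by
  induction hn : r.length using Nat.strong_induction_on generalizing r r' with
  | _ n ih =>
  have hlen : r.length = r'.length := by rw [hr, hr', h]
  rcases r with _ | ⟨s, r⟩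
  · rw [List.length_nil, eq_comm, List.length_eq_zero_iff] at hlen
    rw [hlen]
  rcases r' with _ | ⟨t, r'⟩
  · simp at hlen
  -- Words with a common first letter are settled by induction. The rest of the proof links the two
  -- given words through bridging words whose first letters match.
  have key : ∀ {u : B} {q q' : List B}, C.IsReduced (u :: q) → C.IsReduced (u :: q') →
      C.wordProd (u :: q) = C.wordProd (u :: q') → (u :: q).length = n →
      ((u :: q).map f).prod = ((u :: q').map f).prod := by
    intro u q q' hq hq' hqq hl
    rw [List.map_cons, List.map_cons, List.prod_cons, List.prod_cons,
      ih q.length (by rw [← hl]; simp) (IsReduced.of_cons C hq) (IsReduced.of_cons C hq')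
        (by simpa using hqq) rfl]
  rw [List.length_cons] at hn
  simp only [List.length_cons, add_left_inj] at hlen
  by_cases hst : s = t
  · subst hst
    exact key hr hr' h (by simp [hn])
  have hne : C.gs s ≠ C.gs t := fun e => hst (C.gs_injective e)
  have ht : C.ldesc t (C.gs s * C.wordProd r) := by
    rw [← wordProd_cons, h]
    exact IsReduced.ldesc_cons C hr'
  -- Both `s` and `t` are left descents of the element. Exchange for `t` cannot delete the leading
  -- `s`, since this would give `s = t`; so the element is also `t s r₂`.
  obtain h1 | ⟨r₂, hl₂, h1⟩ := C.left_exchange_cons ht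
  · rw [← mul_assoc, mul_eq_right, mul_eq_one_iff_eq_inv, gs_inv] at h1
    exact absurd h1.symm hne
  have e2 : C.wordProd (t :: s :: r₂) = C.wordProd (s :: r) := by
    rw [wordProd_cons, wordProd_cons, ← h1, gs_mul_gs_mul, wordProd_cons]
  have red2 : C.IsReduced (t :: s :: r₂) :=
    C.isReduced_of_length_le hr e2 (by simp [hl₂])
  -- For `m = 2` the bridge is `s t r₂ = t s r₂`. For `m = 3` a second exchange, now for `s`,
  -- produces the bridge `s t s q = t s t q`.
  rcases C.laced s t hst with hm | hm
  · have e3 : C.wordProd (s :: t :: r₂) = C.wordProd (s :: r) := by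
      rw [← e2]
      simp only [wordProd_cons, ← mul_assoc, C.gs_comm s t hm]
    have red3 : C.IsReduced (s :: t :: r₂) :=
      C.isReduced_of_length_le hr e3 (by simp [hl₂])
    have hb := hf s t
    rw [hm] at hb
    simp only [altProd, mul_one] at hb
    rw [key hr red3 e3.symm (by simp [hn]), ← key red2 hr' (e2.trans h) (by simp; omega)]
    simp only [List.map_cons, List.prod_cons, ← mul_assoc, hb]
  · have hs : C.ldesc s (C.wordProd (t :: s :: r₂)) := by
      rw [e2]
      exact IsReduced.ldesc_cons C hr
    obtain ⟨l, a, l', e5, h5'⟩ := C.left_exchange hs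
    -- Deleting the first letter would give `s = t`, and deleting the second would make `s` and `t`
    -- commute. The deleted letter therefore lies in `r₂`.
    have h6 : ∃ q, q.length + 1 = r₂.length ∧
        C.gs s * C.wordProd (t :: s :: r₂) = C.wordProd (t :: s :: q) := by
      rcases l with _ | ⟨b, l⟩
      · exfalso
        simp only [List.nil_append, List.cons.injEq] at e5
        rw [← e5.2, List.nil_append] at h5'
        simp only [wordProd_cons, mul_right_inj] at h5'
        rw [← mul_assoc, mul_eq_right, mul_eq_one_iff_eq_inv, gs_inv] at h5'
        exact hst (C.gs_injective h5'.symm ▸ rfl)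
      simp only [List.cons_append, List.cons.injEq] at e5
      obtain ⟨rfl, e5⟩ := e5
      rcases l with _ | ⟨b, l⟩
      · exfalso
        simp only [List.nil_append, List.cons.injEq] at e5
        rw [← e5.2] at h5'
        simp only [wordProd_cons, List.cons_append, List.nil_append, ← mul_assoc,
          mul_left_inj] at h5'
        apply C.gs_not_comm s t hm
        calc C.gs s * C.gs t = C.gs s * C.gs t * C.gs s * C.gs s := by rw [mul_gs_mul_gs]
          _ = C.gs t * C.gs s := by rw [h5']
      simp only [List.cons_append, List.cons.injEq] at e5
      obtain ⟨rfl, e5⟩ := e5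
      refine ⟨l ++ l', ?_, by rw [h5']; simp⟩
      rw [e5]
      simp
      omega
    obtain ⟨q, hq, h6⟩ := h6
    have e3 : C.wordProd (s :: t :: s :: q) = C.wordProd (s :: r) := by
      rw [wordProd_cons, ← h6, gs_mul_gs_mul, e2]
    have e4 : C.wordProd (t :: s :: t :: q) = C.wordProd (s :: r) := by
      rw [← e3]
      have := C.gs_braid s t hm
      simp only [wordProd_cons, ← mul_assoc, this]
    have red3 := C.isReduced_of_length_le hr e3 (by simp; omega)
    have red4 := C.isReduced_of_length_le hr e4 (by simp; omega)
    have hb := hf s t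
    rw [hm] at hb
    simp only [altProd, mul_one] at hb
    rw [key hr red3 e3.symm (by simp [hn]), ← key red4 hr' (e4.trans h) (by simp; omega)]
    simp only [List.map_cons, List.prod_cons]
    simp only [← mul_assoc] at hb ⊢
    rw [hb]

/-! ### Parabolic subgroups -/

/-- A reduced word of `w`. -/
noncomputable def redWord (w : W) : List B := (C.exists_reduced w).choose

@[simp] theorem wordProd_redWord (w : W) : C.wordProd (C.redWord w) = w :=
  (C.exists_reduced w).choose_spec.1

theorem length_redWord (w : W) : (C.redWord w).length = C.len w :=
  (C.exists_reduced w).choose_spec.2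

theorem isReduced_redWord (w : W) : C.IsReduced (C.redWord w) := by
  rw [IsReduced, wordProd_redWord, length_redWord]

theorem eq_one_of_len_eq_zero {w : W} (h : C.len w = 0) : w = 1 := by
  rw [← C.length_redWord, List.length_eq_zero_iff] at h
  rw [← C.wordProd_redWord w, h, wordProd_nil]

theorem exists_reduced_of_mem_closure {I : Set B} {w : W}
    (hw : w ∈ Subgroup.closure (C.gs '' I)) :
    ∃ r : List B, C.IsReduced r ∧ (∀ s ∈ r, s ∈ I) ∧ C.wordProd r = w := by
  obtain ⟨r, hr, rfl⟩ := C.exists_word_of_mem_closure hw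
  clear hw
  induction r with
  | nil => exact ⟨[], by simp [IsReduced], by simp, rfl⟩
  | cons a r ih =>
    simp only [List.mem_cons, forall_eq_or_imp] at hr
    obtain ⟨q, hq, hqI, hqr⟩ := ih hr.2
    by_cases h : C.ldesc a (C.wordProd q)
    · obtain ⟨l, b, l', rfl, h2⟩ := C.left_exchange h
      refine ⟨l ++ l', ?_, fun s hs => hqI s ?_, ?_⟩
      · have := C.len_gs_mul_of_ldesc h
        rw [h2, ← hq] at this
        simp only [List.length_append, List.length_cons] at this
        rw [IsReduced, List.length_append]
        omega
      · simp only [List.mem_append, List.mem_cons] at hs ⊢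
        tauto
      · rw [wordProd_cons, ← hqr, h2]
    · exact ⟨a :: q, C.isReduced_cons.2 ⟨hq, h⟩, by simpa using ⟨hr.1, hqI⟩, by simp [hqr]⟩

/-- For commuting idempotents `a`, `b` every alternating product of length 2 or 3 equals `ab`. This
makes 0/1-valued functions admissible both in `matsumoto` and as characters of the 0-Hecke algebra.
-/
theorem altProd_comm_of_idem (C : DescentSystem M W) {A : Type*} [CommMonoid A] (f : B → A)
    (hf : ∀ s, f s * f s = f s)
    (s t : B) : altProd (M s t) (f s) (f t) = altProd (M s t) (f t) (f s) := by
  by_cases h : s = t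
  · rw [h]
  rcases C.laced s t h with h | h <;> rw [h] <;> simp only [altProd, mul_one]
  · rw [mul_comm]
  · rw [mul_left_comm, hf, mul_left_comm, hf, mul_comm]

/-- The parabolic subgroup generated by `J`. -/
def para (J : Set B) : Subgroup W := Subgroup.closure (C.gs '' J)

theorem gs_mem_para {J : Set B} {s : B} (hs : s ∈ J) : C.gs s ∈ C.para J :=
  Subgroup.subset_closure ⟨s, hs, rfl⟩

theorem para_mono {I J : Set B} (h : I ⊆ J) : C.para I ≤ C.para J :=
  Subgroup.closure_mono (Set.image_mono h)

/-- By `matsumoto`, the product of the indicator function of `I` over a reduced word depends only on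
the element. It is nonzero for a reduced word with letters in `I`, hence for every reduced word of
the same element. -/
theorem mem_of_isReduced {I : Set B} {r : List B} (hr : C.IsReduced r)
    (h : C.wordProd r ∈ C.para I) : ∀ s ∈ r, s ∈ I := by
  classical
  obtain ⟨q, hq, hqI, hqr⟩ := C.exists_reduced_of_mem_closure h
  let f : B → ℕ := fun s => if s ∈ I then 1 else 0
  have h1 := C.matsumoto f (C.altProd_comm_of_idem f fun s => by simp [f]) hq hr hqr
  have h2 : (q.map f).prod ≠ 0 := by
    rw [Ne, List.prod_eq_zero_iff, List.mem_map]
    rintro ⟨s, hs, h⟩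
    simp [f, hqI s hs] at h
  intro s hs
  by_contra hsI
  refine h2 (h1.trans (List.prod_eq_zero (List.mem_map.2 ⟨s, hs, ?_⟩)))
  simp [f, hsI]

theorem isReduced_append_singleton {s : B} {r : List B} :
    C.IsReduced (r ++ [s]) ↔ C.IsReduced r ∧ ¬ C.desc s (C.wordProd r) := by
  simp only [IsReduced, wordProd_append, wordProd_cons, wordProd_nil, mul_one,
    List.length_append, List.length_singleton]
  have h1 := C.len_wordProd_le r
  by_cases h : C.desc s (C.wordProd r)
  · have := C.len_mul_gs_of_desc h
    simp only [h, not_true, and_false, iff_false]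
    omega
  · have := C.len_mul_gs_of_not_desc h
    simp only [h, not_false_iff, and_true]
    omega

theorem exists_reduced_of_desc {s : B} {w : W} (h : C.desc s w) :
    ∃ r, C.IsReduced (r ++ [s]) ∧ C.wordProd (r ++ [s]) = w := by
  refine ⟨C.redWord (w * C.gs s), C.isReduced_append_singleton.2 ⟨C.isReduced_redWord _, ?_⟩, ?_⟩
  · rwa [wordProd_redWord, C.desc_mul_gs, not_not]
  · simp

theorem exists_reduced_of_ldesc {s : B} {w : W} (h : C.ldesc s w) :
    ∃ r, C.IsReduced (s :: r) ∧ C.wordProd (s :: r) = w := by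
  refine ⟨C.redWord (C.gs s * w), C.isReduced_cons.2 ⟨C.isReduced_redWord _, ?_⟩, ?_⟩
  · rwa [wordProd_redWord, C.ldesc_gs_mul, not_not]
  · simp

theorem mem_of_desc {I : Set B} {s : B} {w : W} (hw : w ∈ C.para I) (h : C.desc s w) :
    s ∈ I := by
  obtain ⟨r, hr, rfl⟩ := C.exists_reduced_of_desc h
  exact C.mem_of_isReduced hr hw s (by simp)

theorem eq_one_of_forall_not_desc {J : Set B} {w : W} (hw : w ∈ C.para J)
    (h : ∀ s ∈ J, ¬ C.desc s w) : w = 1 := by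
  by_contra hne
  have hr := C.isReduced_redWord w
  rcases List.eq_nil_or_concat (C.redWord w) with h1 | ⟨r, s, h1⟩
  · rw [← C.wordProd_redWord w, h1] at hne
    exact hne rfl
  · rw [List.concat_eq_append] at h1
    rw [← C.wordProd_redWord w, h1] at hw h
    rw [h1] at hr
    refine h s (C.mem_of_isReduced hr hw s (by simp)) ?_
    have := (C.isReduced_append_singleton.1 hr).2
    simpa [C.desc_mul_gs] using this

/-- `u` has no right descent in `J`. -/
def IsMin (J : Set B) (u : W) : Prop := ∀ s ∈ J, ¬ C.desc s u

/-- Exchange in a reduced word of `u` followed by one of `y`: the deleted letter cannot belong to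
`u`, because then `u * (y s y⁻¹)`, which lies in the coset of `u`, would be shorter than `u`. -/
theorem desc_of_desc_mul {J : Set B} {u y : W} (hu : ∀ z ∈ C.para J, C.len u ≤ C.len (u * z))
    (hy : y ∈ C.para J) {s : B} (hs : s ∈ J) (h : C.desc s (u * y)) : C.desc s y := by
  have h1 := h
  rw [← C.wordProd_redWord u, ← C.wordProd_redWord y, ← wordProd_append] at h1
  obtain ⟨l, a, l', h2, h3⟩ := C.exchange h1
  rw [wordProd_append, wordProd_redWord, wordProd_redWord, wordProd_append] at h3
  obtain ⟨q, hq, hq'⟩ | ⟨q, hq, hq'⟩ := List.append_eq_append_iff.1 h2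
  · rw [hq, wordProd_append, wordProd_redWord, mul_assoc, mul_assoc, mul_right_inj] at h3
    rw [C.desc_iff, h3, ← wordProd_append]
    refine (C.len_wordProd_le _).trans_lt ?_
    rw [← C.length_redWord y, hq']
    simp
  -- An empty `q` means that the cut is at the junction, so the deleted letter is the first letter
  -- of the word of `y`.
  · rcases q with _ | ⟨b, q⟩
    · simp only [List.nil_append, List.append_nil] at hq hq'
      rw [← hq, wordProd_redWord, mul_assoc, mul_right_inj] at h3
      rw [C.desc_iff, h3]
      refine (C.len_wordProd_le _).trans_lt ?_
      rw [← C.length_redWord y, ← hq']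
      simp
    · exfalso
      simp only [List.cons_append, List.cons.injEq] at hq'
      obtain ⟨rfl, rfl⟩ := hq'
      rw [wordProd_append, wordProd_redWord, ← mul_assoc] at h3
      have h4 : u * (y * C.gs s * y⁻¹) = C.wordProd (l ++ q) := by
        rw [wordProd_append, ← mul_assoc, ← mul_assoc, h3, mul_inv_cancel_right]
      have h5 := hu _ (mul_mem (mul_mem hy (C.gs_mem_para hs)) (inv_mem hy))
      have h6 := C.len_wordProd_le (l ++ q)
      rw [h4, ← C.length_redWord u, hq] at h5
      simp only [List.length_append, List.length_cons] at h5 h6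
      omega

theorem desc_mul_iff_of_len_le {J : Set B} {u y : W}
    (hu : ∀ z ∈ C.para J, C.len u ≤ C.len (u * z))
    (hy : y ∈ C.para J) {s : B} (hs : s ∈ J) : C.desc s (u * y) ↔ C.desc s y := by
  refine ⟨C.desc_of_desc_mul hu hy hs, fun h => ?_⟩
  by_contra h'
  rw [← C.desc_mul_gs, mul_assoc] at h'
  have := C.desc_of_desc_mul hu (mul_mem hy (C.gs_mem_para hs)) hs h'
  exact (C.desc_mul_gs s y).1 this h

/-- The local condition implies the global one. If `u * y` is shortest in the coset, a descent of
`y⁻¹` in `J` would be a descent of `u = (u * y) * y⁻¹`; so there is none and `y = 1`. -/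
theorem IsMin.len_le {J : Set B} {u : W} (h : C.IsMin J u) :
    ∀ z ∈ C.para J, C.len u ≤ C.len (u * z) := by
  classical
  have hex : ∃ n, ∃ y ∈ C.para J, C.len (u * y) = n := ⟨_, 1, one_mem _, rfl⟩
  obtain ⟨y, hy, hn⟩ := Nat.find_spec hex
  have hmin : ∀ z ∈ C.para J, C.len (u * y) ≤ C.len (u * y * z) := fun z hz => by
    rw [hn, mul_assoc]
    exact Nat.find_min' hex ⟨_, mul_mem hy hz, rfl⟩
  have h1 : y⁻¹ = 1 := by
    refine C.eq_one_of_forall_not_desc (inv_mem hy) fun s hs hd => h s hs ?_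
    rw [← C.desc_mul_iff_of_len_le hmin (inv_mem hy) hs] at hd
    simpa using hd
  rw [inv_eq_one] at h1
  simpa [h1] using hmin

theorem IsMin.desc_mul_iff {J : Set B} {u y : W} (h : C.IsMin J u) (hy : y ∈ C.para J) {s : B}
    (hs : s ∈ J) : C.desc s (u * y) ↔ C.desc s y :=
  C.desc_mul_iff_of_len_le (h.len_le C) hy hs

/-- A descent of `y * y'⁻¹` in `J` would be a descent of `u' = u * (y * y'⁻¹)`, so `y * y'⁻¹` has
none and is trivial. -/
theorem IsMin.mul_inj {J : Set B} {u u' y y' : W} (h : C.IsMin J u) (h' : C.IsMin J u')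
    (hy : y ∈ C.para J) (hy' : y' ∈ C.para J) (he : u * y = u' * y') : u = u' ∧ y = y' := by
  have h1 : y * y'⁻¹ = 1 := by
    have hm := mul_mem hy (inv_mem hy')
    refine C.eq_one_of_forall_not_desc hm fun s hs hd => h' s hs ?_
    rw [← h.desc_mul_iff C hm hs, ← mul_assoc, he] at hd
    simpa using hd
  rw [mul_inv_eq_one] at h1
  subst h1
  exact ⟨mul_right_cancel he, rfl⟩

/-! ### Longest elements -/

theorem IsLongest.desc {I : Set B} {w : W} (h : IsLongest C.gs I w) {s : B} (hs : s ∈ I) :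
    C.desc s w := by
  by_contra h'
  have h1 := h.2 _ (mul_mem h.1 (C.gs_mem_para hs))
  have h2 := C.len_mul_gs_of_not_desc h'
  rw [len, len] at h2
  omega

theorem IsLongest.ldesc {I : Set B} {w : W} (h : IsLongest C.gs I w) {s : B} (hs : s ∈ I) :
    C.ldesc s w := by
  by_contra h'
  have h1 := h.2 _ (mul_mem (C.gs_mem_para hs) h.1)
  have h2 := C.len_gs_mul_of_not_ldesc h'
  rw [len, len] at h2
  omega

end DescentSystem

/-! ### The generators `π_s` and `π̄_s` and their relations -/

namespace HeckeZero

variable {F : Type*} [Field F] {B : Type*} {M : CoxeterMatrix B}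

theorem gen_eq (s : B) : (gen F s : HeckeZero F M) = genBar F s + 1 := by
  simp [genBar]

theorem genBar_mul_self (s : B) : genBar F s * genBar F s = (-genBar F s : HeckeZero F M) := by
  have := gen_mul_self (M := M) F s
  simp only [genBar, mul_sub, sub_mul, this]
  simp

theorem genBar_mul_gen (s : B) : genBar F s * gen F s = (0 : HeckeZero F M) := by
  rw [gen_eq, mul_add, genBar_mul_self]
  simp

theorem gen_mul_genBar (s : B) : gen F s * genBar F s = (0 : HeckeZero F M) := by
  rw [gen_eq, add_mul, genBar_mul_self]
  simp

/-- After expansion, the quadratic relations make all lower terms symmetric in `a` and `b`. For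
length 3 they add up to `ab + ba + a + b + 1`. -/
theorem altProd_add_one {A : Type*} [Ring A] {a b : A} (ha : a * a = -a) (hb : b * b = -b)
    {m : ℕ} (hm : m = 1 ∧ a = b ∨ m = 2 ∨ m = 3) (h : altProd m a b = altProd m b a) :
    altProd m (a + 1) (b + 1) = altProd m (b + 1) (a + 1) := by
  rcases hm with ⟨rfl, rfl⟩ | rfl | rfl
  · rfl
  · simp only [altProd, mul_one] at h ⊢
    simp only [add_mul, mul_add, h, one_mul, mul_one]
    abel
  · simp only [altProd, mul_one] at h ⊢
    simp only [add_mul, mul_add, h, one_mul, mul_one, ha, hb]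
    abel

theorem altProd_sub_one {A : Type*} [Ring A] {a b : A} (ha : a * a = a) (hb : b * b = b)
    {m : ℕ} (hm : m = 1 ∧ a = b ∨ m = 2 ∨ m = 3) (h : altProd m a b = altProd m b a) :
    altProd m (a - 1) (b - 1) = altProd m (b - 1) (a - 1) := by
  rcases hm with ⟨rfl, rfl⟩ | rfl | rfl
  · rfl
  · simp only [altProd, mul_one] at h ⊢
    simp only [sub_mul, mul_sub, h, one_mul, mul_one]
    abel
  · simp only [altProd, mul_one] at h ⊢
    simp only [sub_mul, mul_sub, h, one_mul, mul_one, ha, hb]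
    abel

@[elab_as_elim]
theorem induction_gen {P : HeckeZero F M → Prop} (scalar : ∀ r, P (algebraMap F _ r))
    (gen : ∀ s, P (gen F s)) (add : ∀ x y, P x → P y → P (x + y))
    (mul : ∀ x y, P x → P y → P (x * y)) (x : HeckeZero F M) : P x := by
  have hx : x ∈ Algebra.adjoin F (Set.range (HeckeZero.gen F : B → HeckeZero F M)) := by
    rw [adjoin_gen]; trivial
  induction hx using Algebra.adjoin_induction with
  | algebraMap r => exact scalar r
  | add a b _ _ ha hb => exact add _ _ ha hb
  | mul a b _ _ ha hb => exact mul _ _ ha hb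
  | mem a ha => obtain ⟨s, rfl⟩ := ha; exact gen s

/-- An `F`-linear map commuting with all `π̄_s` is linear over the 0-Hecke algebra. -/
theorem map_smul_of_genBar {V V' : Type*} [AddCommGroup V] [Module F V]
    [Module (HeckeZero F M) V] [IsScalarTower F (HeckeZero F M) V] [AddCommGroup V'] [Module F V']
    [Module (HeckeZero F M) V'] [IsScalarTower F (HeckeZero F M) V'] (f : V →ₗ[F] V')
    (h : ∀ (s : B) (v : V),
      f ((genBar F s : HeckeZero F M) • v) = (genBar F s : HeckeZero F M) • f v)
    (x : HeckeZero F M) (v : V) : f (x • v) = x • f v := by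
  induction x using induction_gen generalizing v with
  | scalar r => simp
  | gen s => rw [gen_eq, add_smul, add_smul, map_add, h, one_smul, one_smul]
  | add x y hx hy => rw [add_smul, add_smul, map_add, hx, hy]
  | mul x y hx hy => rw [mul_smul, mul_smul, hx, hy]

/-- `HeckeZero.rep` is the prescribed representation whenever there is one. -/
theorem rep_genBar {V : Type*} [AddCommGroup V] [Module F V] {T : B → Module.End F V}
    (h : ∃ ρ : HeckeZero F M →ₐ[F] Module.End F V, ∀ s, ρ (genBar F s) = T s) (s : B) :
    rep M T (genBar F s) = T s := by
  rw [rep, dif_pos h]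
  exact h.choose_spec s

end HeckeZero

namespace DescentSystem

open HeckeZero

variable {B : Type*} {M : CoxeterMatrix B} {W : Type*} [Group W] (C : DescentSystem M W)
  {F : Type*} [Field F]

theorem laced_or (C : DescentSystem M W) {A : Type*} (f : B → A) (s t : B) :
    M s t = 1 ∧ f s = f t ∨ M s t = 2 ∨ M s t = 3 := by
  by_cases h : s = t
  · exact Or.inl ⟨by rw [h, M.diagonal], by rw [h]⟩
  · exact Or.inr (C.laced s t h)

theorem genBar_braid (C : DescentSystem M W) (s t : B) :
    altProd (M s t) (genBar F s) (genBar F t) =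
      (altProd (M s t) (genBar F t) (genBar F s) : HeckeZero F M) :=
  altProd_sub_one (gen_mul_self F s) (gen_mul_self F t) (C.laced_or (gen F) s t)
    (gen_braid F s t)

/-- The universal property of the 0-Hecke algebra in terms of the `π̄_s`. -/
theorem exists_algHom (C : DescentSystem M W) {A : Type*} [Ring A] [Algebra F A] (t : B → A)
    (hq : ∀ s, t s * t s = -t s)
    (hb : ∀ s s', altProd (M s s') (t s) (t s') = altProd (M s s') (t s') (t s)) :
    ∃ ρ : HeckeZero F M →ₐ[F] A, ∀ s, ρ (genBar F s) = t s := by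
  refine ⟨lift (fun s => t s + 1) (fun s => ?_) (fun s s' => ?_), fun s => ?_⟩
  · simp only [mul_add, add_mul, hq]
    simp
  · exact altProd_add_one (hq s) (hq s') (C.laced_or t s s') (hb s s')
  · rw [genBar, map_sub, lift_gen, map_one, add_sub_cancel_right]

/-! ### The regular representation -/

section Regular

open Classical in
/-- Left multiplication by `π̄_s` in terms of the standard basis. -/
noncomputable def opL (F : Type*) [Field F] (s : B) : Module.End F (W →₀ F) :=
  Finsupp.linearCombination F fun w =>
    if C.ldesc s w then -Finsupp.single w 1 else Finsupp.single (C.gs s * w) 1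

open Classical in
/-- Right multiplication by `π̄_s` in terms of the standard basis. -/
noncomputable def opR (F : Type*) [Field F] (s : B) : Module.End F (W →₀ F) :=
  Finsupp.linearCombination F fun w =>
    if C.desc s w then -Finsupp.single w 1 else Finsupp.single (w * C.gs s) 1

theorem opL_of_ldesc {s : B} {w : W} (h : C.ldesc s w) :
    C.opL F s (Finsupp.single w 1) = -Finsupp.single w 1 := by
  simp [opL, h]

theorem opL_of_not_ldesc {s : B} {w : W} (h : ¬ C.ldesc s w) :
    C.opL F s (Finsupp.single w 1) = Finsupp.single (C.gs s * w) 1 := by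
  simp [opL, h]

theorem opR_of_desc {s : B} {w : W} (h : C.desc s w) :
    C.opR F s (Finsupp.single w 1) = -Finsupp.single w 1 := by
  simp [opR, h]

theorem opR_of_not_desc {s : B} {w : W} (h : ¬ C.desc s w) :
    C.opR F s (Finsupp.single w 1) = Finsupp.single (w * C.gs s) 1 := by
  simp [opR, h]

/-- Folding, applied to `w` and to `s w`: left multiplication can change the status of a right
descent only when it coincides with right multiplication by that generator. -/
theorem ldesc_mul_gs {s t : B} {w : W} (hne : C.gs s * w ≠ w * C.gs t) :
    C.desc t (C.gs s * w) ↔ C.desc t w := by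
  refine ⟨fun h => ?_, fun h => ?_⟩ <;> by_contra h'
  · exact hne (C.fold t s w h' h)
  · have := C.fold t s (C.gs s * w) h' (by rwa [gs_mul_gs_mul])
    rw [gs_mul_gs_mul] at this
    apply hne
    conv_rhs => rw [this]
    rw [mul_gs_mul_gs]

theorem ldesc_mul_gs' {s t : B} {w : W} (hne : C.gs s * w ≠ w * C.gs t) :
    C.ldesc s (w * C.gs t) ↔ C.ldesc s w := by
  have : C.gs t * w⁻¹ ≠ w⁻¹ * C.gs s := fun h => hne (by
    have h := congrArg (fun x => (x)⁻¹) h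
    simpa using h.symm)
  have h := C.ldesc_mul_gs this
  simpa [ldesc] using h

/-- If `s w = w t`, the two operators agree on `w` and on `w t`. Otherwise neither multiplication
changes the descent status that the other operator tests. -/
theorem opL_comm_opR (s t : B) : Commute (C.opL F s) (C.opR F t) := by
  refine Finsupp.lhom_ext' fun w => LinearMap.ext_ring ?_
  simp only [LinearMap.comp_apply, Module.End.mul_apply, Finsupp.lsingle_apply]
  by_cases hne : C.gs s * w = w * C.gs t
  · have hd : C.ldesc s w ↔ C.desc t w := by rw [C.ldesc_iff, C.desc_iff, hne]
    by_cases h : C.desc t w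
    · simp [C.opR_of_desc h, C.opL_of_ldesc (hd.2 h)]
    · have h' := mt hd.1 h
      rw [C.opR_of_not_desc h, C.opL_of_not_ldesc h', ← hne,
        C.opL_of_ldesc ((C.ldesc_gs_mul s w).2 h'), hne,
        C.opR_of_desc ((C.desc_mul_gs t w).2 h)]
  · have h1 := C.ldesc_mul_gs hne
    have h2 := C.ldesc_mul_gs' hne
    by_cases h : C.desc t w <;> by_cases h' : C.ldesc s w
    · simp [C.opR_of_desc h, C.opL_of_ldesc h']
    · simp [C.opR_of_desc h, C.opL_of_not_ldesc h', C.opR_of_desc (h1.2 h)]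
    · simp [C.opR_of_not_desc h, C.opL_of_ldesc h', C.opL_of_ldesc (h2.2 h')]
    · simp [C.opR_of_not_desc h, C.opL_of_not_ldesc h', C.opL_of_not_ldesc (mt h2.1 h'),
        C.opR_of_not_desc (mt h1.1 h), mul_assoc]

/-- Every basis vector arises from that of `1` by right operators along a reduced word. Identities
between left operators thus need checking at `1` only. -/
theorem eq_of_commute_opR {D D' : Module.End F (W →₀ F)} (hD : ∀ t, Commute D (C.opR F t))
    (hD' : ∀ t, Commute D' (C.opR F t))
    (h : D (Finsupp.single 1 1) = D' (Finsupp.single 1 1)) : D = D' := by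
  refine Finsupp.lhom_ext' fun w => LinearMap.ext_ring ?_
  simp only [LinearMap.comp_apply, Finsupp.lsingle_apply]
  obtain ⟨r, rfl, hr⟩ := C.exists_reduced w
  change C.IsReduced r at hr
  induction r using List.reverseRecOn with
  | nil => exact h
  | append_singleton r s ih =>
    obtain ⟨h1, h2⟩ := C.isReduced_append_singleton.1 hr
    have e := C.opR_of_not_desc (F := F) h2
    simp only [wordProd_append, wordProd_cons, wordProd_nil, mul_one]
    rw [← e, ← Module.End.mul_apply, ← Module.End.mul_apply, (hD s).eq, (hD' s).eq,
      Module.End.mul_apply, Module.End.mul_apply, ih h1]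

theorem opL_word {r : List B} (hr : C.IsReduced r) :
    (r.map (C.opL F)).prod (Finsupp.single 1 1) = Finsupp.single (C.wordProd r) 1 := by
  induction r with
  | nil => simp
  | cons a r ih =>
    obtain ⟨h1, h2⟩ := C.isReduced_cons.1 hr
    rw [List.map_cons, List.prod_cons, Module.End.mul_apply, ih h1, C.opL_of_not_ldesc h2,
      wordProd_cons]

theorem gs_ne_one (s : B) : C.gs s ≠ 1 := fun h => by
  have := C.desc_mul_gs s 1
  simp [h, C.not_desc_one] at this

theorem len_gs (s : B) : C.len (C.gs s) = 1 := by
  have h1 := C.len_gs_le s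
  have h2 : C.len (C.gs s) ≠ 0 := fun h => C.gs_ne_one s (C.eq_one_of_len_eq_zero h)
  omega

theorem isReduced_pair {s t : B} (h : s ≠ t) : C.IsReduced [s, t] := by
  refine C.isReduced_cons.2 ⟨by simp [IsReduced, len_gs], fun h' => ?_⟩
  have := C.len_gs_mul_of_ldesc h'
  simp only [wordProd_cons, wordProd_nil, mul_one, len_gs, Nat.add_eq_right] at this
  have := C.eq_one_of_len_eq_zero this
  rw [mul_eq_one_iff_eq_inv, gs_inv] at this
  exact h (C.gs_injective this)

theorem isReduced_triple {s t : B} (hst : s ≠ t) (h : M s t = 3) : C.IsReduced [s, t, s] := by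
  refine C.isReduced_cons.2 ⟨C.isReduced_pair hst.symm, fun h' => ?_⟩
  rw [wordProd_cons] at h'
  obtain h1 | ⟨r, hr, h1⟩ := C.left_exchange_cons h'
  · rw [← mul_assoc, mul_eq_right, mul_eq_one_iff_eq_inv, gs_inv] at h1
    exact hst (C.gs_injective h1)
  · simp only [List.length_singleton, Nat.add_eq_right, List.length_eq_zero_iff] at hr
    subst hr
    simp only [wordProd_cons, wordProd_nil, mul_one] at h1
    apply C.gs_not_comm s t h
    calc C.gs s * C.gs t = C.gs s * (C.gs t * C.gs s) * C.gs s := by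
            rw [← mul_assoc, mul_gs_mul_gs]
      _ = C.gs t * C.gs s := by rw [h1]

/-- Both sides commute with the right operators. For `s ≠ t` their values at `1` are the basis
vectors of two reduced words of the same element. -/
theorem opL_braid (s t : B) : altProd (M s t) (C.opL F s) (C.opL F t) =
    altProd (M s t) (C.opL F t) (C.opL F s) := by
  by_cases hst : s = t
  · rw [hst]
  have hc : ∀ m s t s', Commute (altProd m (C.opL F s) (C.opL F t)) (C.opR F s') := by
    intro m
    induction m with
    | zero => exact fun _ _ _ => Commute.one_left _
    | succ m ih => exact fun s t s' => (C.opL_comm_opR s s').mul_left (ih t s s')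
  refine C.eq_of_commute_opR (hc _ s t) (hc _ t s) ?_
  rcases C.laced s t hst with h | h
  · have h1 := C.opL_word (F := F) (C.isReduced_pair hst)
    have h2 := C.opL_word (F := F) (C.isReduced_pair (Ne.symm hst))
    simp only [List.map_cons, List.map_nil, List.prod_cons, List.prod_nil, wordProd_cons,
      wordProd_nil, mul_one] at h1 h2
    rw [h]
    simp only [altProd, mul_one]
    rw [h1, h2, C.gs_comm s t h]
  · have h1 := C.opL_word (F := F) (C.isReduced_triple hst h)
    have h2 := C.opL_word (F := F)
      (C.isReduced_triple (Ne.symm hst) (by rw [M.symmetric, h]))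
    simp only [List.map_cons, List.map_nil, List.prod_cons, List.prod_nil, wordProd_cons,
      wordProd_nil, mul_one] at h1 h2
    rw [h]
    simp only [altProd, mul_one]
    have := C.gs_braid s t h
    rw [h1, h2, ← mul_assoc, this, mul_assoc]

theorem opL_mul_self (s : B) : C.opL F s * C.opL F s = -C.opL F s := by
  refine Finsupp.lhom_ext' fun w => LinearMap.ext_ring ?_
  simp only [LinearMap.comp_apply, Finsupp.lsingle_apply, Module.End.mul_apply,
    LinearMap.neg_apply]
  by_cases h : C.ldesc s w
  · simp [C.opL_of_ldesc h]
  · rw [C.opL_of_not_ldesc h, C.opL_of_ldesc ((C.ldesc_gs_mul s w).2 h)]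

theorem exists_regular : ∃ ρ : HeckeZero F M →ₐ[F] Module.End F (W →₀ F),
    ∀ s, ρ (genBar F s) = C.opL F s :=
  C.exists_algHom (A := Module.End F (W →₀ F)) _ C.opL_mul_self C.opL_braid

end Regular

/-! ### The standard basis of the 0-Hecke algebra -/

/-- The element `π̄_w`. -/
noncomputable def piBar (F : Type*) [Field F] (w : W) : HeckeZero F M :=
  ((C.redWord w).map (genBar F)).prod

theorem prod_genBar {r : List B} (hr : C.IsReduced r) :
    (r.map (genBar F)).prod = C.piBar F (C.wordProd r) :=
  C.matsumoto _ C.genBar_braid hr (C.isReduced_redWord _) (by simp)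

theorem prod_genBar_mem (J : Set B) {r : List B} (hr : ∀ s ∈ r, s ∈ J) :
    (r.map (genBar F : B → HeckeZero F M)).prod ∈ Submonoid.closure (genBar F '' J) :=
  Submonoid.list_prod_mem _ fun x hx => by
    obtain ⟨s, hs, rfl⟩ := List.mem_map.1 hx
    exact Submonoid.subset_closure ⟨s, hr s hs, rfl⟩

@[simp] theorem piBar_one : C.piBar F 1 = 1 := by
  have := C.prod_genBar (F := F) (r := []) (by simp [IsReduced])
  simpa using this.symm

theorem genBar_mul_piBar_of_not_ldesc {s : B} {w : W} (h : ¬ C.ldesc s w) :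
    genBar F s * C.piBar F w = C.piBar F (C.gs s * w) := by
  have := C.prod_genBar (F := F) (r := s :: C.redWord w)
    (C.isReduced_cons.2 ⟨C.isReduced_redWord w, by simpa using h⟩)
  simpa [piBar] using this

theorem genBar_mul_piBar_of_ldesc {s : B} {w : W} (h : C.ldesc s w) :
    genBar F s * C.piBar F w = -C.piBar F w := by
  have h1 : ¬ C.ldesc s (C.gs s * w) := by rwa [C.ldesc_gs_mul, not_not]
  have h2 := C.genBar_mul_piBar_of_not_ldesc (F := F) h1
  rw [gs_mul_gs_mul] at h2
  rw [← h2, ← mul_assoc, genBar_mul_self, neg_mul]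

theorem piBar_mul_genBar_of_not_desc {s : B} {w : W} (h : ¬ C.desc s w) :
    C.piBar F w * genBar F s = C.piBar F (w * C.gs s) := by
  have := C.prod_genBar (F := F) (r := C.redWord w ++ [s])
    (C.isReduced_append_singleton.2 ⟨C.isReduced_redWord w, by simpa using h⟩)
  simpa [piBar] using this

theorem piBar_eq_of_desc {s : B} {w : W} (h : C.desc s w) :
    C.piBar F w = C.piBar F (w * C.gs s) * genBar F s := by
  have h1 : ¬ C.desc s (w * C.gs s) := by rwa [C.desc_mul_gs, not_not]
  have h2 := C.piBar_mul_genBar_of_not_desc (F := F) h1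
  rw [mul_gs_mul_gs] at h2
  exact h2.symm

theorem piBar_mul_genBar_of_desc {s : B} {w : W} (h : C.desc s w) :
    C.piBar F w * genBar F s = -C.piBar F w := by
  rw [C.piBar_eq_of_desc h, mul_assoc, genBar_mul_self, mul_neg]

theorem span_piBar : Submodule.span F (Set.range (C.piBar F)) = ⊤ := by
  have h : ∀ (x : HeckeZero F M), ∀ y ∈ Submodule.span F (Set.range (C.piBar F)),
      x * y ∈ Submodule.span F (Set.range (C.piBar F)) := by
    intro x
    induction x using induction_gen with
    | scalar r =>
      intro y hy
      rw [← Algebra.smul_def]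
      exact Submodule.smul_mem _ _ hy
    | add a b ha hb =>
      intro y hy
      rw [add_mul]
      exact Submodule.add_mem _ (ha y hy) (hb y hy)
    | mul a b ha hb =>
      intro y hy
      rw [mul_assoc]
      exact ha _ (hb y hy)
    | gen s =>
      intro y hy
      rw [gen_eq, add_mul, one_mul]
      refine Submodule.add_mem _ ?_ hy
      induction hy using Submodule.span_induction with
      | mem y hy =>
        obtain ⟨w, rfl⟩ := hy
        by_cases h : C.ldesc s w
        · rw [C.genBar_mul_piBar_of_ldesc h]
          exact Submodule.neg_mem _ (Submodule.subset_span ⟨w, rfl⟩)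
        · rw [C.genBar_mul_piBar_of_not_ldesc h]
          exact Submodule.subset_span ⟨_, rfl⟩
      | zero => simp
      | add a b _ _ ha hb => rw [mul_add]; exact Submodule.add_mem _ ha hb
      | smul c a _ ha => rw [mul_smul_comm]; exact Submodule.smul_mem _ _ ha
  refine eq_top_iff.2 fun x _ => ?_
  have := h x 1 (Submodule.subset_span ⟨1, C.piBar_one⟩)
  rwa [mul_one] at this

/-- Evaluating the regular representation at the basis vector of `1` sends `π̄_w` to the basis
vector of `w`. -/
theorem linearIndependent_piBar : LinearIndependent F (C.piBar F) := by
  obtain ⟨ρ, hρ⟩ := C.exists_regular (F := F)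
  let ev : HeckeZero F M →ₗ[F] (W →₀ F) :=
    (LinearMap.applyₗ (Finsupp.single (1 : W) (1 : F))).comp ρ.toLinearMap
  refine LinearIndependent.of_comp ev ?_
  have : ev ∘ C.piBar F = fun w => Finsupp.single w 1 := by
    ext1 w
    have h1 : ρ (C.piBar F w) = ((C.redWord w).map (C.opL F)).prod := by
      rw [piBar, map_list_prod, List.map_map]
      congr 2
      ext1 s
      exact hρ s
    have h2 := C.opL_word (F := F) (C.isReduced_redWord w)
    rw [← h1, wordProd_redWord] at h2
    exact h2
  rw [this]
  exact Finsupp.linearIndependent_single_one F W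
end DescentSystem

namespace DescentSystem

open HeckeZero

variable {B : Type*} {M : CoxeterMatrix B} {W : Type*} [Group W] (C : DescentSystem M W)
  {F : Type*} [Field F]

/-- The basis `(π̄_w)` of the 0-Hecke algebra. -/
noncomputable def basis (F : Type*) [Field F] : Module.Basis W F (HeckeZero F M) :=
  Module.Basis.mk C.linearIndependent_piBar C.span_piBar.ge

@[simp] theorem basis_apply (w : W) : C.basis F w = C.piBar F w := Module.Basis.mk_apply _ _ w

/-! ### Triangularity of right multiplication -/

open Classical in
/-- The character of the 0-Hecke algebra with `π̄_s ↦ -1` for the right descents `s` of `w`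
and `π̄_s ↦ 0` otherwise. -/
noncomputable def chi (F : Type*) [Field F] (w : W) : HeckeZero F M →ₐ[F] F :=
  HeckeZero.lift (fun s => if C.desc s w then 0 else 1) (fun s => by split_ifs <;> simp)
    (C.altProd_comm_of_idem _ fun s => by split_ifs <;> simp)

theorem chi_gen_of_desc {s : B} {w : W} (h : C.desc s w) : C.chi F w (gen F s) = 0 := by
  rw [chi, lift_gen, if_pos h]

theorem chi_gen_of_not_desc {s : B} {w : W} (h : ¬ C.desc s w) : C.chi F w (gen F s) = 1 := by
  rw [chi, lift_gen, if_neg h]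

theorem chi_genBar_of_desc {s : B} {w : W} (h : C.desc s w) :
    C.chi F w (genBar F s) = -1 := by
  rw [genBar, map_sub, C.chi_gen_of_desc h, map_one, zero_sub]

/-- The span of the `π̄_v` with `v` of length at least `k`. -/
def longSpan (F : Type*) [Field F] (k : ℕ) : Submodule F (HeckeZero F M) :=
  Submodule.span F (C.piBar F '' {v | k ≤ C.len v})

theorem piBar_mem_longSpan {k : ℕ} {v : W} (h : k ≤ C.len v) : C.piBar F v ∈ C.longSpan F k :=
  Submodule.subset_span ⟨v, h, rfl⟩

theorem longSpan_mul {k : ℕ} {x : HeckeZero F M} (hx : x ∈ C.longSpan F k)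
    (h : HeckeZero F M) : x * h ∈ C.longSpan F k := by
  induction h using induction_gen generalizing x with
  | scalar r =>
    rw [← Algebra.commutes, ← Algebra.smul_def]
    exact Submodule.smul_mem _ _ hx
  | add a b ha hb =>
    rw [mul_add]
    exact Submodule.add_mem _ (ha hx) (hb hx)
  | mul a b ha hb =>
    rw [← mul_assoc]
    exact hb (ha hx)
  | gen s =>
    rw [gen_eq, mul_add, mul_one]
    refine Submodule.add_mem _ ?_ hx
    induction hx using Submodule.span_induction with
    | mem y hy =>
      obtain ⟨w, hw, rfl⟩ := hy
      by_cases h : C.desc s w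
      · rw [C.piBar_mul_genBar_of_desc h]
        exact Submodule.neg_mem _ (C.piBar_mem_longSpan hw)
      · rw [C.piBar_mul_genBar_of_not_desc h]
        refine C.piBar_mem_longSpan ?_
        rw [C.len_mul_gs_of_not_desc h]
        exact Nat.le_succ_of_le hw
    | zero => simp
    | add a b _ _ ha hb => rw [add_mul]; exact Submodule.add_mem _ ha hb
    | smul c a _ ha => rw [smul_mul_assoc]; exact Submodule.smul_mem _ _ ha

/-- On `π̄_w` a generator `π_s` gives `0` at a descent and `π̄_w + π̄_{ws}` otherwise. Products
cause no trouble because `longSpan` is stable under right multiplication. -/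
theorem piBar_mul_sub_mem (w : W) (h : HeckeZero F M) :
    C.piBar F w * h - C.chi F w h • C.piBar F w ∈ C.longSpan F (C.len w + 1) := by
  induction h using induction_gen with
  | scalar r =>
    rw [← Algebra.commutes, ← Algebra.smul_def, AlgHom.commutes]
    simp
  | add a b ha hb =>
    convert Submodule.add_mem _ ha hb using 1
    rw [mul_add, map_add, add_smul]
    abel
  | mul a b ha hb =>
    convert Submodule.add_mem _ (C.longSpan_mul ha b) (Submodule.smul_mem _ (C.chi F w a) hb)
      using 1
    rw [map_mul, sub_mul, smul_mul_assoc, smul_sub, smul_smul, mul_assoc]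
    abel
  | gen s =>
    by_cases h : C.desc s w
    · rw [C.chi_gen_of_desc h, gen_eq, mul_add, C.piBar_mul_genBar_of_desc h]
      simp
    · rw [C.chi_gen_of_not_desc h, gen_eq, mul_add, C.piBar_mul_genBar_of_not_desc h]
      simp only [mul_one, one_smul, add_sub_cancel_right]
      exact C.piBar_mem_longSpan (C.len_mul_gs_of_not_desc h).ge

theorem repr_of_mem_longSpan {k : ℕ} {x : HeckeZero F M} (hx : x ∈ C.longSpan F k) {w : W}
    (hw : C.len w < k) : (C.basis F).repr x w = 0 := by
  induction hx using Submodule.span_induction with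
  | mem y hy =>
    obtain ⟨v, hv, rfl⟩ := hy
    rw [← basis_apply, Module.Basis.repr_self]
    refine Finsupp.single_eq_of_ne ?_
    rintro rfl
    exact absurd hv (by simpa using hw)
  | zero => simp
  | add a b _ _ ha hb => simp [ha, hb]
  | smul c a _ ha => simp [ha]

/-- The correction terms are longer than `v`, hence longer than `w`, and do not reach the
coefficient of `w`. For `v ≠ w` both sides are zero. -/
theorem repr_piBar_mul {v w : W} (hvw : C.len w ≤ C.len v) (h : HeckeZero F M) :
    (C.basis F).repr (C.piBar F v * h) w = (C.basis F).repr (C.piBar F v) w * C.chi F w h := by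
  have h1 := C.repr_of_mem_longSpan (C.piBar_mul_sub_mem v h) (Nat.lt_succ_of_le hvw)
  rw [map_sub, Finsupp.sub_apply, sub_eq_zero] at h1
  rw [h1, ← basis_apply]
  by_cases hw : v = w
  · subst hw
    simp [-basis_apply]
  · have h0 : (C.basis F).repr (C.basis F v) w = 0 := by
      rw [Module.Basis.repr_self, Finsupp.single_eq_of_ne (Ne.symm hw)]
    rw [map_smul, Finsupp.smul_apply, h0, smul_zero, zero_mul]

/-- For `x ≠ 0`, the coefficient in `x h` of some `π̄_w` occurring in `x` (one of minimal length)
is obtained by applying the character of `w` to `h`. -/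
theorem exists_repr_mul {x : HeckeZero F M} (hx : x ≠ 0) :
    ∃ w, (C.basis F).repr x w ≠ 0 ∧ ∀ h, (C.basis F).repr (x * h) w =
      (C.basis F).repr x w * C.chi F w h := by
  have hne : ((C.basis F).repr x).support.Nonempty := by
    rw [Finsupp.support_nonempty_iff]
    simpa using hx
  obtain ⟨w, hw, hmin⟩ := Finset.exists_min_image _ C.len hne
  refine ⟨w, by simpa using hw, fun h => ?_⟩
  have h1 := (C.basis F).linearCombination_repr x
  rw [Finsupp.linearCombination_apply, Finsupp.sum] at h1
  have h2 : (C.basis F).repr (x * h) w = ∑ v ∈ ((C.basis F).repr x).support,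
      (C.basis F).repr x v * (C.basis F).repr (C.piBar F v * h) w := by
    conv_lhs => rw [← h1]
    simp [Finset.sum_mul, Finsupp.finsetSum_apply]
  have h3 : (C.basis F).repr x w = ∑ v ∈ ((C.basis F).repr x).support,
      (C.basis F).repr x v * (C.basis F).repr (C.piBar F v) w := by
    conv_lhs => rw [← h1]
    simp [Finsupp.finsetSum_apply, -Module.Basis.repr_self]
  rw [h2]
  conv_rhs => rw [h3]
  rw [Finset.sum_mul]
  refine Finset.sum_congr rfl fun v hv => ?_
  rw [C.repr_piBar_mul (hmin v hv) h, mul_assoc]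

end DescentSystem

namespace HeckeZero

/-! ### The elements `π̄_{w₀(I)}` and `π_{w₀(L)}` -/

variable {F : Type*} [Field F] {B : Type*} {M : CoxeterMatrix B}

/-- The characteristic properties of `π̄_{w₀(I)}`. -/
structure IsBarTop (I : Set B) (e : HeckeZero F M) : Prop where
  mem : e ∈ Submonoid.closure (genBar F '' I)
  left : ∀ s ∈ I, genBar F s * e = -e
  right : ∀ s ∈ I, e * genBar F s = -e

/-- The characteristic properties of `π_{w₀(L)}`. -/
structure IsPiTop (L : Set B) (g : HeckeZero F M) : Prop where
  mem : g ∈ Submonoid.closure (gen F '' L)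
  left : ∀ s ∈ L, genBar F s * g = 0
  right : ∀ s ∈ L, g * genBar F s = 0

/-- The element `e` is a product of generators each acting on `x` as `-1`. The sign need not be
tracked, since only generated left ideals matter later. -/
theorem mul_eq_or_neg {I : Set B} {x e : HeckeZero F M}
    (he : e ∈ Submonoid.closure (genBar F '' I)) (hx : ∀ s ∈ I, x * genBar F s = -x) :
    x * e = x ∨ x * e = -x := by
  induction he using Submonoid.closure_induction with
  | mem y hy => obtain ⟨s, hs, rfl⟩ := hy; exact Or.inr (hx s hs)
  | one => simp
  | mul a b _ _ ha hb =>
    rw [← mul_assoc]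
    rcases ha with ha | ha <;> rcases hb with hb | hb <;> simp [ha, hb]

end HeckeZero

namespace DescentSystem

open HeckeZero

variable {B : Type*} {M : CoxeterMatrix B} {W : Type*} [Group W] (C : DescentSystem M W)
  {F : Type*} [Field F]

theorem chi_barTop {I : Set B} {w : W} (hw : ∀ s ∈ I, C.desc s w) {e : HeckeZero F M}
    (he : e ∈ Submonoid.closure (genBar F '' I)) : C.chi F w e ≠ 0 := by
  induction he using Submonoid.closure_induction with
  | mem y hy => obtain ⟨s, hs, rfl⟩ := hy; rw [C.chi_genBar_of_desc (hw s hs)]; simp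
  | one => simp
  | mul a b _ _ ha hb => rw [map_mul]; exact mul_ne_zero ha hb

theorem chi_piTop {L : Set B} {w : W} (hw : ∀ s ∈ L, ¬ C.desc s w) {g : HeckeZero F M}
    (hg : g ∈ Submonoid.closure (gen F '' L)) : C.chi F w g = 1 := by
  induction hg using Submonoid.closure_induction with
  | mem y hy => obtain ⟨s, hs, rfl⟩ := hy; exact C.chi_gen_of_not_desc (hw s hs)
  | one => simp
  | mul a b _ _ ha hb => rw [map_mul, ha, hb, mul_one]

theorem prod_gen {r r' : List B} (hr : C.IsReduced r) (hr' : C.IsReduced r')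
    (h : C.wordProd r = C.wordProd r') :
    (r.map (gen F)).prod = ((r'.map (gen F)).prod : HeckeZero F M) :=
  C.matsumoto _ (gen_braid F) hr hr' h

/-- Any reduced word of the longest element of a parabolic subgroup gives `π̄_{w₀(I)}`. -/
theorem isBarTop_prod {I : Set B} {r : List B} (hr : C.IsReduced r)
    (h : IsLongest C.gs I (C.wordProd r)) :
    IsBarTop I ((r.map (genBar F)).prod : HeckeZero F M) := by
  refine ⟨prod_genBar_mem I (C.mem_of_isReduced hr h.1), fun s hs => ?_, fun s hs => ?_⟩
  · rw [C.prod_genBar hr, C.genBar_mul_piBar_of_ldesc (IsLongest.ldesc C h hs)]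
  · rw [C.prod_genBar hr, C.piBar_mul_genBar_of_desc (IsLongest.desc C h hs)]

/-- Any reduced word of the longest element of a parabolic subgroup gives `π_{w₀(L)}`. -/
theorem isPiTop_prod {L : Set B} {r : List B} (hr : C.IsReduced r)
    (h : IsLongest C.gs L (C.wordProd r)) :
    IsPiTop L ((r.map (gen F)).prod : HeckeZero F M) := by
  refine ⟨Submonoid.list_prod_mem _ fun x hx => ?_, fun s hs => ?_, fun s hs => ?_⟩
  · obtain ⟨s, hs, rfl⟩ := List.mem_map.1 hx
    exact Submonoid.subset_closure ⟨s, C.mem_of_isReduced hr h.1 s hs, rfl⟩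
  · obtain ⟨q, hq, hqr⟩ := C.exists_reduced_of_ldesc (IsLongest.ldesc C h hs)
    rw [C.prod_gen hr hq hqr.symm, List.map_cons, List.prod_cons, ← mul_assoc, genBar_mul_gen,
      zero_mul]
  · obtain ⟨q, hq, hqr⟩ := C.exists_reduced_of_desc (IsLongest.desc C h hs)
    rw [C.prod_gen hr hq hqr.symm, List.map_append, List.prod_append, mul_assoc]
    simp [gen_mul_genBar]

theorem exists_isLongest [Finite W] (I : Set B) : ∃ w, IsLongest C.gs I w := by
  obtain ⟨w, hw, h⟩ := Set.exists_max_image (C.para I : Set W) C.len (Set.toFinite _)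
    ⟨1, one_mem _⟩
  exact ⟨w, hw, h⟩

theorem exists_isBarTop (C : DescentSystem M W) (F : Type*) [Field F] [Finite W] (I : Set B) :
    ∃ e : HeckeZero F M, IsBarTop I e := by
  obtain ⟨w, hw⟩ := C.exists_isLongest I
  obtain ⟨r, rfl, hr⟩ := C.exists_reduced w
  exact ⟨_, C.isBarTop_prod hr hw⟩

theorem exists_isPiTop (C : DescentSystem M W) (F : Type*) [Field F] [Finite W] (L : Set B) :
    ∃ g : HeckeZero F M, IsPiTop L g := by
  obtain ⟨w, hw⟩ := C.exists_isLongest L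
  obtain ⟨r, rfl, hr⟩ := C.exists_reduced w
  exact ⟨_, C.isPiTop_prod hr hw⟩

theorem piBar_mul_eq_zero {L : Set B} {g : HeckeZero F M} (hg : IsPiTop L g) {s : B}
    (hs : s ∈ L) {w : W} (hw : C.desc s w) : C.piBar F w * g = 0 := by
  rw [C.piBar_eq_of_desc hw, mul_assoc, hg.left s hs, mul_zero]

/-- Right multiplication by `π̄_s` sends each `π̄_v` to `±π̄_{v'}` with `s` a descent of `v'`. -/
theorem repr_mul_genBar {s : B} {w : W} (h : ¬ C.desc s w) (x : HeckeZero F M) :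
    (C.basis F).repr (x * genBar F s) w = 0 := by
  have key : ∀ v, C.desc s v → (C.basis F).repr (C.piBar F v) w = 0 := fun v hv => by
    rw [← basis_apply, Module.Basis.repr_self]
    exact Finsupp.single_eq_of_ne (by rintro rfl; exact h hv)
  have hx : x ∈ Submodule.span F (Set.range (C.piBar F)) := by rw [C.span_piBar]; trivial
  induction hx using Submodule.span_induction with
  | mem y hy =>
    obtain ⟨v, rfl⟩ := hy
    by_cases hv : C.desc s v
    · rw [C.piBar_mul_genBar_of_desc hv, map_neg, Finsupp.neg_apply, key v hv, neg_zero]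
    · rw [C.piBar_mul_genBar_of_not_desc hv, key _ ((C.desc_mul_gs s v).2 hv)]
  | zero => simp
  | add a b _ _ ha hb => simp [add_mul, ha, hb]
  | smul c a _ ha => simp [ha]

/-- If the descent `t` were lost, folding would give `w = s w t`, while the right-hand side would
have length `len w + 2`. -/
theorem desc_gs_mul {s t : B} {w : W} (h : C.desc t w) (hs : ¬ C.ldesc s w) :
    C.desc t (C.gs s * w) := by
  by_contra h'
  have h1 := C.fold t s (C.gs s * w) h' (by rwa [gs_mul_gs_mul])
  rw [gs_mul_gs_mul] at h1
  have h2 := C.len_gs_mul_of_not_ldesc hs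
  have h3 := C.len_mul_gs_of_not_desc h'
  rw [← h1] at h3
  omega

end DescentSystem

namespace DescentSystem

open HeckeZero

variable {B : Type*} {M : CoxeterMatrix B} {W : Type*} [Group W] (C : DescentSystem M W)
  {F : Type*} [Field F]

/-! ### Modules spanned by descent classes -/

/-- The elements of `W` having every element of `I` and no element of `L` as a right descent. -/
def interval (I L : Set B) : Set W := {w | (∀ s ∈ I, C.desc s w) ∧ ∀ s ∈ L, ¬ C.desc s w}

/-- The vector space `V` has a basis indexed by `C.interval I L`, and `op s` acts on it as `π̄_s`
acts on tableaux. -/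
structure IsTableauModel (I L : Set B) {V T : Type*} [AddCommGroup V] [Module F V]
    (v : Module.Basis T F V) (wd : T → W) (op : B → Module.End F V) : Prop where
  inj : Function.Injective wd
  range_eq : Set.range wd = C.interval I L
  op_neg : ∀ s τ, C.ldesc s (wd τ) → op s (v τ) = -v τ
  op_zero : ∀ s τ, ¬ C.ldesc s (wd τ) → C.gs s * wd τ ∉ C.interval I L → op s (v τ) = 0
  op_up : ∀ s τ σ, ¬ C.ldesc s (wd τ) → wd σ = C.gs s * wd τ → op s (v τ) = v σ

section Model

variable {I L : Set B} {V T : Type*} [AddCommGroup V] [Module F V]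
  (v : Module.Basis T F V) (wd : T → W)

/-- The map sending the basis vector `v τ` to `π̄_{wd τ} g`. -/
noncomputable def emb (g : HeckeZero F M) : V →ₗ[F] HeckeZero F M :=
  v.constr F fun τ => C.piBar F (wd τ) * g

@[simp] theorem emb_basis (g : HeckeZero F M) (τ : T) :
    C.emb v wd g (v τ) = C.piBar F (wd τ) * g := by
  simp [emb]

theorem emb_eq_mul (g : HeckeZero F M) (x : V) : C.emb v wd g x = C.emb v wd 1 x * g := by
  have : C.emb v wd g = (LinearMap.mulRight F g).comp (C.emb v wd 1) :=
    v.ext fun τ => by simp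
  rw [this]
  rfl

variable {v wd} {op : B → Module.End F V}

namespace IsTableauModel

theorem mem (h : C.IsTableauModel I L v wd op) (τ : T) : wd τ ∈ C.interval I L :=
  h.range_eq ▸ Set.mem_range_self τ

/-- The decisive case is `s w` outside the class. By `desc_gs_mul` its descents in `I` are intact,
so it has a descent in `L`, and `g` annihilates `π̄_{sw}`, matching the prescribed value `0`. -/
theorem emb_op (h : C.IsTableauModel I L v wd op) {g : HeckeZero F M} (hg : IsPiTop L g)
    (s : B) (x : V) :
    C.emb v wd g (op s x) = genBar F s * C.emb v wd g x := by
  have : (C.emb v wd g).comp (op s) = (LinearMap.mulLeft F (genBar F s)).comp (C.emb v wd g) := by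
    refine v.ext fun τ => ?_
    simp only [LinearMap.comp_apply, LinearMap.mulLeft_apply, emb_basis, ← mul_assoc]
    by_cases h1 : C.ldesc s (wd τ)
    · simp [h.op_neg s τ h1, C.genBar_mul_piBar_of_ldesc h1]
    · rw [C.genBar_mul_piBar_of_not_ldesc h1]
      by_cases h2 : C.gs s * wd τ ∈ C.interval I L
      · obtain ⟨σ, hσ⟩ := h.range_eq.symm ▸ h2
        rw [h.op_up s τ σ h1 hσ, emb_basis, hσ]
      · rw [h.op_zero s τ h1 h2, map_zero]
        have h3 : ∃ t ∈ L, C.desc t (C.gs s * wd τ) := by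
          by_contra! h3
          exact h2 ⟨fun t ht => C.desc_gs_mul ((h.mem C τ).1 t ht) h1, h3⟩
        obtain ⟨t, ht, h3⟩ := h3
        rw [C.piBar_mul_eq_zero hg ht h3]
  exact LinearMap.congr_fun this x

/-- With `g = 1` the map `emb` is injective by linear independence alone. Its values are supported
on the class, so the leading element `w` lies there and the values of `χ_w` on top elements are
known. -/
theorem exists_repr_mul (h : C.IsTableauModel I L v wd op) {x : V} (hx : x ≠ 0) :
    ∃ w ∈ C.interval I L, (C.basis F).repr (C.emb v wd 1 x) w ≠ 0 ∧ ∀ y,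
      (C.basis F).repr (C.emb v wd 1 x * y) w =
        (C.basis F).repr (C.emb v wd 1 x) w * C.chi F w y := by
  have hinj : Function.Injective (C.emb v wd (1 : HeckeZero F M)) := by
    have h1 := (C.linearIndependent_piBar (F := F)).comp wd h.inj
    have h2 : C.emb v wd (1 : HeckeZero F M) =
        (Finsupp.linearCombination F (C.piBar F ∘ wd)).comp v.repr.toLinearMap :=
      v.ext fun τ => by simp
    rw [h2]
    exact (show Function.Injective (Finsupp.linearCombination F (C.piBar F ∘ wd)) from h1).comp
      v.repr.injective
  obtain ⟨w, hw, hmul⟩ := C.exists_repr_mul (fun h0 => hx (hinj (h0.trans (map_zero _).symm)))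
  refine ⟨w, ?_, hw, hmul⟩
  by_contra hw'
  apply hw
  have : (Finsupp.lapply w).comp ((C.basis F).repr.toLinearMap.comp (C.emb v wd 1)) = 0 := by
    refine v.ext fun τ => ?_
    simp only [LinearMap.comp_apply, emb_basis, mul_one, LinearEquiv.coe_coe,
      ← basis_apply, Module.Basis.repr_self, Finsupp.lapply_apply, LinearMap.zero_apply]
    exact Finsupp.single_eq_of_ne (fun e => hw' (e ▸ h.mem C τ))
  exact LinearMap.congr_fun this x

/-- The leading coefficient survives multiplication by `g`, because `χ_w(g) = 1` when `w` has no
descent in `L`. -/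
theorem emb_injective (h : C.IsTableauModel I L v wd op) {g : HeckeZero F M} (hg : IsPiTop L g) :
    Function.Injective (C.emb v wd g) := by
  rw [injective_iff_map_eq_zero]
  intro x hx
  by_contra hne
  obtain ⟨w, hwi, hw, hmul⟩ := h.exists_repr_mul C hne
  have := hmul g
  rw [← C.emb_eq_mul, hx, C.chi_piTop hwi.2 hg.mem] at this
  simp at this
  exact hw this.symm

/-- The relations hold for left multiplication in the algebra and are pulled back along the
injective map `emb`. -/
theorem exists_rep (h : C.IsTableauModel I L v wd op) [Finite W] :
    ∃ ρ : HeckeZero F M →ₐ[F] Module.End F V,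
    ∀ s, ρ (genBar F s) = op s := by
  obtain ⟨g, hg⟩ := C.exists_isPiTop F L
  have hinj := h.emb_injective C hg
  refine C.exists_algHom (A := Module.End F V) op (fun s => ?_) (fun s t => ?_)
  · refine LinearMap.ext fun x => hinj ?_
    simp only [Module.End.mul_apply, h.emb_op C hg, LinearMap.neg_apply, map_neg]
    rw [← mul_assoc, genBar_mul_self, neg_mul]
  · have : ∀ m s t x, C.emb v wd g (altProd m (op s) (op t) x) =
        altProd m (genBar F s) (genBar F t) * C.emb v wd g x := by
      intro m
      induction m with
      | zero => simp [altProd]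
      | succ m ih => intro s t x; simp [altProd, h.emb_op C hg, ih, mul_assoc]
    refine LinearMap.ext fun x => hinj ?_
    rw [this, this, C.genBar_braid]

theorem mem_range_emb (h : C.IsTableauModel I L v wd op) {e g : HeckeZero F M}
    (he : IsBarTop I e) (hg : IsPiTop L g)
    (y : HeckeZero F M) : y ∈ LinearMap.range (C.emb v wd g) ↔ ∃ z, y = z * (e * g) := by
  constructor
  · have : ∀ x, ∃ z, C.emb v wd g x = z * (e * g) := by
      intro x
      induction v.mem_span x using Submodule.span_induction with
      | mem y hy =>
        obtain ⟨τ, rfl⟩ := hy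
        rw [emb_basis]
        rcases mul_eq_or_neg he.mem (x := C.piBar F (wd τ)) fun s hs =>
          C.piBar_mul_genBar_of_desc ((h.mem C τ).1 s hs) with h1 | h1
        · exact ⟨C.piBar F (wd τ), by rw [← mul_assoc, h1]⟩
        · exact ⟨-C.piBar F (wd τ), by rw [← mul_assoc, neg_mul, h1, neg_neg]⟩
      | zero => exact ⟨0, by simp⟩
      | add a b _ _ ha hb =>
        obtain ⟨z, hz⟩ := ha
        obtain ⟨z', hz'⟩ := hb
        exact ⟨z + z', by rw [map_add, hz, hz', add_mul]⟩
      | smul c a _ ha =>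
        obtain ⟨z, hz⟩ := ha
        exact ⟨c • z, by rw [map_smul, hz, smul_mul_assoc]⟩
    rintro ⟨x, rfl⟩
    exact this x
  · rintro ⟨z, rfl⟩
    rw [← mul_assoc]
    -- Since `e π̄_s = -e` for `s ∈ I`, the element `z e` is supported on elements having all of `I`
    -- as descents. Of the corresponding terms, those with a descent in `L` are then killed by `g`.
    have hr : ∀ w, (∃ s ∈ I, ¬ C.desc s w) → (C.basis F).repr (z * e) w = 0 := by
      rintro w ⟨s, hs, hw⟩
      have := C.repr_mul_genBar hw (z * e)
      rw [mul_assoc, he.right s hs, mul_neg, map_neg, Finsupp.neg_apply, neg_eq_zero] at this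
      exact this
    rw [← (C.basis F).linearCombination_repr (z * e), Finsupp.linearCombination_apply,
      Finsupp.sum, Finset.sum_mul]
    refine Submodule.sum_mem _ fun w hw => ?_
    rw [smul_mul_assoc, basis_apply]
    refine Submodule.smul_mem _ _ ?_
    by_cases hwi : w ∈ C.interval I L
    · rw [← h.range_eq] at hwi
      obtain ⟨τ, rfl⟩ := hwi
      exact ⟨v τ, C.emb_basis v wd g τ⟩
    · have h1 : ∀ s ∈ I, C.desc s w := fun s hs => by
        by_contra hd
        exact Finsupp.mem_support_iff.1 hw (hr w ⟨s, hs, hd⟩)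
      have h2 : ∃ t ∈ L, C.desc t w := by
        by_contra! h2
        exact hwi ⟨h1, h2⟩
      obtain ⟨t, ht, h2⟩ := h2
      rw [C.piBar_mul_eq_zero hg ht h2]
      exact Submodule.zero_mem _

variable [Module (HeckeZero F M) V] [IsScalarTower F (HeckeZero F M) V]

/-- The embedding of `V` into the 0-Hecke algebra as a linear map over the latter. -/
noncomputable def embLin (h : C.IsTableauModel I L v wd op)
    (hop : ∀ (s : B) (x : V), (genBar F s : HeckeZero F M) • x = op s x)
    {g : HeckeZero F M} (hg : IsPiTop L g) :
    V →ₗ[HeckeZero F M] HeckeZero F M where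
  toFun := C.emb v wd g
  map_add' := map_add _
  map_smul' := map_smul_of_genBar _ fun s x => by rw [hop, h.emb_op C hg, smul_eq_mul]

/-- `V` is the left ideal generated by `π̄_{w₀(I)} π_{w₀(L)}`. -/
noncomputable def idealEquiv (h : C.IsTableauModel I L v wd op)
    (hop : ∀ (s : B) (x : V), (genBar F s : HeckeZero F M) • x = op s x)
    {e g : HeckeZero F M} (he : IsBarTop I e) (hg : IsPiTop L g) :
    V ≃ₗ[HeckeZero F M] Submodule.span (HeckeZero F M) {e * g} :=
  (LinearEquiv.ofInjective (h.embLin C hop hg) (h.emb_injective C hg)).trans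
    (LinearEquiv.ofEq _ _ (by
      ext y
      rw [Submodule.mem_span_singleton]
      have := h.mem_range_emb C he hg y
      simp only [LinearMap.mem_range, smul_eq_mul, eq_comm (a := y)] at this ⊢
      exact this))

theorem coe_idealEquiv (h : C.IsTableauModel I L v wd op)
    (hop : ∀ (s : B) (x : V), (genBar F s : HeckeZero F M) • x = op s x)
    {e g : HeckeZero F M} (he : IsBarTop I e) (hg : IsPiTop L g) (x : V) :
    (h.idealEquiv C hop he hg x : HeckeZero F M) = C.emb v wd g x := rfl

end IsTableauModel

end Model

/-- The module of a disjoint union of descent classes is the direct sum of their modules. -/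
theorem nonempty_equiv_directSum [Finite W] {I L : Set B} {V T : Type*} [AddCommGroup V]
    [Module F V] [Module (HeckeZero F M) V] [IsScalarTower F (HeckeZero F M) V]
    {v : Module.Basis T F V} {wd : T → W} {op : B → Module.End F V}
    (h : C.IsTableauModel I L v wd op)
    (hop : ∀ (s : B) (x : V), (genBar F s : HeckeZero F M) • x = op s x)
    {κ : Type*} [Finite κ] {I' L' : κ → Set B} {V' T' : κ → Type*} [∀ k, AddCommGroup (V' k)]
    [∀ k, Module F (V' k)] [∀ k, Module (HeckeZero F M) (V' k)]
    [∀ k, IsScalarTower F (HeckeZero F M) (V' k)]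
    {v' : ∀ k, Module.Basis (T' k) F (V' k)} {wd' : ∀ k, T' k → W}
    {op' : ∀ k, B → Module.End F (V' k)}
    (h' : ∀ k, C.IsTableauModel (I' k) (L' k) (v' k) (wd' k) (op' k))
    (hop' : ∀ k (s : B) (x : V' k), (genBar F s : HeckeZero F M) • x = op' k s x)
    (hsub : ∀ k, C.interval (I' k) (L' k) ⊆ C.interval I L)
    (hdisj : ∀ k k' w, w ∈ C.interval (I' k) (L' k) → w ∈ C.interval (I' k') (L' k') → k = k')
    (hcov : ∀ w ∈ C.interval I L, ∃ k, w ∈ C.interval (I' k) (L' k)) :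
    Nonempty (V ≃ₗ[HeckeZero F M] ⨁ k, V' k) := by
  classical
  have := Fintype.ofFinite κ
  have : Finite T := Finite.of_injective wd h.inj
  have : ∀ k, Finite (T' k) := fun k => Finite.of_injective (wd' k) (h' k).inj
  obtain ⟨g, hg⟩ := C.exists_isPiTop F L
  choose g' hg' using fun k => C.exists_isPiTop F (L' k)
  choose e' he' using fun k => C.exists_isBarTop F (I' k)
  -- Embed `V`, multiply on the right by `e' k * g' k`, and read the result, an element of the left
  -- ideal of the `k`-th class, back in `V' k`.
  let f : ∀ k, V →ₗ[HeckeZero F M] V' k := fun k =>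
    ((h' k).idealEquiv C (hop' k) (he' k) (hg' k)).symm.toLinearMap.comp
      (LinearMap.codRestrict _
        ((LinearMap.toSpanSingleton (HeckeZero F M) (HeckeZero F M) (e' k * g' k)).comp
          (h.embLin C hop hg))
        fun x => Submodule.mem_span_singleton.2 ⟨_, rfl⟩)
  have hf : ∀ k x, C.emb (v' k) (wd' k) (g' k) (f k x) =
      C.emb v wd g x * (e' k * g' k) := by
    intro k x
    rw [← (h' k).coe_idealEquiv C (hop' k) (he' k) (hg' k)]
    simp only [f, LinearMap.comp_apply, LinearEquiv.coe_coe, LinearEquiv.apply_symm_apply]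
    rfl
  let Φ : V →ₗ[HeckeZero F M] (∀ k, V' k) := LinearMap.pi f
  have hinj : Function.Injective Φ := by
    rw [injective_iff_map_eq_zero]
    intro x hx
    by_contra hne
    -- The leading `w` of `x` lies in one of the smaller classes `k`. There `χ_w` does not vanish on
    -- `g * (e' k * g' k)`, so the `k`-th component of the image is nonzero.
    obtain ⟨w, hwi, hw, hmul⟩ := h.exists_repr_mul C hne
    obtain ⟨k, hk⟩ := hcov w hwi
    have h1 : f k x = 0 := congrFun hx k
    have h2 := hf k x
    rw [h1, map_zero, C.emb_eq_mul, mul_assoc] at h2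
    have h3 := hmul (g * (e' k * g' k))
    rw [← h2, map_mul, map_mul, C.chi_piTop hwi.2 hg.mem, C.chi_piTop hk.2 (hg' k).mem] at h3
    have := C.chi_barTop hk.1 (he' k).mem
    simp [hw, this] at h3
  have : Module.Finite F V := Module.Finite.of_basis v
  have : ∀ k, Module.Finite F (V' k) := fun k => Module.Finite.of_basis (v' k)
  -- The smaller classes are disjoint subsets of the large one. With this bound an injective map is
  -- bijective.
  have hle : Module.finrank F (∀ k, V' k) ≤ Module.finrank F V := by
    rw [Module.finrank_pi_fintype, Module.finrank_eq_nat_card_basis v]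
    simp only [fun k => Module.finrank_eq_nat_card_basis (v' k)]
    rw [← Nat.card_sigma]
    have hex : ∀ p : Σ k, T' k, ∃ τ, wd τ = wd' p.1 p.2 := fun p => by
      have := hsub p.1 ((h' p.1).mem C p.2)
      rwa [← h.range_eq] at this
    choose q hq using hex
    refine Nat.card_le_card_of_injective q ?_
    rintro ⟨k, τ⟩ ⟨k', τ'⟩ hqq
    have h1 : wd' k τ = wd' k' τ' := by rw [← hq ⟨k, τ⟩, ← hq ⟨k', τ'⟩, hqq]
    obtain rfl := hdisj k k' _ ((h' k).mem C τ) (h1 ▸ (h' k').mem C τ')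
    rw [(h' k).inj h1]
  have hinjF : Function.Injective (Φ.restrictScalars F) := hinj
  have hsurj : Function.Surjective (Φ.restrictScalars F) :=
    (LinearMap.injective_iff_surjective_of_finrank_eq_finrank
      (le_antisymm (LinearMap.finrank_le_finrank_of_injective hinjF) hle)).1 hinjF
  exact ⟨(LinearEquiv.ofBijective Φ ⟨hinj, hsurj⟩).trans
    (DirectSum.linearEquivFunOnFintype (HeckeZero F M) κ V').symm⟩

end DescentSystem

namespace HeckeZero

variable {F : Type*} [Field F] {B : Type*} {M : CoxeterMatrix B}

theorem map_gen {B' : Type*} {M' : CoxeterMatrix B'} (φ : B' → B)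
    (hM : ∀ s t, M (φ s) (φ t) = M' s t) (s : B') :
    HeckeZero.map φ hM (gen F s : HeckeZero F M') = gen F (φ s) := by
  rw [HeckeZero.map, lift_gen]

theorem map_genBar {B' : Type*} {M' : CoxeterMatrix B'} (φ : B' → B)
    (hM : ∀ s t, M (φ s) (φ t) = M' s t) (s : B') :
    HeckeZero.map φ hM (genBar F s : HeckeZero F M') = genBar F (φ s) := by
  rw [genBar, map_sub, map_one, map_gen, genBar]

end HeckeZero

namespace DescentSystem

open HeckeZero

variable {B : Type*} {M : CoxeterMatrix B} {W : Type*} [Group W] (C : DescentSystem M W)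
  {F : Type*} [Field F]

/-! ### Parabolic subsystems -/

section Sub

variable {B' : Type*} {M' : CoxeterMatrix B'} (φ : B' → B) (hφ : Function.Injective φ)
  (hM : ∀ s t, M (φ s) (φ t) = M' s t)

/-- The parabolic subgroup generated by the image of `φ`. -/
def sub : DescentSystem M' (C.para (Set.range φ)) where
  gs s := ⟨C.gs (φ s), C.gs_mem_para ⟨s, rfl⟩⟩
  desc s w := C.desc (φ s) w
  gs_mul_self s := Subtype.ext (C.gs_mul_self _)
  gs_injective s t h := hφ (C.gs_injective (congrArg Subtype.val h))
  closure_eq_top := by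
    refine Eq.trans ?_ (Subgroup.closure_closure_coe_preimage (k := C.gs '' Set.range φ))
    congr 1
    ext x
    constructor
    · rintro ⟨s, rfl⟩
      exact ⟨_, ⟨s, rfl⟩, rfl⟩
    · rintro ⟨_, ⟨s, rfl⟩, h⟩
      exact ⟨s, Subtype.ext h⟩
  not_desc_one s := C.not_desc_one _
  desc_mul_gs s w := C.desc_mul_gs _ _
  fold s t w h h' := Subtype.ext (C.fold _ _ _ h h')
  laced s t h := by rw [← hM]; exact C.laced _ _ (hφ.ne h)
  gs_comm s t h := Subtype.ext (C.gs_comm _ _ (by rw [hM, h]))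
  gs_braid s t h := Subtype.ext (C.gs_braid _ _ (by rw [hM, h]))
  gs_not_comm s t h h' := C.gs_not_comm _ _ (by rw [hM, h]) (congrArg Subtype.val h')

theorem coe_sub_wordProd (r : List B') :
    ((C.sub φ hφ hM).wordProd r : W) = C.wordProd (r.map φ) := by
  induction r with
  | nil => rfl
  | cons a r ih =>
    rw [wordProd_cons, Subgroup.coe_mul, ih]
    rfl

/-- Reducedness is a condition on the left descents of suffixes, and descents of the subsystem are
by definition descents of the large system. -/
theorem sub_isReduced {r : List B'} (hr : (C.sub φ hφ hM).IsReduced r) :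
    C.IsReduced (r.map φ) := by
  induction r with
  | nil => simp [IsReduced]
  | cons a r ih =>
    rw [isReduced_cons] at hr
    rw [List.map_cons, isReduced_cons, ← C.coe_sub_wordProd φ hφ hM]
    exact ⟨ih hr.1, hr.2⟩

theorem map_piBar (w : C.para (Set.range φ)) :
    HeckeZero.map φ hM ((C.sub φ hφ hM).piBar F w) = C.piBar F (w : W) := by
  have h := C.prod_genBar (F := F) (C.sub_isReduced φ hφ hM ((C.sub φ hφ hM).isReduced_redWord w))
  rw [← C.coe_sub_wordProd φ hφ hM, wordProd_redWord] at h
  rw [← h, piBar, map_list_prod, List.map_map, List.map_map]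
  congr 2
  ext1 s
  exact map_genBar φ hM s

end Sub

/-- The descents of `u * y` in `J` are those of `y`, so appending a reduced word of `y` raises the
length at each letter. -/
theorem IsMin.piBar_mul {J : Set B} {u y : W} (hu : C.IsMin J u) (hy : y ∈ C.para J) :
    C.piBar F u * C.piBar F y = C.piBar F (u * y) := by
  induction hn : C.len y using Nat.strong_induction_on generalizing y with
  | _ n ih =>
  by_cases h : ∀ s ∈ J, ¬ C.desc s y
  · simp [C.eq_one_of_forall_not_desc hy h]
  · push Not at h
    obtain ⟨s, hs, h⟩ := h
    have hy' := mul_mem hy (C.gs_mem_para hs)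
    rw [C.piBar_eq_of_desc h, ← mul_assoc, ih _ (by rw [← hn]; exact C.len_mul_gs_lt h) hy' rfl,
      C.piBar_mul_genBar_of_not_desc]
    · rw [← mul_assoc, mul_gs_mul_gs]
    · rwa [hu.desc_mul_iff C hy' hs, C.desc_mul_gs, not_not]

theorem isMin_of_mem_para {I J : Set B} (h : Disjoint I J) {u : W} (hu : u ∈ C.para I) :
    C.IsMin J u :=
  fun _ hs hd => Set.disjoint_left.1 h (C.mem_of_desc hu hd) hs

/-! ### Induction from parabolic subalgebras -/

section Ind

variable {A : Type*} [Ring A] [Algebra F A] (ψ : A →ₐ[F] HeckeZero F M) {J : Set B}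
  {ι : Type*} (a : Module.Basis ι F A) (y : ι → W)

/-- The elements `π̄_u`, for minimal `u`, are independent over `A` acting from the right: the
products `π̄_u ψ(a_i)` are the standard basis elements `π̄_{u y_i}`, and these are distinct. -/
theorem repr_piBar_mul_map (hyJ : ∀ i, y i ∈ C.para J) (hy : Function.Injective y)
    (ha : ∀ i, ψ (a i) = C.piBar F (y i)) {u u' : W} (hu : C.IsMin J u) (hu' : C.IsMin J u')
    (x : A) (i : ι) [Decidable (u' = u)] :
    (C.basis F).repr (C.piBar F u' * ψ x) (u * y i) = if u' = u then a.repr x i else 0 := by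
  classical
  have : (Finsupp.lapply (u * y i)).comp ((C.basis F).repr.toLinearMap.comp
      ((LinearMap.mulLeft F (C.piBar F u')).comp ψ.toLinearMap)) =
      if u' = u then (Finsupp.lapply i).comp a.repr.toLinearMap else 0 := by
    refine a.ext fun j => ?_
    simp only [LinearMap.comp_apply, AlgHom.toLinearMap_apply, LinearMap.mulLeft_apply,
      LinearEquiv.coe_coe, ha, Finsupp.lapply_apply]
    rw [hu'.piBar_mul C (hyJ j), ← basis_apply, Module.Basis.repr_self, Finsupp.single_apply]
    by_cases h : u' = u
    · subst h
      simp [Finsupp.single_apply, hy.eq_iff]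
    · rw [if_neg h, if_neg (fun e => h (hu'.mul_inj C hu (hyJ j) (hyJ i) e).1)]
      rfl
  have := LinearMap.congr_fun this x
  split_ifs at this ⊢ <;> exact this

theorem injective_of_basis (hyJ : ∀ i, y i ∈ C.para J) (hy : Function.Injective y)
    (ha : ∀ i, ψ (a i) = C.piBar F (y i)) : Function.Injective ψ := by
  classical
  rw [injective_iff_map_eq_zero]
  intro x hx
  have h1 : C.IsMin J 1 := fun s _ => C.not_desc_one s
  refine a.repr.map_eq_zero_iff.1 (Finsupp.ext fun i => ?_)
  have := C.repr_piBar_mul_map ψ a y hyJ hy ha h1 h1 x i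
  rw [hx, if_pos rfl] at this
  simpa using this.symm

variable {N : Type*} [AddCommGroup N] [Module F N]

/-- The `H`-linear map `H ⊗ N → H`, `h ⊗ v ↦ h ψ(Θ v)`. -/
noncomputable def indMap (Θ : N →ₗ[F] A) : HeckeZero F M ⊗[F] N →ₗ[HeckeZero F M] HeckeZero F M :=
  TensorProduct.AlgebraTensorModule.lift
    (LinearMap.toSpanSingleton (HeckeZero F M) (N →ₗ[F] HeckeZero F M) (ψ.toLinearMap.comp Θ))

theorem indMap_tmul (Θ : N →ₗ[F] A) (h : HeckeZero F M) (v : N) :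
    indMap ψ Θ (h ⊗ₜ v) = h * ψ (Θ v) := by
  simp [indMap]

theorem range_indMap (Θ : N →ₗ[F] A) {ε : A} (h1 : ∀ v, ∃ b, Θ v = b * ε) (h2 : ∃ v, Θ v = ε) :
    LinearMap.range (indMap ψ Θ) = Submodule.span (HeckeZero F M) {ψ ε} := by
  apply le_antisymm
  · rintro _ ⟨t, rfl⟩
    induction t using TensorProduct.induction_on with
    | zero => simp
    | add t t' ht ht' => rw [map_add]; exact Submodule.add_mem _ ht ht'
    | tmul h v =>
      obtain ⟨b, hb⟩ := h1 v
      rw [indMap_tmul, hb, map_mul, ← mul_assoc]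
      exact Submodule.mem_span_singleton.2 ⟨_, rfl⟩
  · rw [Submodule.span_singleton_le_iff_mem]
    obtain ⟨v, hv⟩ := h2
    exact ⟨1 ⊗ₜ v, by rw [indMap_tmul, hv, one_mul]⟩

variable (N) [Module A N]

/-- The relations defining the induced module. -/
def indRel : Submodule (HeckeZero F M) (HeckeZero F M ⊗[F] N) :=
  Submodule.span (HeckeZero F M)
    {x | ∃ (h : HeckeZero F M) (b : A) (v : N), x = (h * ψ b) ⊗ₜ[F] v - h ⊗ₜ[F] (b • v)}

open Classical in
-- If `w` has a descent `s ∈ J`, then `π̄_w = π̄_{ws} π̄_s` and the last factor moves across the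
-- tensor sign. The length drops, so only minimal representatives remain in the end.
theorem exists_sub_mem_indRel (hJ : ∀ s ∈ J, ∃ b, ψ b = genBar F s)
    (t : HeckeZero F M ⊗[F] N) : ∃ c : {u // C.IsMin J u} →₀ N,
      t - c.sum (fun u n => C.piBar F (u : W) ⊗ₜ[F] n) ∈ indRel ψ N := by
  have hadd : ∀ c c' : {u // C.IsMin J u} →₀ N,
      (c + c').sum (fun u n => C.piBar F (u : W) ⊗ₜ[F] n) =
        c.sum (fun u n => C.piBar F (u : W) ⊗ₜ[F] n) +
          c'.sum (fun u n => C.piBar F (u : W) ⊗ₜ[F] n) :=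
    fun c c' => Finsupp.sum_add_index' (fun _ => by simp) (fun _ _ _ => by rw [TensorProduct.tmul_add])
  have hbase : ∀ (w : W) (n : N), ∃ c : {u // C.IsMin J u} →₀ N,
      C.piBar F w ⊗ₜ[F] n - c.sum (fun u n => C.piBar F (u : W) ⊗ₜ[F] n) ∈ indRel ψ N := by
    intro w n
    induction hk : C.len w using Nat.strong_induction_on generalizing w n with
    | _ k ih =>
    by_cases h : C.IsMin J w
    · exact ⟨Finsupp.single ⟨w, h⟩ n, by simp⟩
    · simp only [IsMin, not_forall, not_not] at h
      obtain ⟨s, hs, h⟩ := h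
      obtain ⟨b, hb⟩ := hJ s hs
      obtain ⟨c, hc⟩ := ih _ (by rw [← hk]; exact C.len_mul_gs_lt h) (w * C.gs s) (b • n) rfl
      refine ⟨c, ?_⟩
      have h1 : (C.piBar F (w * C.gs s) * ψ b) ⊗ₜ[F] n - C.piBar F (w * C.gs s) ⊗ₜ[F] (b • n) ∈
          indRel ψ N := Submodule.subset_span ⟨_, _, _, rfl⟩
      rw [hb, ← C.piBar_eq_of_desc h] at h1
      simpa using Submodule.add_mem _ h1 hc
  induction t using TensorProduct.induction_on with
  | zero => exact ⟨0, by simp⟩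
  | add t t' ht ht' =>
    obtain ⟨c, hc⟩ := ht
    obtain ⟨c', hc'⟩ := ht'
    refine ⟨c + c', ?_⟩
    rw [hadd, add_sub_add_comm]
    exact Submodule.add_mem _ hc hc'
  | tmul h n =>
    have hh : h ∈ Submodule.span F (Set.range (C.piBar F)) := by rw [C.span_piBar]; trivial
    induction hh using Submodule.span_induction generalizing n with
    | mem h hh =>
      obtain ⟨w, rfl⟩ := hh
      exact hbase w n
    | zero => exact ⟨0, by simp⟩
    | add h h' _ _ ht ht' =>
      obtain ⟨c, hc⟩ := ht n
      obtain ⟨c', hc'⟩ := ht' n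
      refine ⟨c + c', ?_⟩
      rw [hadd, TensorProduct.add_tmul, add_sub_add_comm]
      exact Submodule.add_mem _ hc hc'
    | smul r h _ ht =>
      obtain ⟨c, hc⟩ := ht (r • n)
      exact ⟨c, by rwa [TensorProduct.smul_tmul]⟩

variable {N}

/-- Modulo the relations a kernel element is a sum of terms `π̄_u ⊗ n_u` with `u` minimal. The
coefficient of `π̄_{u y_i}` in its image is the `i`-th coordinate of `Θ n_u`, so each `n_u`
vanishes. -/
theorem indRel_eq_ker (hyJ : ∀ i, y i ∈ C.para J) (hy : Function.Injective y)
    (ha : ∀ i, ψ (a i) = C.piBar F (y i)) (hJ : ∀ s ∈ J, ∃ b, ψ b = genBar F s)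
    (Θ : N →ₗ[F] A) (hΘ : Function.Injective Θ) (hΘA : ∀ (b : A) (v : N), Θ (b • v) = b * Θ v) :
    indRel ψ N = LinearMap.ker (indMap ψ Θ) := by
  classical
  have hle : indRel ψ N ≤ LinearMap.ker (indMap ψ Θ) := by
    refine Submodule.span_le.2 ?_
    rintro _ ⟨h, b, v, rfl⟩
    simp [indMap_tmul, hΘA, mul_assoc]
  refine le_antisymm hle fun t ht => ?_
  obtain ⟨c, hc⟩ := C.exists_sub_mem_indRel ψ N hJ t
  have h1 : indMap ψ Θ (c.sum fun u n => C.piBar F (u : W) ⊗ₜ[F] n) = 0 := by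
    have := hle hc
    rw [LinearMap.mem_ker, map_sub, LinearMap.mem_ker.1 ht, zero_sub, neg_eq_zero] at this
    exact this
  have h2 : c = 0 := by
    refine Finsupp.ext fun u => hΘ ?_
    rw [Finsupp.zero_apply, map_zero]
    refine a.repr.map_eq_zero_iff.1 (Finsupp.ext fun i => ?_)
    have h3 := congrArg (fun z => (C.basis F).repr z ((u : W) * y i)) h1
    simp only [Finsupp.sum, map_sum, indMap_tmul, Finsupp.finsetSum_apply, map_zero,
      Finsupp.zero_apply] at h3
    rw [Finset.sum_congr rfl fun u' _ =>
      C.repr_piBar_mul_map ψ a y hyJ hy ha u.2 u'.2 (Θ (c u')) i] at h3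
    rw [Finsupp.zero_apply, ← h3]
    simp only [Subtype.coe_inj]
    rw [Finset.sum_ite_eq']
    split_ifs with hs
    · rfl
    · rw [Finsupp.notMem_support_iff.1 hs]
      simp
  rw [h2, Finsupp.sum_zero_index, sub_zero] at hc
  exact hc

/-- The induced module of a left ideal of a parabolic subalgebra is the left ideal generated by
the same element. -/
theorem nonempty_equiv_induced (hyJ : ∀ i, y i ∈ C.para J) (hy : Function.Injective y)
    (ha : ∀ i, ψ (a i) = C.piBar F (y i)) (hJ : ∀ s ∈ J, ∃ b, ψ b = genBar F s)
    (Θ : N →ₗ[F] A) (hΘ : Function.Injective Θ) (hΘA : ∀ (b : A) (v : N), Θ (b • v) = b * Θ v)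
    {ε : A} (h1 : ∀ v, ∃ b, Θ v = b * ε) (h2 : ∃ v, Θ v = ε) :
    Nonempty (Submodule.span (HeckeZero F M) {ψ ε} ≃ₗ[HeckeZero F M] Induced ψ N) := by
  have hk := C.indRel_eq_ker ψ a y hyJ hy ha hJ Θ hΘ hΘA
  exact ⟨(LinearEquiv.ofEq _ _ (range_indMap ψ Θ h1 h2)).symm.trans
    ((indMap ψ Θ).quotKerEquivRange.symm.trans
      (Submodule.quotEquivOfEq _ _ hk.symm))⟩

end Ind

end DescentSystem

/-! ### Reflections -/

/-- The signed transposition exchanging `p` with `q` and `-p` with `-q`. -/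
def reflD (p q : ℤ) : Equiv.Perm ℤ := Equiv.swap p q * Equiv.swap (-p) (-q)

theorem reflD_comm (p q : ℤ) : reflD q p = reflD p q := by
  rw [reflD, reflD, Equiv.swap_comm p q, Equiv.swap_comm (-p) (-q)]

theorem reflD_neg_neg {p q : ℤ} (hp : p ≠ 0) (hq : q ≠ 0) :
    reflD (-p) (-q) = reflD p q := by
  ext x
  simp only [reflD, Equiv.Perm.mul_apply, Equiv.swap_apply_def]
  split_ifs <;> omega

/-- Commutation, braid relations and folding all reduce through this formula to the images of two
points. -/
theorem mul_reflD {w : Equiv.Perm ℤ} (hw : ∀ x, w (-x) = -w x) (p q : ℤ) :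
    w * reflD p q = reflD (w p) (w q) * w := by
  rw [reflD, reflD, ← mul_assoc, Equiv.mul_swap_eq_swap_mul w p q, mul_assoc,
    Equiv.mul_swap_eq_swap_mul w (-p) (-q), hw, hw, mul_assoc]

/-- The generator `s_i` exchanges `lowD i` and `i + 1`. -/
def lowD (i : ℕ) : ℤ := if i = 0 then -2 else i

/-- Taking `lowD 0 = -2` gives `s₀` the same form as the other generators, and turns the convention
`w(0) = -w(2)` into evaluation at `lowD 0`. -/
theorem sD_eq (i : ℕ) : sD i = reflD (lowD i) (i + 1) := by
  unfold sD reflD lowD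
  split_ifs with h
  · subst h
    simp [Equiv.swap_comm]
  · rfl

theorem sD_apply (i : ℕ) (x : ℤ) : sD i x = if x = lowD i then (i + 1 : ℤ)
    else if x = i + 1 then lowD i else if x = -lowD i then (-(i + 1) : ℤ)
    else if x = -(i + 1) then -lowD i else x := by
  rw [sD_eq]
  have : lowD i = -2 ∧ i = 0 ∨ lowD i = i ∧ i ≠ 0 := by
    unfold lowD
    split_ifs <;> simp_all
  simp only [reflD, Equiv.Perm.mul_apply, Equiv.swap_apply_def]
  split_ifs <;> omega

theorem lowD_eq (i : ℕ) : lowD i = -2 ∧ i = 0 ∨ lowD i = i ∧ i ≠ 0 := by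
  unfold lowD
  split_ifs <;> simp_all

theorem sD_neg (i : ℕ) (x : ℤ) : sD i (-x) = -sD i x := by
  have := lowD_eq i
  simp only [sD_apply]
  split_ifs <;> omega

theorem sD_mul_self (i : ℕ) : sD i * sD i = 1 := by
  ext x
  have := lowD_eq i
  simp only [Equiv.Perm.mul_apply, sD_apply, Equiv.Perm.one_apply]
  split_ifs <;> omega

theorem sD_injective {i j : ℕ} (h : sD i = sD j) : i = j := by
  have h1 := congrArg (fun w : Equiv.Perm ℤ => w (j + 1)) h
  have h2 := lowD_eq i
  have h3 := lowD_eq j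
  simp only [sD_apply] at h1
  split_ifs at h1 <;> omega

theorem coxD_eq (n : ℕ) (s t : Fin n) : coxD n s t =
    if s = t then 1
    else if ((s : ℕ) = 0 ∧ (t : ℕ) = 2) ∨ ((t : ℕ) = 0 ∧ (s : ℕ) = 2) ∨
      ((s : ℕ) ≠ 0 ∧ (s : ℕ) + 1 = t) ∨ ((t : ℕ) ≠ 0 ∧ (t : ℕ) + 1 = s) then 3
    else 2 := rfl

theorem adj_of_coxD_eq_three {n : ℕ} {s t : Fin n} (h : coxD n s t = 3) :
    ((s : ℕ) = 0 ∧ (t : ℕ) = 2) ∨ ((t : ℕ) = 0 ∧ (s : ℕ) = 2) ∨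
      ((s : ℕ) ≠ 0 ∧ (s : ℕ) + 1 = t) ∨ ((t : ℕ) ≠ 0 ∧ (t : ℕ) + 1 = s) := by
  by_contra hn
  rw [coxD_eq, if_neg hn] at h
  split_ifs at h <;> omega

theorem not_adj_of_coxD_eq_two {n : ℕ} {s t : Fin n} (h : coxD n s t = 2) :
    ¬(((s : ℕ) = 0 ∧ (t : ℕ) = 2) ∨ ((t : ℕ) = 0 ∧ (s : ℕ) = 2) ∨
      ((s : ℕ) ≠ 0 ∧ (s : ℕ) + 1 = t) ∨ ((t : ℕ) ≠ 0 ∧ (t : ℕ) + 1 = s)) := by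
  intro hn
  rw [coxD_eq, if_pos hn] at h
  split_ifs at h <;> omega

theorem sD_comm {i j : ℕ} (h1 : ¬(i = 0 ∧ j = 2)) (h2 : ¬(j = 0 ∧ i = 2))
    (h3 : ¬(i ≠ 0 ∧ i + 1 = j)) (h4 : ¬(j ≠ 0 ∧ j + 1 = i)) : sD i * sD j = sD j * sD i := by
  by_cases hij : i = j
  · rw [hij]
  conv_lhs => rw [sD_eq j, mul_reflD (sD_neg i)]
  congr 1
  have hi := lowD_eq i
  have hj := lowD_eq j
  -- The second alternative is needed for `{i, j} = {0, 1}`, where `s_i` sends the pair of `s_j` to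
  -- its negative in exchanged order.
  have h5 : sD i (lowD j) = lowD j ∧ sD i (j + 1) = j + 1 ∨
      sD i (lowD j) = -(j + 1) ∧ sD i (j + 1) = -lowD j := by
    simp only [sD_apply]
    split_ifs <;> omega
  rcases h5 with ⟨e1, e2⟩ | ⟨e1, e2⟩
  · rw [e1, e2, sD_eq]
  · rw [e1, e2, sD_eq, reflD_neg_neg, reflD_comm] <;> omega

/-- Each side is a conjugate of one generator by the other, hence a signed transposition, and the
two image pairs define the same one. -/
theorem sD_braid_of_adj {i j : ℕ} (h : i = 0 ∧ j = 2 ∨ i ≠ 0 ∧ i + 1 = j) :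
    sD i * sD j * sD i = sD j * sD i * sD j := by
  conv_lhs => rw [sD_eq j, mul_reflD (sD_neg i), mul_assoc, sD_mul_self, mul_one]
  conv_rhs => rw [sD_eq i, mul_reflD (sD_neg j), mul_assoc, sD_mul_self, mul_one]
  rcases h with ⟨rfl, rfl⟩ | ⟨hi, rfl⟩
  · have e1 : sD 0 (lowD 2) = -1 ∧ sD 0 ((2 : ℕ) + 1) = 3 := by simp [sD_apply, lowD]
    have e2 : sD 2 (lowD 0) = -3 ∧ sD 2 ((0 : ℕ) + 1) = 1 := by simp [sD_apply, lowD]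
    rw [e1.1, e1.2, e2.1, e2.2, ← reflD_neg_neg (by simp) (by simp), neg_neg, reflD_comm]
  · have e1 : sD i (lowD (i + 1)) = i ∧ sD i ((i + 1 : ℕ) + 1) = i + 2 := by
      simp only [sD_apply, lowD, if_neg hi, if_neg i.succ_ne_zero]
      split_ifs <;> omega
    have e2 : sD (i + 1) (lowD i) = i ∧ sD (i + 1) (i + 1) = i + 2 := by
      simp only [sD_apply, lowD, if_neg hi, if_neg i.succ_ne_zero]
      split_ifs <;> omega
    rw [e1.1, e1.2, e2.1, e2.2]

theorem sD_not_comm_of_adj {i j : ℕ} (h : i = 0 ∧ j = 2 ∨ i ≠ 0 ∧ i + 1 = j) :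
    sD i * sD j ≠ sD j * sD i := by
  intro e
  rcases h with ⟨rfl, rfl⟩ | ⟨hi, rfl⟩
  · have h1 := congrArg (fun w : Equiv.Perm ℤ => w 1) e
    simp [sD_apply, lowD] at h1
  · have h1 := congrArg (fun w : Equiv.Perm ℤ => w i) e
    have e1 : sD (i + 1) i = i ∧ sD (i + 1) (i + 1) = i + 2 := by
      simp only [sD_apply, lowD, if_neg i.succ_ne_zero]
      split_ifs <;> omega
    have e2 : sD i i = i + 1 := by simp [sD_apply, lowD, hi]
    simp only [Equiv.Perm.mul_apply, e1, e2] at h1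
    omega

/-- The group generated by the Coxeter generators of type `D_n`. -/
abbrev groupD (n : ℕ) : Subgroup (Equiv.Perm ℤ) :=
  Subgroup.closure (Set.range fun i : Fin n => sD i)

theorem apply_neg_of_mem_groupD {n : ℕ} {w : Equiv.Perm ℤ} (hw : w ∈ groupD n) (x : ℤ) :
    w (-x) = -w x := by
  induction hw using Subgroup.closure_induction generalizing x with
  | mem w hw => obtain ⟨i, rfl⟩ := hw; exact sD_neg _ _
  | one => rfl
  | mul v w _ _ hv hw => rw [Equiv.Perm.mul_apply, hw, hv, Equiv.Perm.mul_apply]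
  | inv w _ hw =>
    rw [Equiv.Perm.inv_eq_iff_eq, hw]
    exact congrArg _ (w.apply_symm_apply x).symm

theorem closure_range_coe {G B : Type*} [Group G] (f : B → G) :
    Subgroup.closure (Set.range fun s =>
      (⟨f s, Subgroup.subset_closure ⟨s, rfl⟩⟩ : Subgroup.closure (Set.range f))) = ⊤ := by
  refine Eq.trans ?_ (Subgroup.closure_closure_coe_preimage (k := Set.range f))
  congr 1
  ext x
  constructor
  · rintro ⟨s, rfl⟩
    exact ⟨s, rfl⟩
  · rintro ⟨s, h⟩
    exact ⟨s, Subtype.ext h⟩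

/-- The folding condition for type D. Among nonzero `a < b` with `a ≠ -b`, the generator `s_j`
reverses only the pair that it exchanges and the negative of that pair; so `s_i` is conjugate to
`s_j` under `w`. -/
theorem sD_mul_eq_mul_sD {w : Equiv.Perm ℤ} (hw : ∀ x, w (-x) = -w x) {i j : ℕ}
    (h1 : w (lowD i) < w (i + 1)) (h2 : sD j (w (i + 1)) < sD j (w (lowD i))) :
    sD j * w = w * sD i := by
  have hi := lowD_eq i
  have hj := lowD_eq j
  have h0 : w 0 = 0 := by
    have := hw 0
    rw [neg_zero] at this
    omega
  -- For `j = 0` the pairs `0, 1` and `-1, 1` would be reversed as well. These degenerate cases are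
  -- excluded by oddness and injectivity of `w`.
  have n1 : w (lowD i) ≠ 0 := fun e => by
    have := w.injective (e.trans h0.symm)
    omega
  have n2 : w (i + 1) ≠ 0 := fun e => by
    have := w.injective (e.trans h0.symm)
    omega
  have n3 : w (lowD i) ≠ -w (i + 1) := fun e => by
    rw [← hw] at e
    have := w.injective e
    omega
  rw [sD_eq i, mul_reflD hw, sD_eq j]
  congr 1
  generalize w (lowD i) = a at *
  generalize w (i + 1) = b at *
  have h5 : a = lowD j ∧ b = j + 1 ∨ a = -(j + 1) ∧ b = -lowD j := by
    simp only [sD_apply] at h2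
    split_ifs at h2 <;> omega
  rcases h5 with ⟨rfl, rfl⟩ | ⟨rfl, rfl⟩
  · rfl
  · rw [reflD_neg_neg, reflD_comm] <;> omega

/-- The Coxeter system of type `D_n`. -/
def systemD (n : ℕ) : DescentSystem (coxD n) (groupD n) where
  gs i := ⟨sD i, Subgroup.subset_closure ⟨i, rfl⟩⟩
  desc i w := w.1 (i + 1) < w.1 (lowD i)
  gs_mul_self i := Subtype.ext (sD_mul_self i)
  gs_injective i j h := Fin.ext (sD_injective (congrArg Subtype.val h))
  closure_eq_top := closure_range_coe _
  not_desc_one i := by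
    have := lowD_eq i
    simp only [Subgroup.coe_one, Equiv.Perm.one_apply]
    omega
  desc_mul_gs i w := by
    have := lowD_eq i
    have h : w.1 (i + 1) ≠ w.1 (lowD i) := w.1.injective.ne (by omega)
    have h1 : sD i (i + 1) = lowD i := by
      rw [sD_apply, if_neg (by omega), if_pos rfl]
    have h2 : sD i (lowD i) = i + 1 := by simp [sD_apply]
    simp only [Subgroup.coe_mul, Equiv.Perm.mul_apply, h1, h2]
    omega
  fold i j w h1 h2 := by
    have := lowD_eq i
    have h : w.1 (i + 1) ≠ w.1 (lowD i) := w.1.injective.ne (by omega)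
    exact Subtype.ext (sD_mul_eq_mul_sD (apply_neg_of_mem_groupD w.2)
      (lt_of_le_of_ne (not_lt.1 h1) h.symm) h2)
  laced i j h := by
    rw [coxD_eq, if_neg h]
    split_ifs <;> simp
  gs_comm i j h := by
    have := not_adj_of_coxD_eq_two h
    exact Subtype.ext (sD_comm (by omega) (by omega) (by omega) (by omega))
  gs_braid i j h := by
    refine Subtype.ext ?_
    rcases adj_of_coxD_eq_three h with h2 | h2 | h2 | h2
    · exact sD_braid_of_adj (Or.inl h2)
    · exact (sD_braid_of_adj (Or.inl h2)).symm
    · exact sD_braid_of_adj (Or.inr h2)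
    · exact (sD_braid_of_adj (Or.inr h2)).symm
  gs_not_comm i j h e := by
    have e := congrArg Subtype.val e
    rcases adj_of_coxD_eq_three h with h2 | h2 | h2 | h2
    · exact sD_not_comm_of_adj (Or.inl h2) e
    · exact sD_not_comm_of_adj (Or.inl h2) e.symm
    · exact sD_not_comm_of_adj (Or.inr h2) e
    · exact sD_not_comm_of_adj (Or.inr h2) e.symm

/-! ### Type A -/

theorem sA_apply (i : ℕ) (x : ℤ) : sA i x = if x = i then (i + 1 : ℤ)
    else if x = i + 1 then (i : ℤ) else x := by
  rw [sA, Equiv.swap_apply_def]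

theorem A_eq (n : ℕ) (s t : Fin n) : CoxeterMatrix.A n s t =
    if s = t then 1 else if (t : ℕ) + 1 = s ∨ (s : ℕ) + 1 = t then 3 else 2 := rfl

theorem adj_of_A_eq_three {n : ℕ} {s t : Fin n} (h : CoxeterMatrix.A n s t = 3) :
    (t : ℕ) + 1 = s ∨ (s : ℕ) + 1 = t := by
  by_contra hn
  rw [A_eq, if_neg hn] at h
  split_ifs at h <;> omega

theorem not_adj_of_A_eq_two {n : ℕ} {s t : Fin n} (h : CoxeterMatrix.A n s t = 2) :
    ¬((t : ℕ) + 1 = s ∨ (s : ℕ) + 1 = t) := by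
  intro hn
  rw [A_eq, if_pos hn] at h
  split_ifs at h <;> omega

/-- The group generated by the Coxeter generators of type `A_{m-1}`. -/
abbrev groupA (m : ℕ) : Subgroup (Equiv.Perm ℤ) :=
  Subgroup.closure (Set.range fun i : Fin (m - 1) => sA (i + 1))

theorem sA_comm {i j : ℕ} (h1 : i + 1 ≠ j) (h2 : j + 1 ≠ i) : sA i * sA j = sA j * sA i := by
  ext x
  simp only [Equiv.Perm.mul_apply, sA_apply]
  split_ifs <;> omega

theorem sA_braid (i : ℕ) : sA i * sA (i + 1) * sA i = sA (i + 1) * sA i * sA (i + 1) := by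
  have e1 : sA i * sA (i + 1) = Equiv.swap (i : ℤ) (i + 2) * sA i := by
    conv_lhs => rw [sA.eq_1 (i + 1), Equiv.mul_swap_eq_swap_mul]
    congr 2 <;> rw [sA_apply] <;> split_ifs <;> omega
  have e2 : sA (i + 1) * sA i = Equiv.swap (i : ℤ) (i + 2) * sA (i + 1) := by
    conv_lhs => rw [sA.eq_1 i, Equiv.mul_swap_eq_swap_mul]
    congr 2 <;> rw [sA_apply] <;> split_ifs <;> omega
  rw [e1, e2, mul_assoc, mul_assoc, sA, sA, Equiv.swap_mul_self, Equiv.swap_mul_self]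

theorem sA_not_comm (i : ℕ) : sA i * sA (i + 1) ≠ sA (i + 1) * sA i := by
  intro e
  have h1 := congrArg (fun w : Equiv.Perm ℤ => w i) e
  simp only [Equiv.Perm.mul_apply, sA_apply] at h1
  split_ifs at h1 <;> omega

theorem sA_mul_eq_mul_sA {w : Equiv.Perm ℤ} {i j : ℕ}
    (h1 : w i < w (i + 1)) (h2 : sA j (w (i + 1)) < sA j (w i)) : sA j * w = w * sA i := by
  have h3 : w i = j ∧ w (i + 1) = j + 1 := by
    simp only [sA_apply] at h2
    split_ifs at h2 <;> omega
  rw [sA, sA, Equiv.mul_swap_eq_swap_mul, h3.1, h3.2]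

/-- The Coxeter system of type `A_{m-1}`. -/
def systemA (m : ℕ) : DescentSystem (CoxeterMatrix.A (m - 1)) (groupA m) where
  gs i := ⟨sA (i + 1), Subgroup.subset_closure ⟨i, rfl⟩⟩
  desc i w := w.1 ((i + 1 : ℕ) + 1) < w.1 (i + 1 : ℕ)
  gs_mul_self i := Subtype.ext (Equiv.swap_mul_self _ _)
  gs_injective i j h := by
    have h1 := congrArg (fun w : groupA m => w.1 (j + 1 : ℕ)) h
    simp only [sA_apply] at h1
    ext
    split_ifs at h1 <;> omega
  closure_eq_top := closure_range_coe _
  not_desc_one i := by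
    simp only [Subgroup.coe_one, Equiv.Perm.one_apply]
    omega
  desc_mul_gs i w := by
    have h : w.1 ((i + 1 : ℕ) + 1) ≠ w.1 (i + 1 : ℕ) := w.1.injective.ne (by omega)
    have h1 : sA (i + 1) ((i + 1 : ℕ) + 1) = (i + 1 : ℕ) := by simp [sA_apply]
    have h2 : sA (i + 1) (i + 1 : ℕ) = (i + 1 : ℕ) + 1 := by simp [sA_apply]
    simp only [Subgroup.coe_mul, Equiv.Perm.mul_apply, h1, h2]
    omega
  fold i j w h1 h2 := by
    have h : w.1 ((i + 1 : ℕ) + 1) ≠ w.1 (i + 1 : ℕ) := w.1.injective.ne (by omega)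
    exact Subtype.ext (sA_mul_eq_mul_sA (lt_of_le_of_ne (not_lt.1 h1) h.symm) h2)
  laced i j h := by
    rw [A_eq, if_neg h]
    split_ifs <;> simp
  gs_comm i j h := by
    have := not_adj_of_A_eq_two h
    exact Subtype.ext (sA_comm (by omega) (by omega))
  gs_braid i j h := by
    refine Subtype.ext ?_
    rcases adj_of_A_eq_three h with h2 | h2 <;> simp only [← h2, Subgroup.coe_mul]
    · exact (sA_braid _).symm
    · exact sA_braid _
  gs_not_comm i j h e := by
    have e := congrArg Subtype.val e
    simp only [Subgroup.coe_mul] at e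
    rcases adj_of_A_eq_three h with h2 | h2 <;> rw [← h2] at e
    · exact sA_not_comm _ e.symm
    · exact sA_not_comm _ e

/-! ### The groups of types D and A -/

theorem sum_sub_sum_of_eq_off_pair {s : Finset ℕ} {f g : ℕ → ℤ} {p q : ℕ} (hp : p ∈ s)
    (hq : q ∈ s) (hpq : p ≠ q) (h : ∀ j ∈ s, j ≠ p → j ≠ q → f j = g j) :
    ∑ j ∈ s, f j - ∑ j ∈ s, g j = f p + f q - g p - g q := by
  rw [← Finset.sum_sub_distrib, ← Finset.sum_subset (s₁ := {p, q}), Finset.sum_pair hpq]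
  · ring
  · intro j hj
    rcases Finset.mem_insert.1 hj with rfl | hj
    · exact hp
    · rw [Finset.mem_singleton.1 hj]; exact hq
  · intro j hj hj'
    simp only [Finset.mem_insert, Finset.mem_singleton, not_or] at hj'
    rw [h j hj hj'.1 hj'.2, sub_self]

theorem eq_self_of_increasing {m : ℕ} {f : ℕ → ℤ} (h1 : ∀ j ∈ Finset.Icc 1 m, 0 < f j)
    (h2 : ∀ j ∈ Finset.Icc 1 m, f j ≤ m) (h : ∀ j, 1 ≤ j → j < m → f j < f (j + 1)) :
    ∀ j ∈ Finset.Icc 1 m, f j = j := by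
  simp only [Finset.mem_Icc] at h1 h2 ⊢
  have hlow : ∀ j, 1 ≤ j → j ≤ m → (j : ℤ) ≤ f j := by
    intro j hj
    induction j, hj using Nat.le_induction with
    | base => intro hm; exact h1 1 ⟨le_rfl, hm⟩
    | succ j hj ih =>
      intro hm
      have := ih (by omega)
      have := h j hj (by omega)
      push_cast
      omega
  have hup : ∀ k j, j + k = m → 1 ≤ j → f j ≤ j := by
    intro k
    induction k with
    | zero => intro j hj hj'; have := h2 j ⟨hj', by omega⟩; omega
    | succ k ih =>
      intro j hj hj'
      have := ih (j + 1) (by omega) (by omega)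
      have := h j hj' (by omega)
      push_cast at *
      omega
  intro j hj
  exact le_antisymm (hup (m - j) j (by omega) hj.1) (hlow j hj.1 hj.2)

section TypeD

variable {n : ℕ} {w : Equiv.Perm ℤ}

/-- The bound on `n` is essential because `s₀` moves `2`. -/
theorem sD_apply_of_lt {i : ℕ} (hn : 2 ≤ n) (hi : i < n) {x : ℤ} (hx : (n : ℤ) < |x|) :
    sD i x = x := by
  have := lowD_eq i
  rw [lt_abs] at hx
  rw [sD_apply]
  split_ifs <;> omega

theorem apply_zero_of_odd (h : ∀ x, w (-x) = -w x) : w 0 = 0 := by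
  have := h 0
  rw [neg_zero] at this
  omega

/-- Used for two functions: the indicator of negative values, which controls the parity, and `j * (n
- x)`, which gives a potential decreasing at descents. -/
theorem mul_sD_sub_eq {f : ℕ → ℤ → ℤ} (hw : ∀ x, w (-x) = -w x) (hn : 2 ≤ n) {i : ℕ}
    (hi : i < n) :
    ∑ j ∈ Finset.Icc 1 n, f j ((w * sD i) j) - ∑ j ∈ Finset.Icc 1 n, f j (w j) =
      if i = 0 then f 1 (-w 2) + f 2 (-w 1) - f 1 (w 1) - f 2 (w 2)
      else f i (w (i + 1)) + f (i + 1) (w i) - f i (w i) - f (i + 1) (w (i + 1)) := by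
  split_ifs with h
  · subst h
    rw [sum_sub_sum_of_eq_off_pair (p := 1) (q := 2)]
    · simp [sD_apply, lowD, hw]
    · simp; omega
    · simp; omega
    · simp
    · intro j hj h1 h2
      rw [Finset.mem_Icc] at hj
      have : sD 0 j = j := by
        rw [sD_apply]
        simp only [lowD, if_true]
        split_ifs <;> first | omega | contradiction
      rw [Equiv.Perm.mul_apply, this]
  · rw [sum_sub_sum_of_eq_off_pair (p := i) (q := i + 1)]
    · simp [sD_apply, lowD, h]
    · simp; omega
    · simp; omega
    · simp
    · intro j hj h1 h2
      rw [Finset.mem_Icc] at hj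
      rw [Equiv.Perm.mul_apply, sD_apply]
      simp only [lowD, if_neg h]
      congr 2
      split_ifs <;> omega

theorem even_card_iff : Even ((Finset.Icc 1 n).filter fun j : ℕ => w j < 0).card ↔
    Even (∑ j ∈ Finset.Icc 1 n, if w (j : ℕ) < 0 then (1 : ℤ) else 0) := by
  rw [Finset.sum_boole]
  simp

theorem mul_sD_mem_typeDGroup (hn : 2 ≤ n) {i : ℕ} (hi : i < n) (hw : w ∈ typeDGroup n) :
    w * sD i ∈ typeDGroup n := by
  obtain ⟨h1, h2, h3⟩ := hw
  refine ⟨fun x => ?_, fun x hx => ?_, ?_⟩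
  · rw [Equiv.Perm.mul_apply, sD_neg, h1, Equiv.Perm.mul_apply]
  · rw [Equiv.Perm.mul_apply, sD_apply_of_lt hn hi hx, h2 x hx]
  · rw [even_card_iff] at h3 ⊢
    have h := mul_sD_sub_eq (f := fun _ x => if x < 0 then 1 else 0) h1 hn hi
    rw [sub_eq_iff_eq_add] at h
    rw [h, Int.even_add]
    refine iff_of_true ?_ h3
    have h0 := apply_zero_of_odd h1
    have e1 : w 1 ≠ 0 := fun e => by have := w.injective (e.trans h0.symm); omega
    have e2 : w 2 ≠ 0 := fun e => by have := w.injective (e.trans h0.symm); omega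
    split_ifs <;> first | omega | decide

theorem abs_apply_le (hw : ∀ x, (n : ℤ) < |x| → w x = x) {x : ℤ} (hx : |x| ≤ n) :
    |w x| ≤ n := by
  by_contra h
  have := w.injective (hw _ (not_le.1 h))
  rw [this] at h
  exact h hx

/-- The absence of descents means `-w(2) < w(1) < w(2) < ⋯ < w(n)`. Only `w(1)` could then be
negative, and the parity condition rules this out. -/
theorem eq_one_of_no_descent (hn : 2 ≤ n) (hw : w ∈ typeDGroup n)
    (h : ∀ i < n, ¬ w (i + 1) < w (lowD i)) : w = 1 := by
  obtain ⟨h1, h2, h3⟩ := hw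
  have h0 := apply_zero_of_odd h1
  have hle : ∀ i < n, w (lowD i) < w (i + 1) := fun i hi =>
    lt_of_le_of_ne (not_lt.1 (h i hi)) (w.injective.ne (by have := lowD_eq i; omega))
  have hmono : ∀ j : ℕ, 1 ≤ j → j < n → w j < w (j + 1 : ℕ) := fun j hj hj' => by
    have := hle j hj'
    rw [lowD, if_neg (by omega)] at this
    exact_mod_cast this
  have h12 : -w 2 < w 1 := by
    have := hle 0 (by omega)
    simpa [lowD, h1] using this
  have hpos2 : ∀ j : ℕ, 2 ≤ j → j ≤ n → 0 < w j := by
    intro j hj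
    induction j, hj using Nat.le_induction with
    | base =>
      intro _
      have := hmono 1 le_rfl (by omega)
      push_cast at this ⊢
      omega
    | succ j hj ih =>
      intro hj'
      have := hmono j (by omega) (by omega)
      have := ih (by omega)
      omega
  have hpos1 : 0 < w 1 := by
    by_contra hneg
    have e1 : w 1 ≠ 0 := fun e => by have := w.injective (e.trans h0.symm); omega
    have : ((Finset.Icc 1 n).filter fun j : ℕ => w j < 0) = {1} := by
      ext j
      simp only [Finset.mem_filter, Finset.mem_Icc, Finset.mem_singleton]
      constructor
      · rintro ⟨hj, hj'⟩
        by_contra hj1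
        have := hpos2 j (by omega) hj.2
        omega
      · rintro rfl
        exact ⟨by omega, by push_cast; omega⟩
    rw [this] at h3
    simp at h3
  have key := eq_self_of_increasing (m := n) (f := fun j => w j)
    (fun j hj => by
      rw [Finset.mem_Icc] at hj
      rcases hj.1.eq_or_lt with rfl | hj'
      · exact_mod_cast hpos1
      · exact hpos2 j hj' hj.2)
    (fun j hj => by
      rw [Finset.mem_Icc] at hj
      exact (le_abs_self _).trans (abs_apply_le h2 (by simpa using hj.2)))
    hmono
  ext x
  rw [Equiv.Perm.one_apply]
  have key' : ∀ j : ℕ, 1 ≤ j → w j = j := fun j hj => by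
    by_cases hjn : j ≤ n
    · exact key j (Finset.mem_Icc.2 ⟨hj, hjn⟩)
    · exact h2 _ (by simpa using hjn)
  rcases lt_trichotomy x 0 with hx | rfl | hx
  · have := key' (-x).toNat (by omega)
    rw [show (((-x).toNat : ℕ) : ℤ) = -x by omega, h1] at this
    omega
  · exact h0
  · have := key' x.toNat (by omega)
    rwa [show ((x.toNat : ℕ) : ℤ) = x by omega] at this

/-- Sorting by descents. The nonnegative potential `∑ j (n - w(j))` changes by `w(i+1) - w(i)` under
`s_i` with `i ≥ 1` and by `3 (w(1) + w(2))` under `s₀`; both are negative at a descent. -/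
theorem typeDGroup_subset (hn : 2 ≤ n) (hw : w ∈ typeDGroup n) : w ∈ groupD n := by
  induction hk : (∑ j ∈ Finset.Icc 1 n, (j : ℤ) * (n - w j)).toNat using
    Nat.strong_induction_on generalizing w with
  | _ k ih =>
  by_cases h : ∀ i < n, ¬ w (i + 1) < w (lowD i)
  · rw [eq_one_of_no_descent hn hw h]
    exact one_mem _
  · push Not at h
    obtain ⟨i, hi, h⟩ := h
    have hw' := mul_sD_mem_typeDGroup hn hi hw
    have hd := mul_sD_sub_eq (f := fun j x => (j : ℤ) * (n - x)) hw.1 hn hi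
    have hnn : ∀ {v : Equiv.Perm ℤ}, v ∈ typeDGroup n →
        0 ≤ ∑ j ∈ Finset.Icc 1 n, (j : ℤ) * (n - v j) := fun hv =>
      Finset.sum_nonneg fun j hj => mul_nonneg (by positivity) (sub_nonneg.2 (by
        rw [Finset.mem_Icc] at hj
        exact (le_abs_self _).trans (abs_apply_le hv.2.1 (by simpa using hj.2))))
    have hlt : ∑ j ∈ Finset.Icc 1 n, (j : ℤ) * (n - (w * sD i) j) <
        ∑ j ∈ Finset.Icc 1 n, (j : ℤ) * (n - w j) := by
      rw [← sub_neg, hd]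
      split_ifs with h0
      · subst h0
        simp only [lowD, if_true, hw.1, Nat.cast_zero, zero_add] at h
        push_cast
        linarith
      · rw [lowD, if_neg h0] at h
        push_cast
        linarith
    have := ih _ (by have := hnn hw; have := hnn hw'; omega) hw' rfl
    have h2 := mul_mem this (Subgroup.subset_closure ⟨⟨i, hi⟩, rfl⟩ : sD i ∈ groupD n)
    rwa [mul_assoc, sD_mul_self, mul_one] at h2

theorem groupD_subset (hn : 2 ≤ n) (hw : w ∈ groupD n) : w ∈ typeDGroup n := by
  obtain ⟨r, hr⟩ := (systemD n).exists_word ⟨w, hw⟩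
  have : ∀ r, ((systemD n).wordProd r : Equiv.Perm ℤ) ∈ typeDGroup n := by
    intro r
    induction r using List.reverseRecOn with
    | nil => exact ⟨fun _ => rfl, fun _ _ => rfl, by
        rw [Finset.filter_eq_empty_iff.2]
        · simp
        · intro j _
          simp⟩
    | append_singleton r s ih =>
      rw [DescentSystem.wordProd_append, DescentSystem.wordProd_cons,
        DescentSystem.wordProd_nil, mul_one]
      exact mul_sD_mem_typeDGroup hn s.2 ih
  have := this r
  rwa [hr] at this

theorem mem_groupD_iff (hn : 2 ≤ n) : w ∈ groupD n ↔ w ∈ typeDGroup n :=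
  ⟨groupD_subset hn, typeDGroup_subset hn⟩

/-- A group of permutations of `ℤ` that fix everything outside a finite set is finite. -/
theorem finite_of_forall_apply_eq {G : Subgroup (Equiv.Perm ℤ)} (s : Set ℤ) (hs : s.Finite)
    (h : ∀ w ∈ G, ∀ x ∉ s, w x = x) : Finite G := by
  have := hs.to_subtype
  have hmem : ∀ (w : G) (x : s), w.1 x ∈ s := fun w x => by
    by_contra hx
    have := w.1.injective (h w.1 w.2 _ hx)
    rw [this] at hx
    exact hx x.2
  refine Finite.of_injective (fun (w : G) (x : s) => (⟨w.1 x, hmem w x⟩ : s)) fun v w hvw => ?_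
  ext x
  by_cases hx : x ∈ s
  · exact congrArg Subtype.val (congrFun hvw ⟨x, hx⟩)
  · rw [h v v.2 x hx, h w w.2 x hx]

theorem finite_groupD (hn : 2 ≤ n) : Finite (groupD n) :=
  finite_of_forall_apply_eq {x | |x| ≤ n}
    ((Set.finite_Icc (-(n : ℤ)) n).subset fun _ hx => abs_le.1 hx)
    fun _ hw x hx => (groupD_subset hn hw).2.1 x (not_le.1 hx)

end TypeD

section TypeA

variable {m : ℕ} {w : Equiv.Perm ℤ}

theorem mul_sA_mem_typeAGroup {i : ℕ} (hi : i ≠ 0) (him : i < m) (hw : w ∈ typeAGroup m) :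
    w * sA i ∈ typeAGroup m := by
  intro x hx
  have : sA i x = x := by
    rw [Set.mem_Icc] at hx
    rw [sA_apply]
    split_ifs <;> omega
  rw [Equiv.Perm.mul_apply, this, hw x hx]

theorem apply_mem_Icc (hw : w ∈ typeAGroup m) {x : ℤ} (hx : x ∈ Set.Icc 1 (m : ℤ)) :
    w x ∈ Set.Icc 1 (m : ℤ) := by
  by_contra h
  have := w.injective (hw _ h)
  rw [this] at h
  exact h hx

theorem typeAGroup_subset (hw : w ∈ typeAGroup m) : w ∈ groupA m := by
  induction hk : (∑ j ∈ Finset.Icc 1 m, (j : ℤ) * (m - w j)).toNat using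
    Nat.strong_induction_on generalizing w with
  | _ k ih =>
  by_cases h : ∀ j : ℕ, 1 ≤ j → j < m → w j < w (j + 1 : ℕ)
  · have key := eq_self_of_increasing (m := m) (f := fun j => w j)
      (fun j hj => by
        rw [Finset.mem_Icc] at hj
        exact (apply_mem_Icc hw ⟨by omega, by omega⟩).1)
      (fun j hj => by
        rw [Finset.mem_Icc] at hj
        exact (apply_mem_Icc hw ⟨by omega, by omega⟩).2) h
    have : w = 1 := by
      ext x
      rw [Equiv.Perm.one_apply]
      by_cases hx : x ∈ Set.Icc 1 (m : ℤ)
      · rw [Set.mem_Icc] at hx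
        have := key x.toNat (Finset.mem_Icc.2 (by omega))
        rwa [show ((x.toNat : ℕ) : ℤ) = x by omega] at this
      · exact hw x hx
    rw [this]
    exact one_mem _
  · push Not at h
    obtain ⟨i, hi, him, h⟩ := h
    have hne : w i ≠ w (i + 1 : ℕ) := w.injective.ne (by omega)
    have hw' := mul_sA_mem_typeAGroup (by omega) him hw
    have hnn : ∀ {v : Equiv.Perm ℤ}, v ∈ typeAGroup m →
        0 ≤ ∑ j ∈ Finset.Icc 1 m, (j : ℤ) * (m - v j) := fun hv =>
      Finset.sum_nonneg fun j hj => mul_nonneg (by positivity) (sub_nonneg.2 (by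
        rw [Finset.mem_Icc] at hj
        exact (apply_mem_Icc hv ⟨by omega, by omega⟩).2))
    have hlt : ∑ j ∈ Finset.Icc 1 m, (j : ℤ) * (m - (w * sA i) j) <
        ∑ j ∈ Finset.Icc 1 m, (j : ℤ) * (m - w j) := by
      have e1 : sA i i = (i + 1 : ℕ) := by simp [sA_apply]
      have e2 : sA i (i + 1 : ℕ) = i := by simp [sA_apply]
      rw [← sub_neg, sum_sub_sum_of_eq_off_pair (p := i) (q := i + 1)]
      · rw [Equiv.Perm.mul_apply, Equiv.Perm.mul_apply, e1, e2]
        have : w (i + 1 : ℕ) < w i := lt_of_le_of_ne h hne.symm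
        push_cast at *
        linarith
      · simp; omega
      · simp; omega
      · simp
      · intro j hj h1 h2
        rw [Equiv.Perm.mul_apply, sA_apply]
        congr 3
        split_ifs <;> omega
    have := ih _ (by have := hnn hw; have := hnn hw'; omega) hw' rfl
    have hs : sA i ∈ groupA m := Subgroup.subset_closure ⟨⟨i - 1, by omega⟩, by
      simp only [Nat.sub_add_cancel hi]⟩
    have h2 := mul_mem this hs
    rwa [mul_assoc, sA, Equiv.swap_mul_self, mul_one] at h2

theorem mem_groupA_iff : w ∈ groupA m ↔ w ∈ typeAGroup m := by
  refine ⟨fun hw => ?_, typeAGroup_subset⟩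
  obtain ⟨r, hr⟩ := (systemA m).exists_word ⟨w, hw⟩
  have : ∀ r, ((systemA m).wordProd r : Equiv.Perm ℤ) ∈ typeAGroup m := by
    intro r
    induction r using List.reverseRecOn with
    | nil => exact fun _ _ => rfl
    | append_singleton r s ih =>
      rw [DescentSystem.wordProd_append, DescentSystem.wordProd_cons,
        DescentSystem.wordProd_nil, mul_one]
      exact mul_sA_mem_typeAGroup (by omega) (by omega) ih
  have := this r
  rwa [hr] at this

theorem finite_groupA (m : ℕ) : Finite (groupA m) :=
  finite_of_forall_apply_eq (Set.Icc 1 (m : ℤ)) (Set.finite_Icc _ _)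
    fun _ hw x hx => mem_groupA_iff.1 hw x hx

end TypeA

/-! ### Tableaux and descents -/

section Box

variable (V K : Finset ℕ)

theorem box_succ (j : ℕ) : box V K (j + 1) = if j ∈ V then ((box V K j).1 + 1, (box V K j).2)
    else if j ∈ K then ((box V K j).1 + 1, (box V K j).2 + 1)
    else ((box V K j).1, (box V K j).2 + 1) := rfl

theorem box_fst_mono : Monotone fun j => (box V K j).1 :=
  monotone_nat_of_le_succ fun j => by
    rw [box_succ]
    split_ifs <;> simp

theorem box_snd_mono : Monotone fun j => (box V K j).2 :=
  monotone_nat_of_le_succ fun j => by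
    rw [box_succ]
    split_ifs <;> simp

/-- Both coordinates grow weakly along the reading order. Boxes in one row (column) are therefore
joined by horizontal (vertical) steps only, and comparisons of neighbours suffice. -/
theorem isIncreasing_box_iff {e : ℕ → ℤ} {a n : ℕ} :
    IsIncreasing (box V K) e (Set.Icc a n) ↔ ∀ j, a ≤ j → j < n →
      (j ∈ V → e (j + 1) < e j) ∧ (j ∉ V → j ∉ K → e j < e (j + 1)) := by
  constructor
  · intro h j hj hjn
    have h1 := h j ⟨hj, hjn.le⟩ (j + 1) ⟨by omega, hjn⟩
    rw [box_succ] at h1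
    refine ⟨fun hV => ?_, fun hV hK => ?_⟩
    · rw [if_pos hV] at h1
      exact h1.2 rfl (Nat.lt_succ_self _)
    · rw [if_neg hV, if_neg hK] at h1
      exact h1.1 rfl (Nat.lt_succ_self _)
  · intro h i hi j hj
    have key : ∀ j, i + 1 ≤ j → j ≤ n →
        ((box V K i).1 = (box V K j).1 → e i < e j) ∧
        ((box V K i).2 = (box V K j).2 → e j < e i) := by
      intro j hij
      induction j, hij using Nat.le_induction with
      | base =>
        intro hn
        have h1 := h i hi.1 hn
        rw [box_succ]
        split_ifs with hV hK
        · simpa using h1.1 hV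
        · simp
        · simpa using h1.2 hV hK
      | succ j hij ih =>
        intro hn
        have h1 := h j (hi.1.trans (by omega)) hn
        obtain ⟨ih1, ih2⟩ := ih (by omega)
        have m1 := box_fst_mono V K (show i ≤ j by omega)
        have m2 := box_snd_mono V K (show i ≤ j by omega)
        simp only at m1 m2
        rw [box_succ]
        split_ifs with hV hK
        · have := h1.1 hV
          exact ⟨fun h => by simp at h; omega, fun h => this.trans (ih2 h)⟩
        · exact ⟨fun h => by simp at h; omega, fun h => by simp at h; omega⟩
        · have := h1.2 hV hK
          exact ⟨fun h => (ih1 h).trans this, fun h => by simp at h; omega⟩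
    refine ⟨fun h1 h2 => ?_, fun h1 h2 => ?_⟩
    · have hij : i < j := by
        by_contra hij
        have := box_snd_mono V K (not_lt.1 hij)
        simp only at this
        omega
      exact (key j hij hj.2).1 h1
    · have hij : i < j := by
        by_contra hij
        have := box_fst_mono V K (not_lt.1 hij)
        simp only at this
        omega
      exact (key j hij hj.2).2 h1

end Box

section TypeD

variable {n : ℕ} {α : GenPseudoRibbon}

theorem wordD_eq {w : Equiv.Perm ℤ} (hw : ∀ x, w (-x) = -w x) (i : ℕ) :
    wordD w i = w (lowD i) := by
  unfold wordD lowD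
  split_ifs
  · rw [hw]
  · rfl

theorem wordD_succ (w : Equiv.Perm ℤ) (i : ℕ) : wordD w (i + 1) = w (i + 1) := by
  simp [wordD]

/-- A vertical step forces a descent, a horizontal step an ascent, a break nothing. The `0`-box with
entry `-w(2)` supplies the condition at index `0`. -/
theorem isTableauD_iff (hn : 2 ≤ n) (w : groupD n) : IsTableauD n α w ↔
    w ∈ (systemD n).interval {i : Fin n | (i : ℕ) ∈ α.ups}
      {i : Fin n | (i : ℕ) ∉ α.ups ∧ (i : ℕ) ∉ α.breaks} := by
  have hodd := apply_neg_of_mem_groupD w.2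
  rw [IsTableauD, isIncreasing_box_iff, and_iff_right ((mem_groupD_iff hn).1 w.2)]
  have hne : ∀ i : ℕ, w.1 (i + 1) ≠ w.1 (lowD i) := fun i => w.1.injective.ne (by
    have := lowD_eq i
    omega)
  simp only [wordD_succ, wordD_eq hodd, zero_le, true_imp_iff]
  constructor
  · exact fun h => ⟨fun i hi => (h i i.2).1 hi, fun i hi => ((h i i.2).2 hi.1 hi.2).not_gt⟩
  · exact fun h j hj => ⟨fun hV => h.1 ⟨j, hj⟩ hV,
      fun hV hK => lt_of_le_of_ne (not_lt.1 (h.2 ⟨j, hj⟩ ⟨hV, hK⟩)) (hne j).symm⟩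

/-- The reading word of a type D tableau as an element of the group generated by the `s_i`. -/
def TableauD.word (hn : 2 ≤ n) (τ : TableauD n α) : groupD n :=
  ⟨τ.1, (mem_groupD_iff hn).2 τ.2.1⟩

variable (F : Type*) [Field F]

/-- The basis of `P^D_α` consisting of the tableaux. -/
noncomputable def basisD (n : ℕ) (α : GenPseudoRibbon) : Module.Basis (TableauD n α) F (PD F n α) :=
  (Finsupp.basisSingleOne : Module.Basis (TableauD n α) F (TableauD n α →₀ F))

@[simp] theorem basisD_apply (τ : TableauD n α) : basisD F n α τ = vecD F τ :=
  congrFun (Finsupp.coe_basisSingleOne (R := F) (ι := TableauD n α)) τ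

theorem opD_vecD (i : Fin n) (τ : TableauD n α) : opD F n α i (vecD F τ) = actD F n α i τ :=
  (Finsupp.linearCombination_single F 1 τ).trans (one_smul F _)

theorem mem_descentsD_iff_desc (i : Fin n) (w : groupD n) :
    (i : ℕ) ∈ descentsD n w.1 ↔ (systemD n).desc i w := by
  rw [descentsD, Set.mem_ofPred_eq, and_iff_right i.2, wordD_succ,
    wordD_eq (apply_neg_of_mem_groupD w.2)]
  rfl

theorem mem_descentsD_inv (hn : 2 ≤ n) (i : Fin n) (τ : TableauD n α) :
    (i : ℕ) ∈ descentsD n τ.1⁻¹ ↔ (systemD n).ldesc i (τ.word hn) :=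
  mem_descentsD_iff_desc i (τ.word hn)⁻¹

/-- `P^D_α` is the module of a descent class. -/
theorem isTableauModelD (hn : 2 ≤ n) (α : GenPseudoRibbon) :
    (systemD n).IsTableauModel {i : Fin n | (i : ℕ) ∈ α.ups}
      {i : Fin n | (i : ℕ) ∉ α.ups ∧ (i : ℕ) ∉ α.breaks} (basisD F n α)
      (TableauD.word hn) (opD F n α) where
  inj σ τ h := Subtype.ext (show σ.1 = τ.1 from congrArg (fun w : groupD n => w.1) h)
  range_eq := by
    ext w
    rw [← isTableauD_iff hn]
    constructor
    · rintro ⟨τ, rfl⟩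
      exact τ.2
    · exact fun h => ⟨⟨w, h⟩, rfl⟩
  op_neg i τ h := by
    rw [basisD_apply, opD_vecD, actD, if_pos ((mem_descentsD_inv hn i τ).2 h)]
  op_zero i τ h h' := by
    rw [← isTableauD_iff hn] at h'
    rw [basisD_apply, opD_vecD, actD, if_neg (mt (mem_descentsD_inv hn i τ).1 h)]
    exact dif_neg h'
  op_up i τ σ h h' := by
    have h' : σ.1 = sD i * τ.1 := congrArg Subtype.val h'
    have h2 : IsTableauD n α (sD i * τ.1) := h' ▸ σ.2
    rw [basisD_apply, opD_vecD, actD, if_neg (mt (mem_descentsD_inv hn i τ).1 h), dif_pos h2,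
      basisD_apply]
    congr 1
    exact Subtype.ext h'.symm

theorem genBar_smul_PD (hn : 2 ≤ n) (i : Fin n) (x : PD F n α) :
    (HeckeZero.genBar F i : HeckeD F n) • x = opD F n α i x := by
  have := finite_groupD hn
  exact LinearMap.congr_fun
    (HeckeZero.rep_genBar ((isTableauModelD F hn α).exists_rep (systemD n)) i) x

end TypeD

section TypeA

variable {m : ℕ} {β : Ribbon}

theorem isTableauA_iff (w : groupA m) : IsTableauA m β w ↔
    w ∈ (systemA m).interval {i : Fin (m - 1) | (i + 1 : ℕ) ∈ descents β.parts}
      {i : Fin (m - 1) | (i + 1 : ℕ) ∉ descents β.parts} := by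
  rw [IsTableauA, boxA, isIncreasing_box_iff, and_iff_right (mem_groupA_iff.1 w.2)]
  have hne : ∀ j : ℕ, w.1 (j + 1 : ℕ) ≠ w.1 j := fun j => w.1.injective.ne (by omega)
  constructor
  · exact fun h => ⟨fun i hi => (h (i + 1) (by omega) (by omega)).1 hi,
      fun i hi => ((h (i + 1) (by omega) (by omega)).2 hi (Finset.notMem_empty _)).not_gt⟩
  · intro h j hj hjm
    obtain ⟨j, rfl⟩ := Nat.exists_eq_add_of_le' hj
    exact ⟨fun hV => h.1 ⟨j, by omega⟩ hV, fun hV _ =>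
      lt_of_le_of_ne (not_lt.1 (h.2 ⟨j, by omega⟩ hV)) (hne (j + 1)).symm⟩

/-- The reading word of a tableau as an element of the group generated by the `s_i`. -/
def TableauA.word (τ : TableauA m β) : groupA m := ⟨τ.1, mem_groupA_iff.2 τ.2.1⟩

/-- A left descent says that the larger of two consecutive entries comes first in the reading word.
Reading order refines row order, and a tie of rows with the larger entry first would contradict
increasing rows. -/
theorem rowA_lt_iff (τ : TableauA m β) (i : Fin (m - 1)) :
    rowA β τ.1 ((i + 1 : ℕ) + 1) < rowA β τ.1 (i + 1 : ℕ) ↔ (systemA m).ldesc i τ.word := by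
  have hinv := mem_groupA_iff.1 (inv_mem τ.word.2)
  have ha := apply_mem_Icc hinv (x := (i + 1 : ℕ)) ⟨by omega, by omega⟩
  have hb := apply_mem_Icc hinv (x := ((i + 1 : ℕ) + 1 : ℕ)) ⟨by omega, by omega⟩
  change _ ↔ (τ.1⁻¹ : Equiv.Perm ℤ) ((i + 1 : ℕ) + 1 : ℕ) < (τ.1⁻¹ : Equiv.Perm ℤ) (i + 1 : ℕ)
  change (τ.1⁻¹ : Equiv.Perm ℤ) _ ∈ _ at ha hb
  have hta : τ.1 ((τ.1⁻¹ : Equiv.Perm ℤ) (i + 1 : ℕ)) = (i + 1 : ℕ) := τ.1.apply_symm_apply _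
  have htb : τ.1 ((τ.1⁻¹ : Equiv.Perm ℤ) ((i + 1 : ℕ) + 1 : ℕ)) = ((i + 1 : ℕ) + 1 : ℕ) :=
    τ.1.apply_symm_apply _
  simp only [rowA, boxA]
  generalize (τ.1⁻¹ : Equiv.Perm ℤ) (i + 1 : ℕ) = a at *
  generalize (τ.1⁻¹ : Equiv.Perm ℤ) ((i + 1 : ℕ) + 1 : ℕ) = b at *
  rw [Set.mem_Icc] at ha hb
  have hmono := box_fst_mono (descents β.parts) ∅
  have hmono2 := box_snd_mono (descents β.parts) ∅
  constructor
  · intro h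
    by_contra hab
    have := hmono (show a.toNat ≤ b.toNat by omega)
    simp only at this
    omega
  · intro hab
    refine lt_of_le_of_ne (hmono (show b.toNat ≤ a.toNat by omega)) fun he => ?_
    have h1 := τ.2.2 b.toNat ⟨by omega, by omega⟩ a.toNat ⟨by omega, by omega⟩
    have e1 : ((b.toNat : ℕ) : ℤ) = b := by omega
    have e2 : ((a.toNat : ℕ) : ℤ) = a := by omega
    simp only [e1, e2, hta, htb] at h1
    have h2 := h1.1 he
    have h3 := hmono2 (show b.toNat ≤ a.toNat by omega)
    simp only at h3
    have h4 : (boxA β b.toNat).2 = (boxA β a.toNat).2 := by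
      by_contra h4
      have := h2 (lt_of_le_of_ne h3 h4)
      push_cast at this
      omega
    have h5 : ∀ p q : ℕ, p < q → box (descents β.parts) ∅ p ≠ box (descents β.parts) ∅ q := by
      intro p q hpq hne
      have h6 := box_succ (descents β.parts) ∅ p
      have h7 := hmono (show p + 1 ≤ q from hpq)
      have h8 := hmono2 (show p + 1 ≤ q from hpq)
      simp only [← hne] at h7 h8
      rw [h6] at h7 h8
      split_ifs at h7 h8 <;> simp_all
    exact h5 b.toNat a.toNat (by omega) (Prod.ext he h4)

variable (F : Type*) [Field F]

/-- The basis of `P_β` consisting of the tableaux. -/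
noncomputable def basisA (m : ℕ) (β : Ribbon) : Module.Basis (TableauA m β) F (PA F m β) :=
  (Finsupp.basisSingleOne : Module.Basis (TableauA m β) F (TableauA m β →₀ F))

@[simp] theorem basisA_apply (τ : TableauA m β) : basisA F m β τ = vecA F τ :=
  congrFun (Finsupp.coe_basisSingleOne (R := F) (ι := TableauA m β)) τ

theorem opA_vecA (i : Fin (m - 1)) (τ : TableauA m β) :
    opA F m β i (vecA F τ) = actA F m β (i + 1) τ :=
  (Finsupp.linearCombination_single F 1 τ).trans (one_smul F _)

theorem rowA_sA_mul (w : Equiv.Perm ℤ) (i x : ℕ) (y : ℕ) (h : sA i x = y) :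
    rowA β (sA i * w) x = rowA β w y := by
  rw [rowA, rowA, mul_inv_rev, Equiv.Perm.mul_apply, ← h]
  congr 4

-- Brings the three-case rule for rows into the form used in type D. If both entries lie in one row,
-- the swapped filling cannot be standard: it would again have them in one row, hence no left
-- descent, whereas multiplication by the generator must reverse the descent status.
open Classical in
theorem actA_eq (i : Fin (m - 1)) (τ : TableauA m β) : actA F m β (i + 1) τ =
    if (systemA m).ldesc i τ.word then -vecA F τ
    else if h : IsTableauA m β (sA (i + 1) * τ.1) then vecA F ⟨sA (i + 1) * τ.1, h⟩ else 0 := by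
  rw [actA]
  simp only [rowA_lt_iff τ i]
  split_ifs with h1 h2 h3 h3 <;> first | rfl | skip
  exfalso
  have h4 : ¬ (systemA m).ldesc i (TableauA.word ⟨_, h3⟩) := by
    refine mt (rowA_lt_iff ⟨_, h3⟩ i).2 ?_
    have e1 := rowA_sA_mul (β := β) τ.1 (i + 1) (i + 1) (i + 1 + 1) (by simp [sA_apply])
    have e2 := rowA_sA_mul (β := β) τ.1 (i + 1) (i + 1 + 1) (i + 1) (by simp [sA_apply])
    change ¬ rowA β (sA (i + 1) * τ.1) (i + 1 + 1) < rowA β (sA (i + 1) * τ.1) (i + 1)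
    rw [e1, e2]
    omega
  exact h4 (((systemA m).ldesc_gs_mul i τ.word).2 h1)

/-- `P_β` is the module of a descent class. -/
theorem isTableauModelA (m : ℕ) (β : Ribbon) :
    (systemA m).IsTableauModel {i : Fin (m - 1) | (i + 1 : ℕ) ∈ descents β.parts}
      {i : Fin (m - 1) | (i + 1 : ℕ) ∉ descents β.parts} (basisA F m β)
      TableauA.word (opA F m β) where
  inj σ τ h := Subtype.ext (show σ.1 = τ.1 from congrArg (fun w : groupA m => w.1) h)
  range_eq := by
    ext w
    rw [← isTableauA_iff]
    constructor
    · rintro ⟨τ, rfl⟩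
      exact τ.2
    · exact fun h => ⟨⟨w, h⟩, rfl⟩
  op_neg i τ h := by
    rw [basisA_apply, opA_vecA, actA_eq, if_pos h]
  op_zero i τ h h' := by
    rw [← isTableauA_iff] at h'
    rw [basisA_apply, opA_vecA, actA_eq, if_neg h]
    exact dif_neg h'
  op_up i τ σ h h' := by
    have h' : σ.1 = sA (i + 1) * τ.1 := congrArg Subtype.val h'
    have h2 : IsTableauA m β (sA (i + 1) * τ.1) := h' ▸ σ.2
    rw [basisA_apply, opA_vecA, actA_eq, if_neg h, dif_pos h2, basisA_apply]
    congr 1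
    exact Subtype.ext h'.symm

theorem genBar_smul_PA (i : Fin (m - 1)) (x : PA F m β) :
    (HeckeZero.genBar F i : HeckeA F m) • x = opA F m β i x := by
  have := finite_groupA m
  exact LinearMap.congr_fun
    (HeckeZero.rep_genBar ((isTableauModelA F m β).exists_rep (systemA m)) i) x

end TypeA

/-! ### Descent sets of ribbons -/

theorem descents_singleton (a : ℕ) : descents [a] = ∅ := by simp [descents]

/-- Merging the first two parts loses only the first partial sum. Inductions on descent sets rest on
this. -/
theorem descents_cons_cons (a b : ℕ) (l : List ℕ) :
    descents (a :: b :: l) = insert a (descents ((a + b) :: l)) := by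
  ext x
  simp only [descents, Finset.mem_image, Finset.mem_Ico, Finset.mem_insert, List.length_cons]
  constructor
  · rintro ⟨k, ⟨hk, hk'⟩, rfl⟩
    rcases hk.eq_or_lt with rfl | hk
    · left; simp
    · right
      obtain ⟨k, rfl⟩ := Nat.exists_eq_add_of_le' (show 2 ≤ k from hk)
      exact ⟨k + 1, by omega, by simp [add_assoc]⟩
  · rintro (rfl | ⟨k, ⟨hk, hk'⟩, rfl⟩)
    · exact ⟨1, by omega, by simp⟩
    · obtain ⟨k, rfl⟩ := Nat.exists_eq_add_of_le' hk
      exact ⟨k + 2, by omega, by simp [add_assoc]⟩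

theorem descents_append (a b : ℕ) (l l' : List ℕ) :
    descents (a :: l ++ b :: l') =
      descents (a :: l) ∪ insert (a :: l).sum ((descents (b :: l')).image ((a :: l).sum + ·)) := by
  induction l generalizing a with
  | nil =>
    simp only [List.singleton_append, descents_singleton, Finset.empty_union,
      List.sum_nil, List.sum_cons, add_zero]
    rw [descents_cons_cons]
    congr 1
    induction l' generalizing b with
    | nil => simp [descents_singleton]
    | cons c l' ih =>
      rw [descents_cons_cons, descents_cons_cons, Finset.image_insert, add_assoc, ih]
  | cons c l ih =>
    have := ih (a + c)
    simp only [List.cons_append] at this ⊢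
    rw [descents_cons_cons, this, descents_cons_cons, Finset.insert_union]
    simp only [List.sum_cons, add_assoc]

theorem descents_lt {a : ℕ} {l : List ℕ} (hl : ∀ b ∈ l, 0 < b) {x : ℕ}
    (hx : x ∈ descents (a :: l)) : a ≤ x ∧ x < (a :: l).sum := by
  induction l generalizing a with
  | nil => simp [descents_singleton] at hx
  | cons b l ih =>
    have hb : 0 < b := hl b (by simp)
    have hl' : ∀ c ∈ l, 0 < c := fun c hc => hl c (by simp [hc])
    rw [descents_cons_cons, Finset.mem_insert] at hx
    rcases hx with rfl | hx
    · simp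
      omega
    · have := ih hl' hx
      simp only [List.sum_cons] at this ⊢
      omega

/-- When there is a descent, the first part is the least one, even if it is `0`. Merging the first
two parts removes it and leaves shorter lists. -/
theorem eq_of_descents_eq {a a' : ℕ} {l l' : List ℕ} (hl : ∀ b ∈ l, 0 < b)
    (hl' : ∀ b ∈ l', 0 < b) (hs : (a :: l).sum = (a' :: l').sum)
    (hd : descents (a :: l) = descents (a' :: l')) : a = a' ∧ l = l' := by
  induction l generalizing a a' l' with
  | nil =>
    rcases l' with _ | ⟨b', l'⟩
    · simpa using hs
    · rw [descents_singleton, descents_cons_cons] at hd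
      exact absurd hd.symm (Finset.insert_ne_empty _ _)
  | cons b l ih =>
    rcases l' with _ | ⟨b', l'⟩
    · rw [descents_singleton, descents_cons_cons] at hd
      exact absurd hd (Finset.insert_ne_empty _ _)
    · have hb : 0 < b := hl b (by simp)
      have hb' : 0 < b' := hl' b' (by simp)
      have hl1 : ∀ c ∈ l, 0 < c := fun c hc => hl c (by simp [hc])
      have hl1' : ∀ c ∈ l', 0 < c := fun c hc => hl' c (by simp [hc])
      have h1 : a ∈ descents (a' :: b' :: l') := by
        rw [← hd, descents_cons_cons]; exact Finset.mem_insert_self _ _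
      have h2 : a' ∈ descents (a :: b :: l) := by
        rw [hd, descents_cons_cons]; exact Finset.mem_insert_self _ _
      obtain rfl : a = a' := le_antisymm (descents_lt hl h2).1 (descents_lt hl' h1).1
      have h3 : descents ((a + b) :: l) = descents ((a + b') :: l') := by
        have e1 : a ∉ descents ((a + b) :: l) := fun h => by
          have := (descents_lt hl1 h).1; omega
        have e2 : a ∉ descents ((a + b') :: l') := fun h => by
          have := (descents_lt hl1' h).1; omega
        rw [descents_cons_cons, descents_cons_cons] at hd
        rw [← Finset.erase_insert e1, hd, Finset.erase_insert e2]
      have := ih hl1 hl1' (by simpa [add_assoc] using hs) h3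
      exact ⟨rfl, by rw [this.2]; congr 1; omega⟩

namespace PseudoRibbon

theorem ext_of_descents {α β : PseudoRibbon} (hs : α.size = β.size)
    (hd : descents α.parts = descents β.parts) : α = β := by
  have := eq_of_descents_eq α.rest_pos β.rest_pos hs hd
  exact PseudoRibbon.ext this.1 this.2

theorem concat_parts (α : PseudoRibbon) (β : Ribbon) :
    (α.concat β).parts = α.parts ++ β.parts := rfl

theorem size_concat (α : PseudoRibbon) (β : Ribbon) :
    (α.concat β).size = α.size + β.size := by
  rw [size, concat_parts, List.sum_append, size, Ribbon.size]

theorem descents_concat (α : PseudoRibbon) (β : Ribbon) : descents (α.concat β).parts =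
    descents α.parts ∪ insert α.size ((descents β.parts).image (α.size + ·)) :=
  descents_append α.first β.first α.rest β.rest

theorem descents_nearConcat_aux (a b : ℕ) (l l' : List ℕ) :
    ∃ c l'', (if l = [] then a + b else a) = c ∧
      (if h : l = [] then l' else l.dropLast ++ (l.getLast h + b) :: l') = l'' ∧
      (c :: l'').sum = (a :: l).sum + (b :: l').sum ∧
      descents (c :: l'') =
        descents (a :: l) ∪ (descents (b :: l')).image ((a :: l).sum + ·) := by
  refine ⟨_, _, rfl, rfl, ?_⟩
  induction l generalizing a with
  | nil =>
    simp only [if_true, dif_pos]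
    refine ⟨by simp [add_assoc], ?_⟩
    rw [descents_singleton, Finset.empty_union, List.sum_singleton]
    induction l' generalizing b with
    | nil => simp [descents_singleton]
    | cons c l' ih =>
      rw [descents_cons_cons, descents_cons_cons, Finset.image_insert, add_assoc, ih]
  | cons d l ih =>
    obtain ⟨h1, h2⟩ := ih (a + d)
    rcases l with _ | ⟨e, l⟩
    · simp only [if_true, dif_pos, List.cons_ne_nil, if_false, not_false_eq_true, dif_neg,
        List.dropLast_singleton, List.getLast_singleton, List.nil_append] at h1 h2 ⊢
      refine ⟨by simp [add_assoc], ?_⟩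
      rw [descents_cons_cons, ← add_assoc, h2, descents_cons_cons, Finset.insert_union]
      simp [descents_singleton]
    · simp only [List.cons_ne_nil, if_false, not_false_eq_true, dif_neg,
        List.dropLast_cons_cons, List.getLast_cons_cons, List.cons_append] at h1 h2 ⊢
      refine ⟨?_, ?_⟩
      · simp only [List.sum_cons] at h1 ⊢
        omega
      · rw [descents_cons_cons, h2, descents_cons_cons (l := e :: l), Finset.insert_union]
        simp [add_assoc]

theorem size_nearConcat (α : PseudoRibbon) (β : Ribbon) :
    (α.nearConcat β).size = α.size + β.size := by
  obtain ⟨_, _, rfl, rfl, h, -⟩ := descents_nearConcat_aux α.first β.first α.rest β.rest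
  exact h

theorem descents_nearConcat (α : PseudoRibbon) (β : Ribbon) :
    descents (α.nearConcat β).parts =
      descents α.parts ∪ (descents β.parts).image (α.size + ·) := by
  obtain ⟨_, _, rfl, rfl, -, h⟩ := descents_nearConcat_aux α.first β.first α.rest β.rest
  exact h

theorem lt_size {α : PseudoRibbon} {x : ℕ} (h : x ∈ descents α.parts) : x < α.size :=
  (descents_lt α.rest_pos h).2

end PseudoRibbon

theorem descents_replicate_one (a k : ℕ) :
    descents (a :: List.replicate k 1) = Finset.Ico a (a + k) := by
  induction k generalizing a with
  | zero => simp [descents_singleton]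
  | succ k ih =>
    rw [List.replicate_succ, descents_cons_cons, ih]
    ext x
    simp only [Finset.mem_insert, Finset.mem_Ico]
    omega

namespace Ribbon

theorem lt_size {β : Ribbon} {x : ℕ} (h : x ∈ descents β.parts) : 0 < x ∧ x < β.size := by
  have := descents_lt β.rest_pos h
  exact ⟨β.first_pos.trans_le this.1, this.2⟩

theorem size_ones (β : Ribbon) : β.ones.size = β.size := by
  have := β.size_pos
  simp only [ones, size, parts, List.sum_cons, List.sum_replicate, smul_eq_mul] at this ⊢
  omega

theorem descents_ones (β : Ribbon) : descents β.ones.parts = Finset.Ico 1 β.size := by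
  have := β.size_pos
  rw [ones, parts, descents_replicate_one, Nat.add_sub_cancel' this]

end Ribbon

namespace GenPseudoRibbon

theorem offset_zero (h : PseudoRibbon) (t : List Ribbon) : offset ⟨h, t⟩ 0 = h.size := by
  simp [offset]

theorem offset_cons_succ (h : PseudoRibbon) (β : Ribbon) (t : List Ribbon) (h' : PseudoRibbon)
    (hs : h'.size = h.size + β.size) (b : ℕ) :
    offset ⟨h, β :: t⟩ (b + 1) = offset ⟨h', t⟩ b := by
  simp [offset, hs, add_assoc]

theorem mem_ups {α : GenPseudoRibbon} {x : ℕ} : x ∈ α.ups ↔ x ∈ descents α.head.parts ∨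
    ∃ b : Fin α.tail.length, ∃ y ∈ descents (α.tail.get b).parts, α.offset b + y = x := by
  simp [ups]

theorem mem_breaks {α : GenPseudoRibbon} {x : ℕ} :
    x ∈ α.breaks ↔ ∃ b : Fin α.tail.length, α.offset b = x := by
  simp [breaks]

theorem ups_nil (h : PseudoRibbon) : ups ⟨h, []⟩ = descents h.parts := by
  simp [ups]

theorem breaks_nil (h : PseudoRibbon) : breaks ⟨h, []⟩ = ∅ := by
  simp [breaks]

/-- Joining by `▷` puts a horizontal step at the junction and keeps all offsets. It is the reduction
step for inductions over the components. -/
theorem mem_ups_cons {h : PseudoRibbon} {β : Ribbon} {t : List Ribbon} {x : ℕ} :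
    x ∈ ups ⟨h, β :: t⟩ ↔ x ∈ ups ⟨h.nearConcat β, t⟩ := by
  simp only [mem_ups, PseudoRibbon.descents_nearConcat, Finset.mem_union, Finset.mem_image,
    or_assoc]
  refine or_congr_right ?_
  rw [show (∃ b : Fin (β :: t).length, ∃ y ∈ descents ((β :: t).get b).parts,
      offset ⟨h, β :: t⟩ b + y = x) ↔ _ from Fin.exists_fin_succ]
  simp only [Fin.val_zero, offset_zero, Fin.val_succ,
    offset_cons_succ h β t _ (h.size_nearConcat β)]
  rfl

theorem mem_breaks_cons {h : PseudoRibbon} {β : Ribbon} {t : List Ribbon} {x : ℕ} :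
    x ∈ breaks ⟨h, β :: t⟩ ↔ x = h.size ∨ x ∈ breaks ⟨h.nearConcat β, t⟩ := by
  simp only [mem_breaks]
  rw [show (∃ b : Fin (β :: t).length, offset ⟨h, β :: t⟩ b = x) ↔ _ from Fin.exists_fin_succ]
  simp only [Fin.val_zero, offset_zero, Fin.val_succ,
    offset_cons_succ h β t _ (h.size_nearConcat β), eq_comm (a := h.size)]

theorem mem_ups_concat {h : PseudoRibbon} {β : Ribbon} {t : List Ribbon} {x : ℕ} :
    x ∈ ups ⟨h.concat β, t⟩ ↔ x = h.size ∨ x ∈ ups ⟨h.nearConcat β, t⟩ := by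
  have e : ∀ b, offset ⟨h.concat β, t⟩ b = offset ⟨h.nearConcat β, t⟩ b := fun b => by
    simp [offset, h.size_concat, h.size_nearConcat]
  simp only [mem_ups, PseudoRibbon.descents_nearConcat, PseudoRibbon.descents_concat, e,
    Finset.mem_union, Finset.mem_image, Finset.mem_insert]
  constructor
  · rintro ((h1 | h1 | h1) | h1)
    exacts [Or.inr (Or.inl (Or.inl h1)), Or.inl h1, Or.inr (Or.inl (Or.inr h1)),
      Or.inr (Or.inr h1)]
  · rintro (h1 | (h1 | h1) | h1)
    exacts [Or.inl (Or.inr (Or.inl h1)), Or.inl (Or.inl h1), Or.inl (Or.inr (Or.inr h1)),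
      Or.inr h1]

theorem breaks_concat (h : PseudoRibbon) (β : Ribbon) (t : List Ribbon) :
    breaks ⟨h.concat β, t⟩ = breaks ⟨h.nearConcat β, t⟩ := by
  have e : ∀ b, offset ⟨h.concat β, t⟩ b = offset ⟨h.nearConcat β, t⟩ b := fun b => by
    simp [offset, h.size_concat, h.size_nearConcat]
  simp only [breaks, e]

theorem size_cons (h : PseudoRibbon) (β : Ribbon) (t : List Ribbon) :
    size ⟨h, β :: t⟩ = size ⟨h.nearConcat β, t⟩ := by
  simp [size, h.size_nearConcat, add_assoc]

theorem size_concat (h : PseudoRibbon) (β : Ribbon) (t : List Ribbon) :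
    size ⟨h.concat β, t⟩ = size ⟨h.nearConcat β, t⟩ := by
  simp [size, h.size_nearConcat, h.size_concat]

theorem descents_near (α : GenPseudoRibbon) : descents α.near.parts = α.ups := by
  obtain ⟨h, t⟩ := α
  induction t generalizing h with
  | nil => rw [ups_nil]; rfl
  | cons β t ih =>
    refine (ih (h.nearConcat β)).trans ?_
    ext x
    exact mem_ups_cons.symm

theorem size_near (α : GenPseudoRibbon) : α.near.size = α.size := by
  obtain ⟨h, t⟩ := α
  induction t generalizing h with
  | nil => rfl
  | cons β t ih => exact (ih (h.nearConcat β)).trans (size_cons h β t).symm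

theorem lt_size_of_mem_ups {α : GenPseudoRibbon} {x : ℕ} (hx : x ∈ α.ups) : x < α.size := by
  rw [← descents_near] at hx
  exact α.size_near ▸ PseudoRibbon.lt_size hx

theorem size_le_of_mem_breaks {α : GenPseudoRibbon} {x : ℕ} (hx : x ∈ α.breaks) :
    α.head.size ≤ x ∧ x < α.size := by
  obtain ⟨b, rfl⟩ := mem_breaks.1 hx
  have h1 := α.offset_succ b
  have h2 := α.offset_le_size (b + 1)
  have h3 := (α.tail.get b).size_pos
  exact ⟨Nat.le_add_right _ _, by omega⟩

/-- Only the sizes of `h` and `g` need to agree. Every interior index of `1^m` is a descent, while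
the junctions made by `▷` are not. -/
theorem mem_descents_nearOnes_aux {x : ℕ} (t : List Ribbon) (h g : PseudoRibbon)
    (hs : g.size = h.size) :
    x ∈ descents ((t.map Ribbon.ones).foldl PseudoRibbon.nearConcat g).parts ↔
      x ∈ descents g.parts ∨ h.size ≤ x ∧ x < size ⟨h, t⟩ ∧ x ∉ breaks ⟨h, t⟩ := by
  induction t generalizing h g with
  | nil =>
    simp only [List.map_nil, List.foldl_nil, size, List.sum_nil]
    constructor
    · exact Or.inl
    · rintro (hx | hx)
      · exact hx
      · omega
  | cons β t ih =>
    rw [List.map_cons, List.foldl_cons, ih (h.nearConcat β) (g.nearConcat β.ones) (by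
      rw [g.size_nearConcat, h.size_nearConcat, hs, β.size_ones])]
    rw [PseudoRibbon.descents_nearConcat, Ribbon.descents_ones, mem_breaks_cons, size_cons,
      h.size_nearConcat, hs]
    have h1 : h.size + β.size ≤ size ⟨h.nearConcat β, t⟩ := by
      rw [← size_cons]
      simp only [size, List.map_cons, List.sum_cons]
      omega
    have h2 : x ∈ breaks ⟨h.nearConcat β, t⟩ → h.size + β.size ≤ x := fun hx => by
      have := (size_le_of_mem_breaks hx).1
      rwa [h.size_nearConcat] at this
    simp only [Finset.mem_union, Finset.mem_image, Finset.mem_Ico]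
    have h3 : (∃ a, (1 ≤ a ∧ a < β.size) ∧ h.size + a = x) ↔
        h.size < x ∧ x < h.size + β.size :=
      ⟨fun ⟨a, ha, hx⟩ => by omega, fun hx => ⟨x - h.size, by omega, by omega⟩⟩
    rw [h3]
    have := β.size_pos
    by_cases hb : x ∈ breaks ⟨h.nearConcat β, t⟩
    · have := h2 hb
      have h4 : ¬(h.size < x ∧ x < h.size + β.size) := by omega
      simp only [hb, not_true, and_false, or_false, or_true, h4]
    · simp only [hb, not_false_iff, and_true, or_false, or_assoc]
      refine or_congr_right ?_
      omega

theorem mem_descents_nearOnes {α : GenPseudoRibbon} {x : ℕ} :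
    x ∈ descents α.nearOnes.parts ↔ x < α.size ∧ x ∉ α.breaks := by
  have h1 : descents α.head.zeroOnes.parts = Finset.Ico 0 α.head.size := by
    rw [PseudoRibbon.zeroOnes, PseudoRibbon.parts, descents_replicate_one, zero_add]
  have h2 : α.head.size ≤ α.size := Nat.le_add_right _ _
  refine (mem_descents_nearOnes_aux α.tail α.head α.head.zeroOnes (by
    simp [PseudoRibbon.zeroOnes, PseudoRibbon.size, PseudoRibbon.parts])).trans ?_
  rw [h1, Finset.mem_Ico]
  change _ ∨ _ ∧ x < α.size ∧ x ∉ α.breaks ↔ _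
  have h3 : x ∈ α.breaks → α.head.size ≤ x := fun hx => (size_le_of_mem_breaks hx).1
  by_cases hb : x ∈ α.breaks
  · have := h3 hb
    simp [hb, this]
  · simp only [hb, not_false_iff, and_true]
    omega

theorem disjoint_ups_breaks (α : GenPseudoRibbon) : Disjoint α.ups α.breaks := by
  obtain ⟨h, t⟩ := α
  induction t generalizing h with
  | nil => simp [breaks_nil]
  | cons β t ih =>
    rw [Finset.disjoint_left]
    intro x hx hx'
    rw [mem_ups_cons] at hx
    rcases mem_breaks_cons.1 hx' with rfl | hx'
    · have key : ∀ (t : List Ribbon) (g : PseudoRibbon) (y : ℕ), y < g.size →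
          y ∉ descents g.parts → y ∉ ups ⟨g, t⟩ := by
        intro t g y hy hyd hyu
        rcases mem_ups.1 hyu with hyu | ⟨b, z, -, rfl⟩
        · exact hyd hyu
        · have : g.size ≤ offset ⟨g, t⟩ b := Nat.le_add_right _ _
          omega
      refine key t _ _ ?_ ?_ hx
      · have := β.size_pos
        rw [h.size_nearConcat]
        omega
      · rw [h.descents_nearConcat, Finset.mem_union, Finset.mem_image]
        rintro (h1 | ⟨y, hy, h1⟩)
        · exact lt_irrefl _ (PseudoRibbon.lt_size h1)
        · have := (Ribbon.lt_size hy).1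
          omega
    · exact Finset.disjoint_left.1 (ih _) hx hx'

theorem mem_glue_cons {h : PseudoRibbon} {β : Ribbon} {t : List Ribbon} {γ : PseudoRibbon} :
    γ ∈ glue ⟨h, β :: t⟩ ↔ γ ∈ glue ⟨h.concat β, t⟩ ∨ γ ∈ glue ⟨h.nearConcat β, t⟩ := by
  -- The fold acts on the elements of the starting set separately, so it may be started from a
  -- single pseudo-ribbon.
  have hfold : ∀ (t : List Ribbon) (S : Set PseudoRibbon) (γ : PseudoRibbon),
      γ ∈ t.foldl (fun S β => {γ | ∃ δ ∈ S, γ = δ.concat β ∨ γ = δ.nearConcat β}) S ↔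
        ∃ δ ∈ S, γ ∈ glue ⟨δ, t⟩ := by
    intro t
    induction t with
    | nil => simp [glue]
    | cons β t ih =>
      intro S γ
      simp only [glue, List.foldl_cons]
      rw [ih]
      constructor
      · rintro ⟨δ, ⟨ε, hε, h⟩, hγ⟩
        exact ⟨ε, hε, (ih _ _).2 ⟨δ, ⟨ε, rfl, h⟩, hγ⟩⟩
      · rintro ⟨ε, hε, hγ⟩
        obtain ⟨δ, ⟨ε', hε', h⟩, hγ'⟩ := (ih _ _).1 hγ
        obtain rfl : ε' = ε := hε'
        exact ⟨δ, ⟨ε', hε, h⟩, hγ'⟩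
  rw [glue, List.foldl_cons, hfold]
  simp [or_and_right, exists_or]

/-- The set `[α]` consists of the pseudo-ribbons whose descents are obtained from the vertical
adjacencies of `α` by adding some of the breaks between components. -/
theorem mem_glue_iff {α : GenPseudoRibbon} {γ : PseudoRibbon} : γ ∈ α.glue ↔
    γ.size = α.size ∧ α.ups ⊆ descents γ.parts ∧ descents γ.parts ⊆ α.ups ∪ α.breaks := by
  obtain ⟨h, t⟩ := α
  induction t generalizing h with
  | nil =>
    simp only [glue, List.foldl_nil, Set.mem_singleton_iff, ups_nil, breaks_nil,
      Finset.union_empty, size, List.map_nil, List.sum_nil, add_zero]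
    constructor
    · rintro rfl
      simp
    · rintro ⟨h1, h2, h3⟩
      exact PseudoRibbon.ext_of_descents h1 (Finset.Subset.antisymm h3 h2)
  | cons β t ih =>
    have hd := disjoint_ups_breaks ⟨h, β :: t⟩
    refine mem_glue_cons.trans ((or_congr (ih _) (ih _)).trans ?_)
    rw [breaks_concat, size_cons, size_concat]
    simp only [Finset.subset_iff, Finset.mem_union, mem_ups_cons, mem_breaks_cons, mem_ups_concat]
    have hn : h.size ∉ ups ⟨h.nearConcat β, t⟩ := fun hu =>
      Finset.disjoint_left.1 hd (mem_ups_cons.2 hu) (mem_breaks_cons.2 (Or.inl rfl))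
    -- Membership of the first break in the descent set decides between `·` and `▷` at the first
    -- junction.
    by_cases hγ : h.size ∈ descents γ.parts
    · constructor
      · rintro (⟨h2, h3, h4⟩ | ⟨h2, h3, h4⟩)
        · exact ⟨h2, fun x hx => h3 (Or.inr hx), fun x hx => by have := h4 hx; tauto⟩
        · exact ⟨h2, h3, fun x hx => by have := h4 hx; tauto⟩
      · rintro ⟨h2, h3, h4⟩
        refine Or.inl ⟨h2, ?_, fun x hx => by have := h4 hx; tauto⟩
        rintro x (rfl | hx)
        · exact hγ
        · exact h3 hx
    · constructor
      · rintro (⟨h2, h3, h4⟩ | ⟨h2, h3, h4⟩)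
        · exact absurd (h3 (Or.inl rfl)) hγ
        · exact ⟨h2, h3, fun x hx => by have := h4 hx; tauto⟩
      · rintro ⟨h2, h3, h4⟩
        refine Or.inr ⟨h2, h3, fun x hx => ?_⟩
        rcases h4 hx with h5 | rfl | h5
        · exact Or.inl h5
        · exact absurd hx hγ
        · exact Or.inr h5

theorem finite_glue (α : GenPseudoRibbon) : α.glue.Finite := by
  refine Set.Finite.of_finite_image (f := fun γ => descents γ.parts)
    (((α.ups ∪ α.breaks).powerset).finite_toSet.subset ?_) fun γ hγ δ hδ h => ?_
  · rintro _ ⟨γ, hγ, rfl⟩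
    exact Finset.mem_coe.2 (Finset.mem_powerset.2 (mem_glue_iff.1 hγ).2.2)
  · exact PseudoRibbon.ext_of_descents
      ((mem_glue_iff.1 hγ).1.trans (mem_glue_iff.1 hδ).1.symm) h

/-- Every set of indices between the vertical adjacencies and their union with the breaks is the
descent set of an element of `[α]`. -/
theorem exists_mem_glue {α : GenPseudoRibbon} {D : Finset ℕ} (h1 : α.ups ⊆ D)
    (h2 : D ⊆ α.ups ∪ α.breaks) : ∃ γ ∈ α.glue, descents γ.parts = D := by
  obtain ⟨h, t⟩ := α
  induction t generalizing h with
  | nil =>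
    rw [breaks_nil, Finset.union_empty] at h2
    rw [ups_nil] at h1 h2
    exact ⟨h, rfl, Finset.Subset.antisymm h1 h2⟩
  | cons β t ih =>
    by_cases hD : h.size ∈ D
    · obtain ⟨γ, hγ, e⟩ := ih (h.concat β) (fun x hx => by
        rcases mem_ups_concat.1 hx with rfl | hx
        · exact hD
        · exact h1 (mem_ups_cons.2 hx)) (fun x hx => by
        rw [breaks_concat]
        rcases Finset.mem_union.1 (h2 hx) with h3 | h3
        · exact Finset.mem_union_left _ (mem_ups_concat.2 (Or.inr (mem_ups_cons.1 h3)))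
        · rcases mem_breaks_cons.1 h3 with h3 | h3
          · exact Finset.mem_union_left _ (mem_ups_concat.2 (Or.inl h3))
          · exact Finset.mem_union_right _ h3)
      exact ⟨γ, mem_glue_cons.2 (Or.inl hγ), e⟩
    · obtain ⟨γ, hγ, e⟩ := ih (h.nearConcat β) (fun x hx => h1 (mem_ups_cons.2 hx))
        (fun x hx => by
        rcases Finset.mem_union.1 (h2 hx) with h3 | h3
        · exact Finset.mem_union_left _ (mem_ups_cons.1 h3)
        · rcases mem_breaks_cons.1 h3 with rfl | h3
          · exact absurd hx hD
          · exact Finset.mem_union_right _ h3)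
      exact ⟨γ, mem_glue_cons.2 (Or.inr hγ), e⟩

end GenPseudoRibbon

namespace DescentSystem

open HeckeZero

/-! ### The elements `π̄_{w₀(I)}` and `π_{w₀(L)}` computed in an overgroup -/

section Overgroup

variable {B : Type*} {M : CoxeterMatrix B} {W W' : Type*} [Group W] [Group W']
  (C : DescentSystem M W) {ι : W →* W'}

theorem map_prod_overgroup (r : List B) : (r.map fun s => ι (C.gs s)).prod = ι (C.wordProd r) := by
  rw [wordProd, map_list_prod, List.map_map]
  rfl

/-- Lengths and longest elements in the theorem are taken inside `Equiv.Perm ℤ`, not in the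
generated subgroup. An injective homomorphism preserves which words represent an element. -/
theorem wordLength_overgroup (hι : Function.Injective ι) (w : W) :
    wordLength (fun s => ι (C.gs s)) (ι w) = C.len w := by
  simp only [wordLength, len, C.map_prod_overgroup, hι.eq_iff]
  rfl

theorem closure_overgroup (I : Set B) :
    Subgroup.closure ((fun s => ι (C.gs s)) '' I) = (C.para I).map ι := by
  rw [para, MonoidHom.map_closure, Set.image_image]

theorem isLongest_overgroup (hι : Function.Injective ι) {I : Set B} {w : W} :
    IsLongest (fun s => ι (C.gs s)) I (ι w) ↔ IsLongest C.gs I w := by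
  rw [IsLongest, IsLongest, C.closure_overgroup, Subgroup.mem_map_iff_mem hι]
  refine and_congr Iff.rfl ⟨fun h u hu => ?_, ?_⟩
  · have := h _ (Subgroup.mem_map_of_mem ι hu)
    rwa [C.wordLength_overgroup hι, C.wordLength_overgroup hι] at this
  · rintro h _ ⟨u, hu, rfl⟩
    rw [C.wordLength_overgroup hι, C.wordLength_overgroup hι]
    exact h u hu

theorem longest_overgroup (hι : Function.Injective ι) [Finite W] (I : Set B) :
    C.IsReduced (reducedWord (fun s => ι (C.gs s)) (longest (fun s => ι (C.gs s)) I)) ∧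
      IsLongest C.gs I
        (C.wordProd (reducedWord (fun s => ι (C.gs s)) (longest (fun s => ι (C.gs s)) I))) := by
  obtain ⟨w, hw⟩ := C.exists_isLongest I
  have h1 : IsLongest (fun s => ι (C.gs s)) I (longest (fun s => ι (C.gs s)) I) :=
    Classical.epsilon_spec (p := IsLongest (fun s => ι (C.gs s)) I)
      ⟨_, (C.isLongest_overgroup hι).2 hw⟩
  generalize longest (fun s => ι (C.gs s)) I = w' at *
  obtain ⟨u, hu, rfl⟩ : w' ∈ (C.para I).map ι := by
    rw [← C.closure_overgroup]
    exact h1.1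
  obtain ⟨r, rfl, hr⟩ := C.exists_reduced u
  have h2 := Classical.epsilon_spec (p := fun l : List B =>
    (l.map fun s => ι (C.gs s)).prod = ι (C.wordProd r) ∧
      l.length = wordLength (fun s => ι (C.gs s)) (ι (C.wordProd r)))
    ⟨r, C.map_prod_overgroup r, by rw [C.wordLength_overgroup hι, hr]⟩
  change (List.map _ (reducedWord _ _)).prod = _ ∧ (reducedWord _ _).length = _ at h2
  rw [C.map_prod_overgroup, C.wordLength_overgroup hι, hι.eq_iff] at h2
  rw [IsReduced, h2.1]
  exact ⟨h2.2, (C.isLongest_overgroup hι).1 h1⟩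

theorem isBarTop_piBarW (hι : Function.Injective ι) [Finite W] (F : Type*) [Field F] (I : Set B) :
    IsBarTop I (piBarW F M (fun s => ι (C.gs s)) (longest (fun s => ι (C.gs s)) I)) :=
  C.isBarTop_prod (C.longest_overgroup hι I).1 (C.longest_overgroup hι I).2

theorem isPiTop_piW (hι : Function.Injective ι) [Finite W] (F : Type*) [Field F] (L : Set B) :
    IsPiTop L (piW F M (fun s => ι (C.gs s)) (longest (fun s => ι (C.gs s)) L)) :=
  C.isPiTop_prod (C.longest_overgroup hι L).1 (C.longest_overgroup hι L).2

end Overgroup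

end DescentSystem

/-! ### The modules `P^D_α` as left ideals and as direct sums -/

section TypeD

variable (F : Type*) [Field F]

theorem isBarTop_piBarW_coxD {n : ℕ} (hn : 2 ≤ n) (I : Set (Fin n)) : HeckeZero.IsBarTop I
    (piBarW F (coxD n) (fun i : Fin n => sD i) (longest (fun i : Fin n => sD i) I)) := by
  have := finite_groupD hn
  exact (systemD n).isBarTop_piBarW (groupD n).subtype_injective F I

theorem isPiTop_piW_coxD {n : ℕ} (hn : 2 ≤ n) (L : Set (Fin n)) : HeckeZero.IsPiTop L
    (piW F (coxD n) (fun i : Fin n => sD i) (longest (fun i : Fin n => sD i) L)) := by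
  have := finite_groupD hn
  exact (systemD n).isPiTop_piW (groupD n).subtype_injective F L

theorem genBar_smul_vecD {n : ℕ} (hn : 2 ≤ n) {α : GenPseudoRibbon} (i : Fin n)
    (τ : TableauD n α) : (HeckeZero.genBar F i : HeckeD F n) • vecD F τ = actD F n α i τ := by
  rw [genBar_smul_PD F hn, opD_vecD]

theorem genBar_smul_vecA {m : ℕ} {β : Ribbon} (i : Fin (m - 1)) (τ : TableauA m β) :
    (HeckeZero.genBar F i : HeckeA F m) • vecA F τ = actA F m β (i + 1) τ := by
  rw [genBar_smul_PA F, opA_vecA]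

namespace PseudoRibbon

theorem ups_toGen (α : PseudoRibbon) : α.toGen.ups = descents α.parts := GenPseudoRibbon.ups_nil α

theorem breaks_toGen (α : PseudoRibbon) : α.toGen.breaks = ∅ := GenPseudoRibbon.breaks_nil α

/-- `P^D_α` is the module of the elements with descent set `D(α)`. -/
theorem isTableauModelD {n : ℕ} (hn : 2 ≤ n) (α : PseudoRibbon) :
    (systemD n).IsTableauModel {i : Fin n | (i : ℕ) ∈ descents α.parts}
      {i : Fin n | (i : ℕ) ∈ descents α.parts}ᶜ (basisD F n α.toGen) (TableauD.word hn)
      (opD F n α.toGen) := by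
  have h := _root_.isTableauModelD F hn α.toGen
  simp only [ups_toGen, breaks_toGen, Finset.notMem_empty, not_false_iff, and_true] at h
  exact h

theorem nonempty_equiv_moduleI {n : ℕ} (hn : 2 ≤ n) (α : PseudoRibbon) :
    Nonempty (PD F n α.toGen ≃ₗ[HeckeD F n]
      moduleI F (coxD n) (fun i : Fin n => sD i) {i : Fin n | (i : ℕ) ∈ descents α.parts}) :=
  ⟨(α.isTableauModelD F hn).idealEquiv (systemD n) (genBar_smul_PD F hn)
    (isBarTop_piBarW_coxD F hn _) (isPiTop_piW_coxD F hn _)⟩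

end PseudoRibbon

namespace GenPseudoRibbon

theorem nonempty_equiv_moduleIJ (α : GenPseudoRibbon) (hn : 2 ≤ α.size) :
    Nonempty (PD F α.size α ≃ₗ[HeckeD F α.size]
      moduleIJ F (coxD α.size) (fun i : Fin α.size => sD i)
        {i : Fin α.size | (i : ℕ) ∈ descents α.near.parts}
        {j : Fin α.size | (j : ℕ) ∈ descents α.nearOnes.parts}) := by
  have h1 : {i : Fin α.size | (i : ℕ) ∈ descents α.near.parts} =
      {i : Fin α.size | (i : ℕ) ∈ α.ups} := by
    rw [descents_near]
  -- The set `J` consists of all indices that are not breaks, so `J \ I` is the set of forced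
  -- ascents.
  have h2 : {j : Fin α.size | (j : ℕ) ∈ descents α.nearOnes.parts} \
      {i : Fin α.size | (i : ℕ) ∈ descents α.near.parts} =
      {i : Fin α.size | (i : ℕ) ∉ α.ups ∧ (i : ℕ) ∉ α.breaks} := by
    ext i
    simp [mem_descents_nearOnes, descents_near, and_comm]
  rw [moduleIJ, h2, h1]
  exact ⟨(isTableauModelD F hn α).idealEquiv (systemD α.size) (genBar_smul_PD F hn)
    (isBarTop_piBarW_coxD F hn _) (isPiTop_piW_coxD F hn _)⟩

/-- Elements of the class of `α` may have any descents at the breaks. Each choice gives the descent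
set of exactly one `β ∈ [α]`, so the classes of these `β` partition that of `α`. -/
theorem nonempty_equiv_glue (α : GenPseudoRibbon) (hn : 2 ≤ α.size) :
    Nonempty (PD F α.size α ≃ₗ[HeckeD F α.size]
      ⨁ β : α.glue, PD F α.size (β : PseudoRibbon).toGen) := by
  classical
  have := finite_groupD hn
  have : Finite α.glue := α.finite_glue
  refine (systemD α.size).nonempty_equiv_directSum (isTableauModelD F hn α)
    (genBar_smul_PD F hn) (fun γ : α.glue => γ.1.isTableauModelD F hn)
    (fun _ => genBar_smul_PD F hn) ?_ ?_ ?_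
  · rintro ⟨γ, hγ⟩ w ⟨h1, h2⟩
    rw [mem_glue_iff] at hγ
    refine ⟨fun s hs => h1 s (hγ.2.1 hs), fun s hs => h2 s fun hs' => ?_⟩
    rcases Finset.mem_union.1 (hγ.2.2 hs') with h | h
    · exact hs.1 h
    · exact hs.2 h
  · rintro ⟨γ, hγ⟩ ⟨δ, hδ⟩ w ⟨h1, h2⟩ ⟨h3, h4⟩
    rw [mem_glue_iff] at hγ hδ
    refine Subtype.ext (PseudoRibbon.ext_of_descents (hγ.1.trans hδ.1.symm) ?_)
    ext i
    constructor
    · intro hi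
      by_contra hi'
      have hin : i < α.size := hγ.1 ▸ PseudoRibbon.lt_size hi
      exact h4 ⟨i, hin⟩ hi' (h1 ⟨i, hin⟩ hi)
    · intro hi
      by_contra hi'
      have hin : i < α.size := hδ.1 ▸ PseudoRibbon.lt_size hi
      exact h2 ⟨i, hin⟩ hi' (h3 ⟨i, hin⟩ hi)
  · rintro w ⟨h1, h2⟩
    obtain ⟨γ, hγ, hD⟩ := exists_mem_glue (α := α)
      (D := (Finset.range α.size).filter fun i => ∃ h : i < α.size, (systemD α.size).desc ⟨i, h⟩ w)
      (fun i hi => Finset.mem_filter.2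
        ⟨Finset.mem_range.2 (lt_size_of_mem_ups hi), lt_size_of_mem_ups hi, h1 ⟨i, _⟩ hi⟩)
      (fun i hi => by
        obtain ⟨-, h, hd⟩ := Finset.mem_filter.1 hi
        by_contra hc
        rw [Finset.mem_union, not_or] at hc
        exact h2 ⟨i, h⟩ hc hd)
    refine ⟨⟨γ, hγ⟩, fun i hi => ?_, fun i hi hd => hi ?_⟩
    · change (i : ℕ) ∈ descents γ.parts at hi
      rw [hD] at hi
      exact (Finset.mem_filter.1 hi).2.2
    · change (i : ℕ) ∈ descents γ.parts
      rw [hD]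
      exact Finset.mem_filter.2 ⟨Finset.mem_range.2 i.2, i.2, hd⟩

end GenPseudoRibbon

end TypeD

theorem List.prod_ofFn_eq_single {A : Type*} [Monoid A] {r : ℕ} {f : Fin r → A} (b : Fin r)
    (h : ∀ c, c ≠ b → f c = 1) : (List.ofFn f).prod = f b := by
  induction r with
  | zero => exact b.elim0
  | succ r ih =>
    rw [List.ofFn_succ, List.prod_cons]
    cases b using Fin.cases with
    | zero =>
      rw [List.prod_eq_one, mul_one]
      intro x hx
      obtain ⟨c, rfl⟩ := List.mem_ofFn.1 hx
      exact h _ (Fin.succ_ne_zero c)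
    | succ b =>
      rw [h 0 (Fin.succ_ne_zero b).symm, one_mul]
      exact ih b fun c hc => h _ ((Fin.succ_injective r).ne hc)

namespace DescentSystem

open HeckeZero

variable {B : Type*} {M : CoxeterMatrix B} {W : Type*} [Group W] (C : DescentSystem M W)

/-! ### Products of elements of disjoint parabolic subgroups -/

theorem prod_ofFn_mem_para {r : ℕ} {J : Fin r → Set B} {w : Fin r → W}
    (hw : ∀ b, w b ∈ C.para (J b)) : (List.ofFn w).prod ∈ C.para (⋃ b, J b) := by
  refine Subgroup.list_prod_mem _ fun x hx => ?_
  obtain ⟨b, rfl⟩ := List.mem_ofFn.1 hx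
  exact C.para_mono (Set.subset_iUnion J b) (hw b)

theorem disjoint_zero_iUnion_succ {r : ℕ} {J : Fin (r + 1) → Set B}
    (hJ : Pairwise fun b c => Disjoint (J b) (J c)) : Disjoint (J 0) (⋃ b : Fin r, J b.succ) :=
  Set.disjoint_iUnion_right.2 fun b => hJ (Fin.succ_ne_zero b).symm

/-- Disjointness of the generating sets makes each factor minimal with respect to the later ones, so
the lengths add. -/
theorem piBar_prod_ofFn (F : Type*) [Field F] {r : ℕ} {J : Fin r → Set B}
    (hJ : Pairwise fun b c => Disjoint (J b) (J c)) {w : Fin r → W}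
    (hw : ∀ b, w b ∈ C.para (J b)) :
    (List.ofFn fun b => C.piBar F (w b)).prod = C.piBar F (List.ofFn w).prod := by
  induction r with
  | zero => simp
  | succ r ih =>
    rw [List.ofFn_succ, List.prod_cons, List.ofFn_succ, List.prod_cons,
      ih (J := fun b => J b.succ) (fun b c h => hJ ((Fin.succ_injective r).ne h))
        (fun b => hw b.succ)]
    exact (C.isMin_of_mem_para (disjoint_zero_iUnion_succ hJ) (hw 0)).piBar_mul C
      (C.prod_ofFn_mem_para fun b => hw b.succ)

theorem prod_ofFn_inj {r : ℕ} {J : Fin r → Set B}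
    (hJ : Pairwise fun b c => Disjoint (J b) (J c)) {w w' : Fin r → W}
    (hw : ∀ b, w b ∈ C.para (J b)) (hw' : ∀ b, w' b ∈ C.para (J b))
    (h : (List.ofFn w).prod = (List.ofFn w').prod) : w = w' := by
  induction r with
  | zero => exact Subsingleton.elim _ _
  | succ r ih =>
    rw [List.ofFn_succ, List.prod_cons, List.ofFn_succ, List.prod_cons] at h
    have hd := disjoint_zero_iUnion_succ hJ
    have h1 := (C.isMin_of_mem_para hd (hw 0)).mul_inj C (C.isMin_of_mem_para hd (hw' 0))
      (C.prod_ofFn_mem_para fun b => hw b.succ) (C.prod_ofFn_mem_para fun b => hw' b.succ) h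
    have h2 := ih (J := fun b => J b.succ) (fun b c h => hJ ((Fin.succ_injective r).ne h))
      (fun b => hw b.succ) (fun b => hw' b.succ) h1.2
    funext b
    cases b using Fin.cases with
    | zero => exact h1.1
    | succ b => exact congrFun h2 b

end DescentSystem

namespace HeckeZero

variable {F : Type*} [Field F] {B : Type*} {M : CoxeterMatrix B}

/-! ### Products of commuting top elements -/

theorem range_map {B' : Type*} {M' : CoxeterMatrix B'} (φ : B' → B)
    (hM : ∀ s t, M (φ s) (φ t) = M' s t) :
    (HeckeZero.map φ hM : HeckeZero F M' →ₐ[F] HeckeZero F M).range =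
      Algebra.adjoin F (gen F '' Set.range φ) := by
  rw [← Algebra.map_top, ← adjoin_gen, AlgHom.map_adjoin, ← Set.range_comp, ← Set.range_comp]
  congr 2
  ext1 s
  exact map_gen φ hM s

theorem commute_of_mem_closure {I : Set B} {x e : HeckeZero F M}
    (he : e ∈ Submonoid.closure (genBar F '' I)) (h : ∀ s ∈ I, Commute x (genBar F s)) :
    Commute x e := by
  induction he using Submonoid.closure_induction with
  | mem y hy => obtain ⟨s, hs, rfl⟩ := hy; exact h s hs
  | one => exact Commute.one_right x
  | mul a b _ _ ha hb => exact ha.mul_right hb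

theorem commute_of_mem_closure_gen {L : Set B} {x g : HeckeZero F M}
    (hg : g ∈ Submonoid.closure (gen F '' L)) (h : ∀ s ∈ L, Commute x (genBar F s)) :
    Commute x g := by
  induction hg using Submonoid.closure_induction with
  | mem y hy =>
    obtain ⟨s, hs, rfl⟩ := hy
    rw [gen_eq]
    exact (h s hs).add_right (Commute.one_right x)
  | one => exact Commute.one_right x
  | mul a b _ _ ha hb => exact ha.mul_right hb

theorem IsBarTop.map {B' : Type*} {M' : CoxeterMatrix B'} (φ : B' → B)
    (hM : ∀ s t, M (φ s) (φ t) = M' s t) {I : Set B'} {e : HeckeZero F M'} (h : IsBarTop I e) :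
    IsBarTop (φ '' I) (HeckeZero.map φ hM e) where
  mem := by
    have := Submonoid.mem_map_of_mem (HeckeZero.map φ hM).toRingHom.toMonoidHom h.mem
    rw [MonoidHom.map_mclosure] at this
    refine Submonoid.closure_mono ?_ this
    rintro _ ⟨_, ⟨s, hs, rfl⟩, rfl⟩
    exact ⟨φ s, ⟨s, hs, rfl⟩, (map_genBar φ hM s).symm⟩
  left := by
    rintro _ ⟨s, hs, rfl⟩
    rw [← map_genBar φ hM, ← map_mul, h.left s hs, map_neg]
  right := by
    rintro _ ⟨s, hs, rfl⟩
    rw [← map_genBar φ hM, ← map_mul, h.right s hs, map_neg]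

theorem IsPiTop.map {B' : Type*} {M' : CoxeterMatrix B'} (φ : B' → B)
    (hM : ∀ s t, M (φ s) (φ t) = M' s t) {L : Set B'} {g : HeckeZero F M'} (h : IsPiTop L g) :
    IsPiTop (φ '' L) (HeckeZero.map φ hM g) where
  mem := by
    have := Submonoid.mem_map_of_mem (HeckeZero.map φ hM).toRingHom.toMonoidHom h.mem
    rw [MonoidHom.map_mclosure] at this
    refine Submonoid.closure_mono ?_ this
    rintro _ ⟨_, ⟨s, hs, rfl⟩, rfl⟩
    exact ⟨φ s, ⟨s, hs, rfl⟩, (map_gen φ hM s).symm⟩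
  left := by
    rintro _ ⟨s, hs, rfl⟩
    rw [← map_genBar φ hM, ← map_mul, h.left s hs, map_zero]
  right := by
    rintro _ ⟨s, hs, rfl⟩
    rw [← map_genBar φ hM, ← map_mul, h.right s hs, map_zero]

/-- Working with the characteristic properties avoids identifying the longest element of a product
of commuting parabolic subgroups. -/
theorem IsBarTop.mul {I I' : Set B} {e e' : HeckeZero F M} (h : IsBarTop I e)
    (h' : IsBarTop I' e')
    (hc : ∀ s ∈ I, ∀ t ∈ I', Commute (genBar F s : HeckeZero F M) (genBar F t)) :
    IsBarTop (I ∪ I') (e * e') where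
  mem := mul_mem (Submonoid.closure_mono (Set.image_mono Set.subset_union_left) h.mem)
    (Submonoid.closure_mono (Set.image_mono Set.subset_union_right) h'.mem)
  left := by
    rintro s (hs | hs)
    · rw [← mul_assoc, h.left s hs, neg_mul]
    · rw [← mul_assoc, (commute_of_mem_closure h.mem fun t ht => (hc t ht s hs).symm).eq,
        mul_assoc, h'.left s hs, mul_neg]
  right := by
    rintro s (hs | hs)
    · rw [mul_assoc, ← (commute_of_mem_closure h'.mem fun t ht => hc s hs t ht).eq,
        ← mul_assoc, h.right s hs, neg_mul]
    · rw [mul_assoc, h'.right s hs, mul_neg]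

theorem IsPiTop.mul {L L' : Set B} {g g' : HeckeZero F M} (h : IsPiTop L g)
    (h' : IsPiTop L' g')
    (hc : ∀ s ∈ L, ∀ t ∈ L', Commute (genBar F s : HeckeZero F M) (genBar F t)) :
    IsPiTop (L ∪ L') (g * g') where
  mem := mul_mem (Submonoid.closure_mono (Set.image_mono Set.subset_union_left) h.mem)
    (Submonoid.closure_mono (Set.image_mono Set.subset_union_right) h'.mem)
  left := by
    rintro s (hs | hs)
    · rw [← mul_assoc, h.left s hs, zero_mul]
    · rw [← mul_assoc, (commute_of_mem_closure_gen h.mem fun t ht => (hc t ht s hs).symm).eq,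
        mul_assoc, h'.left s hs, mul_zero]
  right := by
    rintro s (hs | hs)
    · rw [mul_assoc, ← (commute_of_mem_closure_gen h'.mem fun t ht => hc s hs t ht).eq,
        ← mul_assoc, h.right s hs, zero_mul]
    · rw [mul_assoc, h'.right s hs, mul_zero]

theorem _root_.Set.iUnion_fin_succ {X : Type*} {r : ℕ} (I : Fin (r + 1) → Set X) :
    ⋃ b, I b = I 0 ∪ ⋃ b : Fin r, I b.succ := by
  ext x
  simp [Fin.exists_fin_succ]

theorem IsBarTop.prod_ofFn {r : ℕ} {I : Fin r → Set B} {e : Fin r → HeckeZero F M}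
    (h : ∀ b, IsBarTop (I b) (e b))
    (hc : ∀ b c, b ≠ c → ∀ s ∈ I b, ∀ t ∈ I c,
      Commute (genBar F s : HeckeZero F M) (genBar F t)) :
    IsBarTop (⋃ b, I b) (List.ofFn e).prod := by
  induction r with
  | zero => exact ⟨by simp [one_mem], by simp, by simp⟩
  | succ r ih =>
    rw [Set.iUnion_fin_succ, List.ofFn_succ, List.prod_cons]
    refine (h 0).mul (ih (fun b => h b.succ)
      fun b c hbc => hc _ _ ((Fin.succ_injective r).ne hbc)) fun s hs t ht => ?_
    obtain ⟨b, ht⟩ := Set.mem_iUnion.1 ht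
    exact hc _ _ (Fin.succ_ne_zero b).symm s hs t ht

theorem IsPiTop.prod_ofFn {r : ℕ} {L : Fin r → Set B} {g : Fin r → HeckeZero F M}
    (h : ∀ b, IsPiTop (L b) (g b))
    (hc : ∀ b c, b ≠ c → ∀ s ∈ L b, ∀ t ∈ L c,
      Commute (genBar F s : HeckeZero F M) (genBar F t)) :
    IsPiTop (⋃ b, L b) (List.ofFn g).prod := by
  induction r with
  | zero => exact ⟨by simp [one_mem], by simp, by simp⟩
  | succ r ih =>
    rw [Set.iUnion_fin_succ, List.ofFn_succ, List.prod_cons]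
    refine (h 0).mul (ih (fun b => h b.succ)
      fun b c hbc => hc _ _ ((Fin.succ_injective r).ne hbc)) fun s hs t ht => ?_
    obtain ⟨b, ht⟩ := Set.mem_iUnion.1 ht
    exact hc _ _ (Fin.succ_ne_zero b).symm s hs t ht

end HeckeZero

/-! ### Tensor products of linear maps over a field -/

/-- Over a field each injective factor has a linear left inverse, and the tensor product of these is
a left inverse. -/
theorem PiTensorProduct.map_injective_of_field {F ι : Type*} [Field F] {V V' : ι → Type*}
    [∀ b, AddCommGroup (V b)] [∀ b, Module F (V b)] [∀ b, AddCommGroup (V' b)]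
    [∀ b, Module F (V' b)] {f : ∀ b, V b →ₗ[F] V' b} (hf : ∀ b, Function.Injective (f b)) :
    Function.Injective (PiTensorProduct.map f) := by
  choose g hg using fun b =>
    (f b).exists_leftInverse_of_injective (LinearMap.ker_eq_bot.2 (hf b))
  have h : (PiTensorProduct.map g).comp (PiTensorProduct.map f) = LinearMap.id := by
    rw [← PiTensorProduct.map_comp]
    simp only [hg]
    exact PiTensorProduct.map_id
  exact fun x y hxy => by
    rw [← LinearMap.id_apply (R := F) x, ← LinearMap.id_apply (R := F) y, ← h,
      LinearMap.comp_apply, LinearMap.comp_apply, hxy]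

namespace GenPseudoRibbon

open HeckeZero

variable (α : GenPseudoRibbon)

/-! ### The generators of the parabolic subalgebra -/

theorem offset_length : α.offset α.tail.length = α.size := by
  rw [offset, size, List.take_of_length_le (by simp)]

theorem head_size_le_offset (b : ℕ) : α.head.size ≤ α.offset b := Nat.le_add_right _ _

theorem exists_offset_le {x : ℕ} (h1 : α.head.size ≤ x) (h2 : x < α.size) :
    ∃ b : Fin α.tail.length, α.offset b ≤ x ∧ x < α.offset (b + 1) := by
  classical
  have hex : ∃ b, x < α.offset b := ⟨_, α.offset_length.symm ▸ h2⟩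
  obtain ⟨b, hb⟩ : ∃ b, Nat.find hex = b + 1 := Nat.exists_eq_succ_of_ne_zero fun h0 => by
    have := Nat.find_spec hex
    rw [h0, offset, List.take_zero, List.sum_nil] at this
    omega
  have hlt := Nat.find_min' hex (α.offset_length.symm ▸ h2 : x < α.offset α.tail.length)
  refine ⟨⟨b, by omega⟩, not_lt.1 (Nat.find_min hex (by rw [hb]; exact Nat.lt_succ_self b)), ?_⟩
  rw [← hb]
  exact Nat.find_spec hex

theorem eq_of_offset_le {b c : Fin α.tail.length} {x : ℕ} (hb : α.offset b ≤ x)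
    (hb' : x < α.offset (b + 1)) (hc : α.offset c ≤ x) (hc' : x < α.offset (c + 1)) : b = c := by
  by_contra hne
  rcases lt_or_gt_of_ne (fun e => hne (Fin.ext e) : (b : ℕ) ≠ c) with h | h
  · have := α.offset_mono (show (b : ℕ) + 1 ≤ c from h)
    omega
  · have := α.offset_mono (show (c : ℕ) + 1 ≤ b from h)
    omega

/-- The indices of the generators of the first factor of the parabolic subalgebra. -/
def headIdx (i : Fin α.head.size) : Fin α.size := ⟨i, α.head_lt i⟩

/-- The indices of the generators of the other factors of the parabolic subalgebra. -/
def tailIdx (b : Fin α.tail.length) (i : Fin ((α.tail.get b).size - 1)) : Fin α.size :=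
  ⟨α.offset b + i + 1, α.tail_lt b i⟩

theorem headIdx_injective : Function.Injective α.headIdx := fun i j h =>
  Fin.ext (show (i : ℕ) = j from congrArg (fun x : Fin α.size => (x : ℕ)) h)

theorem tailIdx_injective (b : Fin α.tail.length) : Function.Injective (α.tailIdx b) :=
  fun i j h => by
    have := congrArg Fin.val h
    simp only [tailIdx] at this
    exact Fin.ext (by omega)

theorem tailIdx_lt (b : Fin α.tail.length) (i : Fin ((α.tail.get b).size - 1)) :
    α.offset b < α.tailIdx b i ∧ (α.tailIdx b i : ℕ) < α.offset (b + 1) := by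
  have := α.offset_succ b
  simp only [tailIdx]
  omega

theorem exists_tailIdx {b : Fin α.tail.length} {x : Fin α.size} (h1 : α.offset b < x)
    (h2 : (x : ℕ) < α.offset (b + 1)) : ∃ i, α.tailIdx b i = x := by
  have := α.offset_succ b
  exact ⟨⟨x - α.offset b - 1, by omega⟩, Fin.ext (by simp only [tailIdx]; omega)⟩

theorem disjoint_range_tailIdx :
    Pairwise fun b c => Disjoint (Set.range (α.tailIdx b)) (Set.range (α.tailIdx c)) := by
  intro b c hbc
  rw [Set.disjoint_left]
  rintro _ ⟨i, rfl⟩ ⟨j, h⟩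
  have h1 := α.tailIdx_lt b i
  have h2 := α.tailIdx_lt c j
  rw [h] at h2
  exact hbc (α.eq_of_offset_le h1.1.le h1.2 h2.1.le h2.2)

theorem disjoint_range_headIdx :
    Disjoint (Set.range α.headIdx) (⋃ b, Set.range (α.tailIdx b)) := by
  rw [Set.disjoint_iUnion_right]
  intro b
  rw [Set.disjoint_left]
  rintro _ ⟨i, rfl⟩ ⟨j, h⟩
  have h1 := α.tailIdx_lt b j
  have h2 := α.head_size_le_offset b
  rw [h] at h1
  have h3 : ((α.headIdx i : Fin α.size) : ℕ) < α.head.size := i.2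
  omega

theorem headIdx_notMem_breaks (i : Fin α.head.size) : (α.headIdx i : ℕ) ∉ α.breaks := by
  intro h
  have h1 : ((α.headIdx i : Fin α.size) : ℕ) < α.head.size := i.2
  have := (size_le_of_mem_breaks h).1
  omega

theorem tailIdx_notMem_breaks (b : Fin α.tail.length) (i : Fin ((α.tail.get b).size - 1)) :
    (α.tailIdx b i : ℕ) ∉ α.breaks := by
  intro h
  obtain ⟨c, hc⟩ := mem_breaks.1 h
  have h1 := α.tailIdx_lt b i
  have h2 := α.offset_succ c
  have h3 := (α.tail.get c).size_pos
  have := α.eq_of_offset_le h1.1.le h1.2 (b := b) (c := c) hc.le (by omega)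
  subst this
  omega

theorem exists_idx {x : Fin α.size} (hx : (x : ℕ) ∉ α.breaks) :
    (∃ i, α.headIdx i = x) ∨ ∃ b i, α.tailIdx b i = x := by
  rcases lt_or_ge (x : ℕ) α.head.size with h | h
  · exact Or.inl ⟨⟨x, h⟩, rfl⟩
  · obtain ⟨b, h1, h2⟩ := α.exists_offset_le h x.2
    exact Or.inr ⟨b, α.exists_tailIdx (lt_of_le_of_ne h1 fun e => hx (mem_breaks.2 ⟨b, e⟩)) h2⟩

theorem range_idx : Set.range α.headIdx ∪ ⋃ b, Set.range (α.tailIdx b) =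
    {j : Fin α.size | (j : ℕ) ∈ descents α.nearOnes.parts} := by
  ext x
  simp only [Set.mem_union, Set.mem_iUnion, Set.mem_range, Set.mem_ofPred_eq,
    mem_descents_nearOnes, x.2, true_and]
  refine ⟨?_, α.exists_idx⟩
  rintro (⟨i, rfl⟩ | ⟨b, i, rfl⟩)
  exacts [α.headIdx_notMem_breaks i, α.tailIdx_notMem_breaks b i]

theorem headIdx_mem_ups (i : Fin α.head.size) :
    (α.headIdx i : ℕ) ∈ α.ups ↔ (i : ℕ) ∈ descents α.head.parts := by
  rw [mem_ups]
  refine ⟨?_, Or.inl⟩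
  rintro (h | ⟨b, y, -, h⟩)
  · exact h
  · have h1 : ((α.headIdx i : Fin α.size) : ℕ) < α.head.size := i.2
    have := α.head_size_le_offset b
    omega

theorem tailIdx_mem_ups (b : Fin α.tail.length) (i : Fin ((α.tail.get b).size - 1)) :
    (α.tailIdx b i : ℕ) ∈ α.ups ↔ (i + 1 : ℕ) ∈ descents (α.tail.get b).parts := by
  rw [mem_ups]
  constructor
  · have h1 := α.tailIdx_lt b i
    rintro (h | ⟨c, y, hy, h⟩)
    · have := PseudoRibbon.lt_size h
      have := α.head_size_le_offset b
      omega
    · have h2 := Ribbon.lt_size hy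
      have h3 := α.offset_succ c
      obtain rfl := α.eq_of_offset_le h1.1.le h1.2 (b := b) (c := c) (by omega) (by omega)
      have h4 : α.offset b + y = α.offset b + i + 1 := h
      obtain rfl : y = i + 1 := by omega
      exact hy
  · exact fun h => Or.inr ⟨b, _, h, rfl⟩

theorem ups_eq : α.headIdx '' {i : Fin α.head.size | (i : ℕ) ∈ descents α.head.parts} ∪
    ⋃ b, α.tailIdx b '' {i | (i + 1 : ℕ) ∈ descents (α.tail.get b).parts} =
    {i : Fin α.size | (i : ℕ) ∈ α.ups} := by
  ext x
  simp only [Set.mem_union, Set.mem_iUnion, Set.mem_image, Set.mem_ofPred_eq]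
  constructor
  · rintro (⟨i, hi, rfl⟩ | ⟨b, i, hi, rfl⟩)
    exacts [(α.headIdx_mem_ups i).2 hi, (α.tailIdx_mem_ups b i).2 hi]
  · intro hx
    rcases α.exists_idx (Finset.disjoint_left.1 α.disjoint_ups_breaks hx) with
      ⟨i, rfl⟩ | ⟨b, i, rfl⟩
    exacts [Or.inl ⟨i, (α.headIdx_mem_ups i).1 hx, rfl⟩,
      Or.inr ⟨b, i, (α.tailIdx_mem_ups b i).1 hx, rfl⟩]

theorem notMem_ups_eq :
    α.headIdx '' {i : Fin α.head.size | (i : ℕ) ∈ descents α.head.parts}ᶜ ∪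
      ⋃ b, α.tailIdx b '' {i | (i + 1 : ℕ) ∉ descents (α.tail.get b).parts} =
    {i : Fin α.size | (i : ℕ) ∉ α.ups ∧ (i : ℕ) ∉ α.breaks} := by
  ext x
  simp only [Set.mem_union, Set.mem_iUnion, Set.mem_image, Set.mem_ofPred_eq, Set.mem_compl_iff]
  constructor
  · rintro (⟨i, hi, rfl⟩ | ⟨b, i, hi, rfl⟩)
    exacts [⟨mt (α.headIdx_mem_ups i).1 hi, α.headIdx_notMem_breaks i⟩,
      ⟨mt (α.tailIdx_mem_ups b i).1 hi, α.tailIdx_notMem_breaks b i⟩]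
  · rintro ⟨hx, hx'⟩
    rcases α.exists_idx hx' with ⟨i, rfl⟩ | ⟨b, i, rfl⟩
    exacts [Or.inl ⟨i, mt (α.headIdx_mem_ups i).2 hx, rfl⟩,
      Or.inr ⟨b, i, mt (α.tailIdx_mem_ups b i).2 hx, rfl⟩]

/-! ### The embedding of the parabolic tensor product -/

variable (F : Type*) [Field F]

theorem coxD_headIdx (s t : Fin α.head.size) :
    coxD α.size (α.headIdx s) (α.headIdx t) = coxD α.head.size s t := by
  simp [coxD, Fin.ext_iff, headIdx]

theorem coxD_tailIdx (b : Fin α.tail.length) (s t : Fin ((α.tail.get b).size - 1)) :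
    coxD α.size (α.tailIdx b s) (α.tailIdx b t) =
      CoxeterMatrix.A ((α.tail.get b).size - 1) s t := by
  simp only [coxD, CoxeterMatrix.A, Matrix.of_apply, Fin.ext_iff, tailIdx]
  grind

theorem headHom_genBar (i : Fin α.head.size) :
    α.headHom F (genBar F i) = genBar F (α.headIdx i) := HeckeZero.map_genBar _ α.coxD_headIdx i

theorem tailHom_genBar (b : Fin α.tail.length) (i : Fin ((α.tail.get b).size - 1)) :
    α.tailHom F b (genBar F i) = genBar F (α.tailIdx b i) :=
  HeckeZero.map_genBar _ (α.coxD_tailIdx b) i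

theorem commute_genBar_head (h : 2 ≤ α.head.size) (b : Fin α.tail.length)
    {s t : Fin α.size} (hs : s ∈ Set.range α.headIdx) (ht : t ∈ Set.range (α.tailIdx b)) :
    Commute (genBar F s : HeckeD F α.size) (genBar F t) := by
  obtain ⟨s, rfl⟩ := hs
  obtain ⟨t, rfl⟩ := ht
  rw [← headHom_genBar, ← tailHom_genBar]
  exact α.commute_head F h b _ _

theorem commute_genBar_tail {b c : Fin α.tail.length} (hbc : b ≠ c)
    {s t : Fin α.size} (hs : s ∈ Set.range (α.tailIdx b)) (ht : t ∈ Set.range (α.tailIdx c)) :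
    Commute (genBar F s : HeckeD F α.size) (genBar F t) := by
  obtain ⟨s, rfl⟩ := hs
  obtain ⟨t, rfl⟩ := ht
  rw [← tailHom_genBar, ← tailHom_genBar]
  exact α.commute_tail F hbc _ _

theorem parHom_tmul (h : 2 ≤ α.head.size) (x : HeckeD F α.head.size)
    (a : ∀ b : Fin α.tail.length, HeckeA F (α.tail.get b).size) :
    α.parHom F h (x ⊗ₜ PiTensorProduct.tprod F a) =
      α.headHom F x * (List.ofFn fun b => α.tailHom F b (a b)).prod := by
  rw [parHom, Algebra.TensorProduct.lift_tmul, tailsHom_tprod]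

theorem parHom_tmul_one (h : 2 ≤ α.head.size) (x : HeckeD F α.head.size) :
    α.parHom F h (x ⊗ₜ 1) = α.headHom F x := by
  rw [parHom, Algebra.TensorProduct.lift_tmul, map_one, mul_one]

theorem parHom_single (h : 2 ≤ α.head.size) (b : Fin α.tail.length)
    (x : HeckeA F (α.tail.get b).size) :
    α.parHom F h (1 ⊗ₜ PiTensorProduct.tprod F (Pi.mulSingle b x)) = α.tailHom F b x := by
  rw [parHom_tmul, map_one, one_mul, List.prod_ofFn_eq_single b, Pi.mulSingle_eq_same]
  intro c hc
  rw [Pi.mulSingle_eq_of_ne hc, map_one]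

theorem exists_parHom_eq_gen (h : 2 ≤ α.head.size) {j : Fin α.size}
    (hj : (j : ℕ) ∈ descents α.nearOnes.parts) : ∃ x, α.parHom F h x = gen F j := by
  change j ∈ {j : Fin α.size | (j : ℕ) ∈ descents α.nearOnes.parts} at hj
  rw [← range_idx] at hj
  rcases hj with ⟨i, rfl⟩ | hj
  · exact ⟨_, (α.parHom_tmul_one F h (gen F i)).trans (HeckeZero.map_gen _ α.coxD_headIdx i)⟩
  · obtain ⟨b, i, rfl⟩ := Set.mem_iUnion.1 hj
    exact ⟨_, (α.parHom_single F h b (gen F i)).trans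
      (HeckeZero.map_gen _ (α.coxD_tailIdx b) i)⟩

theorem range_parHom (h : 2 ≤ α.head.size) : (α.parHom F h).range = Algebra.adjoin F
    (gen F '' {j : Fin α.size | (j : ℕ) ∈ descents α.nearOnes.parts}) := by
  apply le_antisymm
  · have h0 : ∀ x, α.headHom F x ∈ Algebra.adjoin F
        (gen F '' {j : Fin α.size | (j : ℕ) ∈ descents α.nearOnes.parts}) := fun x => by
      have := AlgHom.mem_range_self (α.headHom F) x
      rw [headHom, HeckeZero.range_map] at this
      rw [← range_idx]
      exact Algebra.adjoin_mono (Set.image_mono Set.subset_union_left) this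
    have h1 : ∀ b x, α.tailHom F b x ∈ Algebra.adjoin F
        (gen F '' {j : Fin α.size | (j : ℕ) ∈ descents α.nearOnes.parts}) := fun b x => by
      have := AlgHom.mem_range_self (α.tailHom F b) x
      rw [tailHom, HeckeZero.range_map] at this
      rw [← range_idx]
      exact Algebra.adjoin_mono (Set.image_mono ((Set.subset_iUnion
        (fun b => Set.range (α.tailIdx b)) b).trans Set.subset_union_right)) this
    rintro _ ⟨x, rfl⟩
    change α.parHom F h x ∈ _
    induction x using TensorProduct.induction_on with
    | zero => rw [map_zero]; exact zero_mem _
    | add x y hx hy => rw [map_add]; exact add_mem hx hy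
    | tmul x y =>
      induction y using PiTensorProduct.induction_on with
      | smul_tprod r a =>
        rw [TensorProduct.tmul_smul, map_smul, parHom_tmul]
        refine Subalgebra.smul_mem _ (mul_mem (h0 x) (list_prod_mem fun z hz => ?_)) r
        obtain ⟨b, rfl⟩ := List.mem_ofFn.1 hz
        exact h1 b _
      | add y z hy hz => rw [TensorProduct.tmul_add, map_add]; exact add_mem hy hz
  · rw [Algebra.adjoin_le_iff]
    rintro _ ⟨j, hj, rfl⟩
    exact α.exists_parHom_eq_gen F h hj

/-- The parabolic subgroup of the first component. -/
abbrev headPara : Subgroup (groupD α.size) := (systemD α.size).para (Set.range α.headIdx)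

/-- The parabolic subgroups of the other components. -/
abbrev tailPara (b : Fin α.tail.length) : Subgroup (groupD α.size) :=
  (systemD α.size).para (Set.range (α.tailIdx b))

/-- The basis of the parabolic tensor product consisting of the tensors of the `π̄_w`. -/
noncomputable def parBasis :
    Module.Basis (α.headPara × ∀ b, α.tailPara b) F (α.ParAlg F) :=
  (((systemD α.size).sub α.headIdx α.headIdx_injective α.coxD_headIdx).basis F).tensorProduct
    (Basis.piTensorProduct fun b => ((systemD α.size).sub (α.tailIdx b) (α.tailIdx_injective b)
      (α.coxD_tailIdx b)).basis F)

/-- The product of a family of elements of the parabolic subgroups. -/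
def parElt (p : α.headPara × ∀ b, α.tailPara b) : groupD α.size :=
  p.1 * (List.ofFn fun b => (p.2 b : groupD α.size)).prod

theorem parElt_mem (p : α.headPara × ∀ b, α.tailPara b) : α.parElt p ∈ (systemD α.size).para
    {j : Fin α.size | (j : ℕ) ∈ descents α.nearOnes.parts} := by
  rw [← range_idx]
  exact mul_mem ((systemD α.size).para_mono Set.subset_union_left p.1.2)
    ((systemD α.size).para_mono Set.subset_union_right
      ((systemD α.size).prod_ofFn_mem_para fun b => (p.2 b).2))

theorem parElt_injective : Function.Injective α.parElt := by
  rintro ⟨p, q⟩ ⟨p', q'⟩ h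
  have h1 := ((systemD α.size).isMin_of_mem_para α.disjoint_range_headIdx p.2).mul_inj _
    ((systemD α.size).isMin_of_mem_para α.disjoint_range_headIdx p'.2)
    ((systemD α.size).prod_ofFn_mem_para fun b => (q b).2)
    ((systemD α.size).prod_ofFn_mem_para fun b => (q' b).2) h
  have h2 := (systemD α.size).prod_ofFn_inj α.disjoint_range_tailIdx (fun b => (q b).2)
    (fun b => (q' b).2) h1.2
  exact Prod.ext (Subtype.ext h1.1) (funext fun b => Subtype.ext (congrFun h2 b))

/-- The tensor basis goes to standard basis elements, since lengths add over disjoint parabolic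
subgroups. Both injectivity and the computation of the induced module rest on this. -/
theorem parHom_parBasis (h : 2 ≤ α.head.size) (p : α.headPara × ∀ b, α.tailPara b) :
    α.parHom F h (α.parBasis F p) = (systemD α.size).piBar F (α.parElt p) := by
  rw [parBasis, Module.Basis.tensorProduct_apply', Basis.piTensorProduct_apply, parHom_tmul]
  simp only [DescentSystem.basis_apply]
  have h1 := (systemD α.size).map_piBar (F := F) α.headIdx α.headIdx_injective α.coxD_headIdx p.1
  have h2 := fun b => (systemD α.size).map_piBar (F := F) (α.tailIdx b) (α.tailIdx_injective b)
    (α.coxD_tailIdx b) (p.2 b)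
  refine (congrArg₂ _ h1 (congrArg (fun f => (List.ofFn f).prod) (funext h2))).trans ?_
  rw [(systemD α.size).piBar_prod_ofFn F α.disjoint_range_tailIdx fun b => (p.2 b).2]
  exact ((systemD α.size).isMin_of_mem_para α.disjoint_range_headIdx p.1.2).piBar_mul _
    ((systemD α.size).prod_ofFn_mem_para fun b => (p.2 b).2)

theorem parHom_injective (h : 2 ≤ α.head.size) : Function.Injective (α.parHom F h) :=
  (systemD α.size).injective_of_basis (α.parHom F h) (α.parBasis F) α.parElt α.parElt_mem
    α.parElt_injective (α.parHom_parBasis F h)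

end GenPseudoRibbon

namespace GenPseudoRibbon

open HeckeZero

variable (α : GenPseudoRibbon) (F : Type*) [Field F]

/-! ### Induction from the parabolic tensor product -/

variable {α F}

/-- The pure tensors in `P^D_{α¹} ⊗ P_{α²} ⊗ ⋯ ⊗ P_{αᵏ}`. -/
noncomputable def pureTensor (v : PD F α.head.size α.head.toGen)
    (u : ∀ b : Fin α.tail.length, PA F (α.tail.get b).size (α.tail.get b)) : α.ParMod F :=
  (v ⊗ₜ PiTensorProduct.tprod F u : PD F α.head.size α.head.toGen ⊗[F]
    (⨂[F] b : Fin α.tail.length, PA F (α.tail.get b).size (α.tail.get b)))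

theorem smul_pureTensor (x : HeckeD F α.head.size)
    (a : ∀ b : Fin α.tail.length, HeckeA F (α.tail.get b).size)
    (v : PD F α.head.size α.head.toGen)
    (u : ∀ b : Fin α.tail.length, PA F (α.tail.get b).size (α.tail.get b)) :
    (x ⊗ₜ PiTensorProduct.tprod F a : α.ParAlg F) • pureTensor v u =
      pureTensor (x • v) fun b => a b • u b := by
  change α.parRep F (x ⊗ₜ PiTensorProduct.tprod F a) (pureTensor v u) = _
  rw [parRep]
  refine (TensorProduct.map_tmul _ _ _ _).trans ?_
  refine congrArg₂ _ rfl ?_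
  simp [tailsRep, PiTensorProduct.liftAlgHom]

/-- A tensor product of embeddings of the factors into the 0-Hecke algebras. -/
noncomputable def parEmb (θ : PD F α.head.size α.head.toGen →ₗ[F] HeckeD F α.head.size)
    (ϑ : ∀ b : Fin α.tail.length, PA F (α.tail.get b).size (α.tail.get b) →ₗ[F]
      HeckeA F (α.tail.get b).size) : α.ParMod F →ₗ[F] α.ParAlg F :=
  TensorProduct.map θ (PiTensorProduct.map ϑ)

section

variable {θ : PD F α.head.size α.head.toGen →ₗ[F] HeckeD F α.head.size}
  {ϑ : ∀ b : Fin α.tail.length, PA F (α.tail.get b).size (α.tail.get b) →ₗ[F]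
    HeckeA F (α.tail.get b).size}

theorem parEmb_pureTensor (v : PD F α.head.size α.head.toGen)
    (u : ∀ b : Fin α.tail.length, PA F (α.tail.get b).size (α.tail.get b)) :
    parEmb θ ϑ (pureTensor v u) =
      θ v ⊗ₜ PiTensorProduct.tprod F fun b => ϑ b (u b) :=
  (TensorProduct.map_tmul _ _ _ _).trans (by rw [PiTensorProduct.map_tprod])

theorem parEmb_injective (hθ : Function.Injective θ) (hϑ : ∀ b, Function.Injective (ϑ b)) :
    Function.Injective (parEmb θ ϑ) :=
  TensorProduct.map_injective_of_flat_flat _ _ hθ (PiTensorProduct.map_injective_of_field hϑ)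

theorem parMod_induction {p : α.ParMod F → Prop} (x : α.ParMod F)
    (tmul : ∀ (v : PD F α.head.size α.head.toGen)
      (u : ∀ b : Fin α.tail.length, PA F (α.tail.get b).size (α.tail.get b)),
      p (pureTensor v u))
    (zero : p 0) (add : ∀ x y, p x → p y → p (x + y)) : p x := by
  change PD F α.head.size α.head.toGen ⊗[F] _ at x
  induction x using TensorProduct.induction_on with
  | zero => exact zero
  | add x y hx hy => exact add x y hx hy
  | tmul v u =>
    induction u using PiTensorProduct.induction_on with
    | smul_tprod r u =>
      rw [← TensorProduct.smul_tmul]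
      exact tmul _ _
    | add u u' hu hu' =>
      rw [TensorProduct.tmul_add]
      exact add _ _ hu hu'

theorem parEmb_smul (hθ : ∀ x v, θ (x • v) = x * θ v) (hϑ : ∀ b x v, ϑ b (x • v) = x * ϑ b v)
    (x : α.ParAlg F) (v : α.ParMod F) : parEmb θ ϑ (x • v) = x * parEmb θ ϑ v := by
  induction v using parMod_induction with
  | zero => rw [smul_zero, map_zero, mul_zero]
  | add v v' hv hv' => rw [smul_add, map_add, hv, hv', map_add, mul_add]
  | tmul v u =>
    induction x using TensorProduct.induction_on with
    | zero =>
      exact (congrArg (parEmb θ ϑ) (zero_smul (α.ParAlg F) (pureTensor v u))).trans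
        ((map_zero _).trans (zero_mul _).symm)
    | add x y hx hy => rw [add_smul, map_add, hx, hy, add_mul]
    | tmul x a =>
      induction a using PiTensorProduct.induction_on with
      | smul_tprod r a =>
        rw [← TensorProduct.smul_tmul, smul_pureTensor, parEmb_pureTensor, parEmb_pureTensor,
          Algebra.TensorProduct.tmul_mul_tmul, PiTensorProduct.tprod_mul_tprod, hθ]
        simp only [hϑ]
        rfl
      | add a a' ha ha' => rw [TensorProduct.tmul_add, add_smul, map_add, ha, ha', add_mul]

theorem exists_parEmb_eq_mul {ε : HeckeD F α.head.size}
    {η : ∀ b : Fin α.tail.length, HeckeA F (α.tail.get b).size}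
    (hε : ∀ v, ∃ z, θ v = z * ε) (hη : ∀ b v, ∃ z, ϑ b v = z * η b) (v : α.ParMod F) :
    ∃ z, parEmb θ ϑ v = z * (ε ⊗ₜ PiTensorProduct.tprod F η : α.ParAlg F) := by
  induction v using parMod_induction with
  | zero => exact ⟨0, by rw [map_zero, zero_mul]⟩
  | add v v' hv hv' =>
    obtain ⟨z, hz⟩ := hv
    obtain ⟨z', hz'⟩ := hv'
    exact ⟨z + z', by rw [map_add, hz, hz', add_mul]⟩
  | tmul v u =>
    obtain ⟨z, hz⟩ := hε v
    choose y hy using fun b => hη b (u b)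
    refine ⟨z ⊗ₜ PiTensorProduct.tprod F y, ?_⟩
    rw [parEmb_pureTensor, Algebra.TensorProduct.tmul_mul_tmul,
      PiTensorProduct.tprod_mul_tprod, hz]
    simp only [hy]
    rfl

end

theorem isBarTop_par (h : 2 ≤ α.head.size) {e : HeckeD F α.head.size}
    {e' : ∀ b : Fin α.tail.length, HeckeA F (α.tail.get b).size}
    (he : IsBarTop {i : Fin α.head.size | (i : ℕ) ∈ descents α.head.parts} e)
    (he' : ∀ b, IsBarTop {i : Fin ((α.tail.get b).size - 1) |
      (i + 1 : ℕ) ∈ descents (α.tail.get b).parts} (e' b)) :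
    IsBarTop {i : Fin α.size | (i : ℕ) ∈ α.ups}
      (α.headHom F e * (List.ofFn fun b => α.tailHom F b (e' b)).prod) := by
  rw [← ups_eq]
  refine (he.map _ α.coxD_headIdx).mul (IsBarTop.prod_ofFn
    (fun b => (he' b).map _ (α.coxD_tailIdx b)) fun b c hbc s hs t ht =>
      α.commute_genBar_tail F hbc (Set.image_subset_range _ _ hs)
        (Set.image_subset_range _ _ ht)) fun s hs t ht => ?_
  obtain ⟨b, ht⟩ := Set.mem_iUnion.1 ht
  exact α.commute_genBar_head F h b (Set.image_subset_range _ _ hs)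
    (Set.image_subset_range _ _ ht)

theorem isPiTop_par (h : 2 ≤ α.head.size) {g : HeckeD F α.head.size}
    {g' : ∀ b : Fin α.tail.length, HeckeA F (α.tail.get b).size}
    (hg : IsPiTop {i : Fin α.head.size | (i : ℕ) ∈ descents α.head.parts}ᶜ g)
    (hg' : ∀ b, IsPiTop {i : Fin ((α.tail.get b).size - 1) |
      (i + 1 : ℕ) ∉ descents (α.tail.get b).parts} (g' b)) :
    IsPiTop {i : Fin α.size | (i : ℕ) ∉ α.ups ∧ (i : ℕ) ∉ α.breaks}
      (α.headHom F g * (List.ofFn fun b => α.tailHom F b (g' b)).prod) := by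
  rw [← notMem_ups_eq]
  refine (hg.map _ α.coxD_headIdx).mul (IsPiTop.prod_ofFn
    (fun b => (hg' b).map _ (α.coxD_tailIdx b)) fun b c hbc s hs t ht =>
      α.commute_genBar_tail F hbc (Set.image_subset_range _ _ hs)
        (Set.image_subset_range _ _ ht)) fun s hs t ht => ?_
  obtain ⟨b, ht⟩ := Set.mem_iUnion.1 ht
  exact α.commute_genBar_head F h b (Set.image_subset_range _ _ hs)
    (Set.image_subset_range _ _ ht)

theorem parHom_mul_tmul (h : 2 ≤ α.head.size) (e g : HeckeD F α.head.size)
    (e' g' : ∀ b : Fin α.tail.length, HeckeA F (α.tail.get b).size) :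
    α.parHom F h ((e * g) ⊗ₜ PiTensorProduct.tprod F fun b => e' b * g' b) =
      (α.headHom F e * (List.ofFn fun b => α.tailHom F b (e' b)).prod) *
        (α.headHom F g * (List.ofFn fun b => α.tailHom F b (g' b)).prod) := by
  rw [← parHom_tmul α F h e e', ← parHom_tmul α F h g g', ← map_mul,
    Algebra.TensorProduct.tmul_mul_tmul, PiTensorProduct.tprod_mul_tprod]
  rfl

-- Both sides are identified with the left ideal generated by the image of the tensor of the
-- elements `e g`, `e' b * g' b` of the factors. In the large algebra this image is a product of top
-- elements for the sets `I` and `L` of `α`, so `idealEquiv` treats `P^D_α` and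
-- `nonempty_equiv_induced` the induced module.
variable (α F) in
theorem nonempty_equiv_indMod (h : 2 ≤ α.head.size) :
    Nonempty (PD F α.size α ≃ₗ[HeckeD F α.size] α.IndMod F h) := by
  have hn : 2 ≤ α.size := h.trans (Nat.le_add_right _ _)
  have := finite_groupD h
  have := finite_groupA
  obtain ⟨e, he⟩ := (systemD α.head.size).exists_isBarTop F
    {i : Fin α.head.size | (i : ℕ) ∈ descents α.head.parts}
  obtain ⟨g, hg⟩ := (systemD α.head.size).exists_isPiTop F
    {i : Fin α.head.size | (i : ℕ) ∈ descents α.head.parts}ᶜ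
  choose e' he' using fun b : Fin α.tail.length => (systemA (α.tail.get b).size).exists_isBarTop F
    {i : Fin ((α.tail.get b).size - 1) | (i + 1 : ℕ) ∈ descents (α.tail.get b).parts}
  choose g' hg' using fun b : Fin α.tail.length => (systemA (α.tail.get b).size).exists_isPiTop F
    {i : Fin ((α.tail.get b).size - 1) | (i + 1 : ℕ) ∉ descents (α.tail.get b).parts}
  have hD := α.head.isTableauModelD F h
  have hA := fun b : Fin α.tail.length =>
    isTableauModelA F (α.tail.get b).size (α.tail.get b)
  -- Preimages of the generators of the factors. Their pure tensor shows that the generating tensor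
  -- lies in the image of `parEmb`.
  obtain ⟨v, hv⟩ := (hD.mem_range_emb _ he hg (e * g)).2 ⟨1, (one_mul _).symm⟩
  choose u hu using fun b => ((hA b).mem_range_emb _ (he' b) (hg' b) (e' b * g' b)).2
    ⟨1, (one_mul _).symm⟩
  obtain ⟨f⟩ := (systemD α.size).nonempty_equiv_induced (α.parHom F h) (α.parBasis F) α.parElt
    α.parElt_mem α.parElt_injective (α.parHom_parBasis F h)
    (fun s hs => by
      obtain ⟨x, hx⟩ := α.exists_parHom_eq_gen F h hs
      exact ⟨x - 1, by rw [map_sub, hx, map_one, genBar]⟩)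
    (parEmb (hD.embLin _ (genBar_smul_PD F h) hg |>.restrictScalars F)
      fun b => (hA b).embLin _ (genBar_smul_PA F) (hg' b) |>.restrictScalars F)
    (parEmb_injective (hD.emb_injective _ hg) fun b => (hA b).emb_injective _ (hg' b))
    (parEmb_smul (fun x v => map_smul (hD.embLin _ (genBar_smul_PD F h) hg) x v)
      fun b x v => map_smul ((hA b).embLin _ (genBar_smul_PA F) (hg' b)) x v)
    (ε := (e * g) ⊗ₜ PiTensorProduct.tprod F fun b => e' b * g' b)
    (exists_parEmb_eq_mul (fun v => (hD.mem_range_emb _ he hg _).1 ⟨v, rfl⟩)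
      fun b v => ((hA b).mem_range_emb _ (he' b) (hg' b) _).1 ⟨v, rfl⟩)
    ⟨pureTensor v u, by
      rw [parEmb_pureTensor]
      exact congrArg₂ _ hv (congrArg _ (funext hu))⟩
  have hspan := α.parHom_mul_tmul h e g e' g'
  exact ⟨((isTableauModelD F hn α).idealEquiv (systemD α.size) (genBar_smul_PD F hn)
    (isBarTop_par h he he') (isPiTop_par h hg hg')).trans
      ((LinearEquiv.ofEq _ _ (by rw [hspan])).trans f)⟩

end GenPseudoRibbon

theorem mainTheorem5 (F : Type*) [Field F] :
    -- (i) pseudo-ribbons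
    (∀ (n : ℕ) (α : PseudoRibbon), 2 ≤ n → α.size = n →
      (∀ (i : Fin n) (τ : TableauD n α.toGen),
        (HeckeZero.genBar F i : HeckeD F n) • vecD F τ = actD F n α.toGen i τ) ∧
      Nonempty (PD F n α.toGen ≃ₗ[HeckeD F n]
        moduleI F (coxD n) (fun i : Fin n => sD i) {i : Fin n | (i : ℕ) ∈ descents α.parts})) ∧
    -- (ii) generalized pseudo-ribbons
    (∀ α : GenPseudoRibbon, 2 ≤ α.size →
      (∀ (i : Fin α.size) (τ : TableauD α.size α),
        (HeckeZero.genBar F i : HeckeD F α.size) • vecD F τ = actD F α.size α i τ) ∧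
      Nonempty (PD F α.size α ≃ₗ[HeckeD F α.size]
        moduleIJ F (coxD α.size) (fun i : Fin α.size => sD i)
          {i : Fin α.size | (i : ℕ) ∈ descents α.near.parts}
          {j : Fin α.size | (j : ℕ) ∈ descents α.nearOnes.parts}) ∧
      Nonempty (PD F α.size α ≃ₗ[HeckeD F α.size]
        ⨁ β : α.glue, PD F α.size (β : PseudoRibbon).toGen) ∧
      ∀ h : 2 ≤ α.head.size,
        (∀ (b : Fin α.tail.length) (i : Fin ((α.tail.get b).size - 1))
          (τ : TableauA (α.tail.get b).size (α.tail.get b)),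
          (HeckeZero.genBar F i : HeckeA F (α.tail.get b).size) • vecA F τ =
            actA F (α.tail.get b).size (α.tail.get b) (i + 1) τ) ∧
        Function.Injective (α.parHom F h) ∧
        (α.parHom F h).range = Algebra.adjoin F
          (HeckeZero.gen F '' {j : Fin α.size | (j : ℕ) ∈ descents α.nearOnes.parts}) ∧
        Nonempty (PD F α.size α ≃ₗ[HeckeD F α.size] α.IndMod F h)) :=
  ⟨fun _ α hn _ => ⟨genBar_smul_vecD F hn, α.nonempty_equiv_moduleI F hn⟩,
    fun α hn => ⟨genBar_smul_vecD F hn, α.nonempty_equiv_moduleIJ F hn,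
      α.nonempty_equiv_glue F hn, fun h => ⟨fun _ => genBar_smul_vecA F,
        α.parHom_injective F h, α.range_parHom F h, α.nonempty_equiv_indMod F h⟩⟩⟩
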